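/- Let $n\ge 0$ and $R=\mathbb C[\hbar,\hbar^{-1}]$. Let $\mathbb W_{2n}$ be the polynomial Weyl algebra: the $R$-module $R[p_1,\dots,p_n,q_1,\dots,q_n]$ with the Moyal product $f\star g=m\big(\exp(\tfrac{\hbar}{2}\alpha)(f\otimes g)\big)$, where $m$ is the commutative multiplication and $\alpha=\sum_{s=1}^n(\partial_{p_s}\otimes\partial_{q_s}-\partial_{q_s}\otimes\partial_{p_s})$. All tensor products are over $R$. *Cochains.* For a unital $R$-algebra $A$ let $\overline C^k(A)=\operatorname{Hom}_R(A\otimes(A/R)^{\otimes k},R)$ be the normalized cochains, with $b:\overline C^k(A)\to\overline C^{k+1}(A)$ and $B:\overline C^{k+1}(A)\to\overline C^{k}(A)$ given by $$(b\varphi)(a_0,\dots,a_{k+1})=\sum_{i=0}^{k}(-1)^i\varphi(a_0,\dots,a_ia_{i+1},\dots,a_{k+1})+(-1)^{k+1}\varphi(a_{k+1}a_0,a_1,\dots,a_k),$$ $$(B\varphi)(a_0,\dots,a_{k})=\sum_{i=0}^{k}(-1)^{ik}\varphi(1,a_i,\dots,a_k,a_0,\dots,a_{i-1}).$$ The total complex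 is $\operatorname{Tot}^m=\bigoplus_{0\le i\le m/2}\overline C^{m-2i}(A)$ with differential $b+B$ (where $B=0$ on $\overline C^0(A)$). *The cochains $\tau_i$.* On $\mathbb W_{2n}^{\otimes(m+1)}$, with slots $0,\dots,m$, let $\alpha_{ij}$ be $\alpha$ acting on the slots $i$ and $j$, and let $\mu_m(a_0\otimes\cdots\otimes a_m)=a_0(0)\cdots a_m(0)$. Let $\Delta^m=\{0\le u_1\le\dots\le u_m\le1\}$ and $u_0=0$. For a set of slots $i_1<\dots<i_{2k}$, let $(\hbar\alpha)^{\wedge k}$ denote the normalized exterior power acting on these slots, $$(\hbar\alpha)^{\wedge k}=\frac{1}{2^kk!}\sum_{\sigma\in S_{2k}}\operatorname{sgn}(\sigma)\prod_{t=1}^{k}\hbar\,\alpha_{i_{\sigma(2t-1)}i_{\sigma(2t)}},$$ that is, the Pfaffian of the matrix $(\hbar\alpha_{i_ri_s})$ of commuting operators. Put $$\tau_{2k}(a)=(-1)^k\mu_{2k}\int_{\Delta^{2k}}\prod_{0\le i<j\le 2k}e^{\hbar(u_i-u_j+\frac12)\alpha_{ij}}\,\pi_{2k}(a)\,du_1\cdots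 du_{2k}\qquad(0\le k\le n),$$ where $\pi_{2k}=1\otimes(\hbar\alpha)^{\wedge k}$ acts by $(\hbar\alpha)^{\wedge k}$ on the slots $1,\dots,2k$, and $$\tau_{2k-1}(a)=(-1)^{k-1}\mu_{2k-1}\int_{\Delta^{2k-1}}\prod_{0\le i<j\le 2k-1}e^{\hbar(u_i-u_j+\frac12)\alpha_{ij}}\,(\hbar\alpha)^{\wedge k}(a)\,du_1\cdots du_{2k-1}\qquad(1\le k\le n),$$ where $(\hbar\alpha)^{\wedge k}$ acts on all the slots $0,\dots,2k-1$. **Theorem.** For $0\le i\le 2n$ one has $\tau_i\in\overline C^i(\mathbb W_{2n})$, and for all $1\le k\le n$ $$-B\tau_{2k}=\tau_{2k-1}=b\tau_{2k-2}.$$ Consequently $(\tau_0,\tau_2,\dots,\tau_{2n})\in\operatorname{Tot}^{2n}$ is a cocycle for $b+B$. It extends the Feigin–Felder–Shoikhet Hochschild cocycle: $\tau_{2n}=(-1)^n\tau^{\mathrm{FFS}}$ and $b\tau^{\mathrm{FFS}}=0$, where, with $(y_1,\dots,y_{2n})=(p_1,q_1,\dots,p_n,q_n)$, $$\tau^{\mathrm{FFS}}(a)=\mu_{2n}\int_{\Delta^{2n}}\prod_{0\le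 i<j\le 2n}e^{\hbar(u_i-u_j+\frac12)\alpha_{ij}}\;\hbar^n\sum_{\sigma\in S_{2n}}\operatorname{sgn}(\sigma)\,a_0\otimes\frac{\partial a_1}{\partial y_{\sigma(1)}}\otimes\cdots\otimes\frac{\partial a_{2n}}{\partial y_{\sigma(2n)}}\;du_1\cdots du_{2n}.$$ -/

import Mathlib

open scoped LaurentPolynomial Nat

noncomputable section

namespace WeylCyclic

/-! ## Exponentials of locally nilpotent operators -/

section LocallyNilpotent

variable {K : Type*} [CommRing K]
variable {M N : Type*} [AddCommGroup M] [Module K M] [AddCommGroup N] [Module K N]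

/-- An endomorphism is locally nilpotent if every vector is killed by some power of it. -/
def LocNil (T : Module.End K M) : Prop := ∀ x, ∃ r : ℕ, (T ^ r) x = 0

lemma pow_apply_zero_of_le {T : Module.End K M} {x : M} {r s : ℕ} (h : (T ^ r) x = 0)
    (hrs : r ≤ s) : (T ^ s) x = 0 := by
  obtain ⟨d, rfl⟩ := Nat.exists_eq_add_of_le hrs
  rw [add_comm, pow_add, Module.End.mul_apply, h, map_zero]

lemma pow_intertwine {T : Module.End K M} {T' : Module.End K N} (S : M →ₗ[K] N)
    (hS : ∀ x, S (T x) = T' (S x)) (r : ℕ) (x : M) : S ((T ^ r) x) = (T' ^ r) (S x) := by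
  induction r generalizing x with
  | zero => rfl
  | succ r ih => rw [pow_succ, pow_succ, Module.End.mul_apply, Module.End.mul_apply, ih, hS]

lemma LocNil.mul {A B : Module.End K M} (hAB : Commute A B) (hB : LocNil B) :
    LocNil (A * B) := fun x => by
  obtain ⟨r, hr⟩ := hB x
  exact ⟨r, by rw [hAB.mul_pow, Module.End.mul_apply, hr, map_zero]⟩

lemma LocNil.smul {A : Module.End K M} (hA : LocNil A) (c : K) : LocNil (c • A) := fun x => by
  obtain ⟨r, hr⟩ := hA x
  exact ⟨r, by rw [smul_pow, LinearMap.smul_apply, hr, smul_zero]⟩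

lemma LocNil.zero : LocNil (0 : Module.End K M) := fun x => ⟨1, by simp⟩

lemma LocNil.neg {A : Module.End K M} (hA : LocNil A) : LocNil (-A) := by
  have := hA.smul (-1); simpa using this

lemma add_pow_apply_zero {A B : Module.End K M} (hAB : Commute A B) {x : M} {r : ℕ}
    (hA : (A ^ r) x = 0) (hB : (B ^ r) x = 0) : ((A + B) ^ (r + r)) x = 0 := by
  rw [hAB.add_pow', LinearMap.sum_apply]
  refine Finset.sum_eq_zero fun p hp => ?_
  rw [Finset.HasAntidiagonal.mem_antidiagonal] at hp
  rw [LinearMap.smul_apply]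
  rcases le_or_gt r p.2 with h | h
  · rw [Module.End.mul_apply, pow_apply_zero_of_le hB h, map_zero, smul_zero]
  · rw [(hAB.pow_pow _ _).eq, Module.End.mul_apply,
      pow_apply_zero_of_le hA (by omega : r ≤ p.1), map_zero, smul_zero]

lemma LocNil.add {A B : Module.End K M} (hAB : Commute A B) (hA : LocNil A) (hB : LocNil B) :
    LocNil (A + B) := fun x => by
  obtain ⟨r, hr⟩ := hA x
  obtain ⟨s, hs⟩ := hB x
  exact ⟨_, add_pow_apply_zero hAB (pow_apply_zero_of_le hr (le_max_left r s))
    (pow_apply_zero_of_le hs (le_max_right r s))⟩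

lemma commute_sum_sub_sum_sub {σ τ : Type*} (S : Finset σ) (S' : Finset τ)
    (A B : σ → Module.End K M) (A' B' : τ → Module.End K M)
    (h1 : ∀ s t, Commute (A s) (A' t)) (h2 : ∀ s t, Commute (A s) (B' t))
    (h3 : ∀ s t, Commute (B s) (A' t)) (h4 : ∀ s t, Commute (B s) (B' t)) :
    Commute (∑ s ∈ S, (A s - B s)) (∑ t ∈ S', (A' t - B' t)) :=
  Commute.sum_left _ _ _ fun s _ => Commute.sum_right _ _ _ fun t _ =>
    ((h1 s t).sub_right (h2 s t)).sub_left ((h3 s t).sub_right (h4 s t))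

lemma LocNil.sum_sub {σ : Type*} (S : Finset σ) (A B : σ → Module.End K M)
    (h1 : ∀ s t, Commute (A s) (A t)) (h2 : ∀ s t, Commute (A s) (B t))
    (h3 : ∀ s t, Commute (B s) (B t)) (hA : ∀ s, LocNil (A s)) (hB : ∀ s, LocNil (B s)) :
    LocNil (∑ s ∈ S, (A s - B s)) := by
  classical
  induction S using Finset.induction_on with
  | empty => rw [Finset.sum_empty]; exact LocNil.zero
  | insert s S hs ih =>
    rw [Finset.sum_insert hs]
    refine LocNil.add (Commute.sum_right _ _ _ fun t _ => ?_) ?_ ih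
    · exact ((h1 s t).sub_right (h2 s t)).sub_left ((h2 t s).symm.sub_right (h3 s t))
    · rw [sub_eq_add_neg]
      exact LocNil.add (h2 s s).neg_right (hA s) (hB s).neg

variable [Algebra ℂ K]

/-- The power series `∑ r, T ^ r x / r!`; the sum has only finitely many nonzero terms
when `T` is locally nilpotent. -/
def expSeries (T : Module.End K M) (x : M) : M :=
  ∑ᶠ r : ℕ, algebraMap ℂ K ((r ! : ℂ)⁻¹) • (T ^ r) x

lemma expSeries_eq_sum {T : Module.End K M} {x : M} {r : ℕ} (h : (T ^ r) x = 0) :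
    expSeries T x = ∑ s ∈ Finset.range r, algebraMap ℂ K ((s ! : ℂ)⁻¹) • (T ^ s) x := by
  refine finsum_eq_sum_of_support_subset _ fun s hs => ?_
  by_contra hc
  refine hs ?_
  simp only [Finset.coe_range, Set.mem_Iio, not_lt] at hc
  simp only [pow_apply_zero_of_le h hc, smul_zero]

open Classical in
/-- The exponential of a locally nilpotent endomorphism, as an endomorphism, given by its power
series. (It is set to `0` for endomorphisms that are not locally nilpotent; this case does not
occur below.) -/
def expEnd (T : Module.End K M) : Module.End K M :=
  if h : LocNil T then
    { toFun := expSeries T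
      map_add' := fun x y => by
        obtain ⟨r, hr⟩ := h x
        obtain ⟨s, hs⟩ := h y
        have hx := pow_apply_zero_of_le hr (le_max_left r s)
        have hy := pow_apply_zero_of_le hs (le_max_right r s)
        have hxy : (T ^ max r s) (x + y) = 0 := by rw [map_add, hx, hy, add_zero]
        rw [expSeries_eq_sum hx, expSeries_eq_sum hy, expSeries_eq_sum hxy,
          ← Finset.sum_add_distrib]
        exact Finset.sum_congr rfl fun _ _ => by rw [map_add, smul_add]
      map_smul' := fun c x => by
        obtain ⟨r, hr⟩ := h x
        have hc : (T ^ r) (c • x) = 0 := by rw [map_smul, hr, smul_zero]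
        rw [expSeries_eq_sum hr, expSeries_eq_sum hc, RingHom.id_apply, Finset.smul_sum]
        exact Finset.sum_congr rfl fun _ _ => by rw [map_smul, smul_comm] }
  else 0

lemma expEnd_apply {T : Module.End K M} (h : LocNil T) (x : M) :
    expEnd T x = expSeries T x := by
  rw [expEnd, dif_pos h]; rfl

lemma expEnd_eq_sum {T : Module.End K M} (h : LocNil T) {x : M} {r : ℕ} (hr : (T ^ r) x = 0) :
    expEnd T x = ∑ s ∈ Finset.range r, algebraMap ℂ K ((s ! : ℂ)⁻¹) • (T ^ s) x := by
  rw [expEnd_apply h, expSeries_eq_sum hr]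

lemma expEnd_intertwine {T : Module.End K M} {T' : Module.End K N} (hT : LocNil T)
    (hT' : LocNil T') (S : M →ₗ[K] N) (hS : ∀ x, S (T x) = T' (S x)) (x : M) :
    S (expEnd T x) = expEnd T' (S x) := by
  obtain ⟨r, hr⟩ := hT x
  have hr' : (T' ^ r) (S x) = 0 := by rw [← pow_intertwine S hS, hr, map_zero]
  rw [expEnd_eq_sum hT hr, expEnd_eq_sum hT' hr', map_sum]
  exact Finset.sum_congr rfl fun s _ => by rw [map_smul, pow_intertwine S hS]

lemma expEnd_add {A B : Module.End K M} (hAB : Commute A B) (hA : LocNil A) (hB : LocNil B)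
    (x : M) : expEnd (A + B) x = expEnd A (expEnd B x) := by
  obtain ⟨a, ha⟩ := hA x
  obtain ⟨b, hb⟩ := hB x
  set r := max a b with hr
  have hAx := pow_apply_zero_of_le ha (le_max_left a b)
  have hBx := pow_apply_zero_of_le hb (le_max_right a b)
  rw [← hr] at hAx hBx
  rw [expEnd_eq_sum (hA.add hAB hB) (add_pow_apply_zero hAB hAx hBx), expEnd_eq_sum hB hBx,
    map_sum]
  have key : ∀ s, expEnd A (algebraMap ℂ K ((s ! : ℂ)⁻¹) • (B ^ s) x)
      = ∑ t ∈ Finset.range r, algebraMap ℂ K ((t ! : ℂ)⁻¹ * (s ! : ℂ)⁻¹) • (A ^ t) ((B ^ s) x) := by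
    intro s
    have h0 : (A ^ r) ((B ^ s) x) = 0 := by
      rw [← Module.End.mul_apply, (hAB.pow_pow _ _).eq, Module.End.mul_apply, hAx, map_zero]
    rw [map_smul, expEnd_eq_sum hA h0, Finset.smul_sum]
    exact Finset.sum_congr rfl fun t _ => by rw [smul_smul, ← map_mul, mul_comm]
  simp only [key]
  have key2 : ∀ m, algebraMap ℂ K ((m ! : ℂ)⁻¹) • ((A + B) ^ m) x
      = ∑ p ∈ Finset.HasAntidiagonal.antidiagonal m,
        algebraMap ℂ K ((p.1 ! : ℂ)⁻¹ * (p.2 ! : ℂ)⁻¹) • (A ^ p.1) ((B ^ p.2) x) := by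
    intro m
    rw [hAB.add_pow', LinearMap.sum_apply, Finset.smul_sum]
    refine Finset.sum_congr rfl fun p hp => ?_
    rw [Finset.HasAntidiagonal.mem_antidiagonal] at hp
    rw [LinearMap.smul_apply, ← Nat.cast_smul_eq_nsmul K, smul_smul, Module.End.mul_apply]
    congr 1
    rw [← map_natCast (algebraMap ℂ K), ← map_mul]
    congr 1
    subst hp
    have h1 := Nat.choose_mul_factorial_mul_factorial (Nat.le_add_right p.1 p.2)
    rw [Nat.add_sub_cancel_left] at h1
    have h2 : (((p.1 + p.2).choose p.1 : ℕ) : ℂ) * (p.1 ! : ℂ) * (p.2 ! : ℂ)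
        = ((p.1 + p.2)! : ℂ) := by exact_mod_cast h1
    have f1 : (p.1 ! : ℂ) ≠ 0 := by exact_mod_cast Nat.factorial_ne_zero _
    have f2 : (p.2 ! : ℂ) ≠ 0 := by exact_mod_cast Nat.factorial_ne_zero _
    have f3 : ((p.1 + p.2)! : ℂ) ≠ 0 := by exact_mod_cast Nat.factorial_ne_zero _
    field_simp
    linear_combination h2
  simp only [key2]
  rw [Finset.sum_comm, ← Finset.sum_product', Finset.sum_sigma']
  refine Finset.sum_bij_ne_zero (fun q _ _ => q.2) ?_ ?_ ?_ ?_
  · rintro ⟨m, p⟩ h h0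
    rw [Finset.mem_product, Finset.mem_range, Finset.mem_range]
    constructor
    · by_contra hc
      refine h0 ?_
      dsimp only
      rw [← Module.End.mul_apply, (hAB.pow_pow _ _).eq, Module.End.mul_apply,
        pow_apply_zero_of_le hAx (not_lt.mp hc), map_zero, smul_zero]
    · by_contra hc
      refine h0 ?_
      dsimp only
      rw [pow_apply_zero_of_le hBx (not_lt.mp hc), map_zero, smul_zero]
  · rintro ⟨m, p⟩ h _ ⟨m', p'⟩ h' _ e
    simp only [Finset.mem_sigma, Finset.HasAntidiagonal.mem_antidiagonal] at h h'
    dsimp only at e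
    subst e
    obtain rfl : m = m' := by omega
    rfl
  · rintro p hp h0
    rw [Finset.mem_product, Finset.mem_range, Finset.mem_range] at hp
    refine ⟨⟨p.1 + p.2, p⟩, ?_, h0, rfl⟩
    simp only [Finset.mem_sigma, Finset.HasAntidiagonal.mem_antidiagonal, Finset.mem_range, and_true]
    omega
  · rintro ⟨m, p⟩ h _
    rfl

end LocallyNilpotent

/-! ## Tensor powers of the polynomial ring and Poisson operators -/

/-- The ground ring `ℂ[ħ, ħ⁻¹]`. -/
abbrev Coeff : Type := ℂ[T;T⁻¹]

/-- The formal parameter `ħ`. -/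
def hbar : Coeff := LaurentPolynomial.T 1

/-- The variables: `Sum.inl s` is `p_s` and `Sum.inr s` is `q_s`. -/
abbrev Var (n : ℕ) : Type := Fin n ⊕ Fin n

/-- Polynomials in the `p_s, q_s` with coefficients in `ℂ[ħ, ħ⁻¹]`. -/
abbrev Poly (n : ℕ) : Type := MvPolynomial (Var n) Coeff

/-- The tensor power (over `ℂ[ħ, ħ⁻¹]`) of `Poly n` with tensor slots indexed by `ι`: the
polynomial ring with one set of variables `p_s, q_s` for each slot. -/
abbrev Slots (ι : Type) (n : ℕ) : Type := MvPolynomial (ι × Var n) Coeff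

/-- The pure tensor with factor `a i` in slot `i`. -/
def pureTensor {ι : Type} [Fintype ι] {n : ℕ} (a : ι → Poly n) : Slots ι n :=
  ∏ i, MvPolynomial.rename (Prod.mk i) (a i)

/-- The derivative by the variable `v`, acting on slot `i`. -/
def slotDeriv {ι : Type} {n : ℕ} (i : ι) (v : Var n) : Module.End Coeff (Slots ι n) :=
  (MvPolynomial.pderiv (R := Coeff) (i, v)).toLinearMap

/-- The Poisson tensor `α_{ij} = ∑ s, ∂_{p_s} ⊗ ∂_{q_s} - ∂_{q_s} ⊗ ∂_{p_s}` acting on the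
slots `i` and `j`. -/
def poisson {ι : Type} {n : ℕ} (i j : ι) : Module.End Coeff (Slots ι n) :=
  ∑ s : Fin n, (slotDeriv i (Sum.inl s) * slotDeriv j (Sum.inr s)
    - slotDeriv i (Sum.inr s) * slotDeriv j (Sum.inl s))

/-- The algebra homomorphism that moves the factor in slot `i` to slot `f i`, multiplying
(commutatively) the factors that land in the same slot. -/
def merge {ι κ : Type} {n : ℕ} (f : ι → κ) : Slots ι n →ₐ[Coeff] Slots κ n :=
  MvPolynomial.rename (Prod.map f id)

/-- The commutative multiplication of all tensor factors. -/
def multiply {ι : Type} {n : ℕ} : Slots ι n →ₐ[Coeff] Poly n :=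
  MvPolynomial.rename Prod.snd

lemma slotDeriv_commute {ι : Type} {n : ℕ} (i j : ι) (v w : Var n) :
    Commute (slotDeriv i v) (slotDeriv j w) := by
  refine LinearMap.ext fun x => ?_
  have h : ⁅MvPolynomial.pderiv (R := Coeff) (i, v), MvPolynomial.pderiv (R := Coeff) (j, w)⁆ = 0 := by
    refine MvPolynomial.derivation_ext fun k => ?_
    classical
    rw [Derivation.commutator_apply]
    simp only [MvPolynomial.pderiv_X, Pi.single_apply]
    split_ifs <;> simp
  have h2 := congrArg (fun D => D x) h
  simp only [Derivation.commutator_apply, Derivation.coe_zero, Pi.zero_apply] at h2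
  exact sub_eq_zero.mp h2

lemma slotDeriv_apply {ι : Type} {n : ℕ} (i : ι) (v : Var n) (x : Slots ι n) :
    slotDeriv i v x = MvPolynomial.pderiv (i, v) x := rfl

lemma slotDeriv_locNil {ι : Type} {n : ℕ} (i : ι) (v : Var n) :
    LocNil (slotDeriv (n := n) i v) := by
  have key : ∀ (k : ℕ) (u : ι × Var n →₀ ℕ) (a : Coeff), u (i, v) = k →
      (slotDeriv (n := n) i v ^ (k + 1)) (MvPolynomial.monomial u a) = 0 := by
    intro k
    induction k with
    | zero =>
      intro u a hu
      rw [zero_add, pow_one, slotDeriv_apply, MvPolynomial.pderiv_monomial, hu]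
      simp
    | succ k ih =>
      intro u a hu
      rw [pow_succ, Module.End.mul_apply, slotDeriv_apply, MvPolynomial.pderiv_monomial]
      refine ih _ _ ?_
      simp [hu]
  intro x
  induction x using MvPolynomial.induction_on' with
  | monomial u a => exact ⟨_, key _ u a rfl⟩
  | add x y hx hy =>
    obtain ⟨r, hr⟩ := hx
    obtain ⟨s, hs⟩ := hy
    refine ⟨max r s, ?_⟩
    rw [map_add, pow_apply_zero_of_le hr (le_max_left r s),
      pow_apply_zero_of_le hs (le_max_right r s), add_zero]

lemma slotDeriv_merge {ι κ : Type} [Fintype ι] [DecidableEq κ] {n : ℕ} (f : ι → κ) (k : κ)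
    (v : Var n) (x : Slots ι n) :
    slotDeriv k v (merge f x) = ∑ i, if f i = k then merge f (slotDeriv i v x) else 0 := by
  classical
  simp only [slotDeriv_apply]
  induction x using MvPolynomial.induction_on with
  | C a => simp [merge]
  | add x y hx hy =>
    simp only [map_add, hx, hy, ← Finset.sum_add_distrib]
    refine Finset.sum_congr rfl fun i _ => ?_
    split_ifs <;> simp
  | mul_X x p hx =>
    obtain ⟨j, w⟩ := p
    have h1 : MvPolynomial.pderiv (k, v) (merge f (MvPolynomial.X (j, w) : Slots ι n))
        = ∑ i, if f i = k then
            merge f (MvPolynomial.pderiv (i, v) (MvPolynomial.X (j, w) : Slots ι n)) else 0 := by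
      rw [Finset.sum_eq_single j]
      · simp only [merge, MvPolynomial.rename_X, MvPolynomial.pderiv_X, Pi.single_apply,
          Prod.map, Prod.mk.injEq, id]
        by_cases h : f j = k <;> by_cases h' : w = v <;> simp [h, h']
      · intro i _ hij
        simp [MvPolynomial.pderiv_X, hij.symm]
      · simp
    rw [map_mul, Derivation.leibniz, hx, h1, Finset.smul_sum, Finset.smul_sum,
      ← Finset.sum_add_distrib]
    refine Finset.sum_congr rfl fun i _ => ?_
    split_ifs
    · rw [Derivation.leibniz, map_add, smul_eq_mul, smul_eq_mul, smul_eq_mul, smul_eq_mul,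
        map_mul, map_mul]
    · simp

lemma slotDeriv_slot {ι : Type} [DecidableEq ι] {n : ℕ} (i j : ι) (v : Var n) (x : Poly n) :
    slotDeriv i v (MvPolynomial.rename (Prod.mk j) x)
      = if j = i then MvPolynomial.rename (Prod.mk j) (MvPolynomial.pderiv v x) else 0 := by
  simp only [slotDeriv_apply]
  by_cases h : j = i
  · subst h
    rw [if_pos rfl, MvPolynomial.pderiv_rename (Prod.mk_right_injective j)]
  · rw [if_neg h]
    induction x using MvPolynomial.induction_on with
    | C a => simp
    | add x y hx hy => simp [hx, hy]
    | mul_X x w hx =>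
      rw [map_mul, Derivation.leibniz, hx, MvPolynomial.rename_X, MvPolynomial.pderiv_X]
      simp [h]

/-- Derivatives act on pure tensors slotwise. -/
lemma slotDeriv_pureTensor {ι : Type} [Fintype ι] [DecidableEq ι] {n : ℕ} (i : ι) (v : Var n)
    (a : ι → Poly n) :
    slotDeriv i v (pureTensor a)
      = pureTensor (Function.update a i (MvPolynomial.pderiv v (a i))) := by
  have h0 : slotDeriv i v
      (∏ j ∈ Finset.univ.erase i, MvPolynomial.rename (Prod.mk j) (a j)) = 0 := by
    rw [slotDeriv_apply]
    refine Finset.prod_induction _ (fun y => MvPolynomial.pderiv (i, v) y = 0) ?_ ?_ ?_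
    · intro x y hx hy
      rw [Derivation.leibniz, hx, hy, smul_zero, smul_zero, add_zero]
    · simp
    · intro j hj
      have := slotDeriv_slot i j v (a j)
      rw [if_neg (Finset.ne_of_mem_erase hj)] at this
      exact this
  unfold pureTensor
  rw [← Finset.mul_prod_erase _ _ (Finset.mem_univ i),
    ← Finset.mul_prod_erase Finset.univ _ (Finset.mem_univ i)]
  rw [slotDeriv_apply] at h0
  rw [slotDeriv_apply, Derivation.leibniz, h0, smul_zero, zero_add, smul_eq_mul, mul_comm]
  congr 1
  · have := slotDeriv_slot i i v (a i)
    rw [if_pos rfl, slotDeriv_apply] at this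
    rw [this, Function.update_self]
  · refine Finset.prod_congr rfl fun j hj => ?_
    rw [Function.update_of_ne (Finset.ne_of_mem_erase hj)]

lemma poisson_apply {ι : Type} {n : ℕ} (i j : ι) (x : Slots ι n) :
    poisson i j x = ∑ s : Fin n, (slotDeriv i (Sum.inl s) (slotDeriv j (Sum.inr s) x)
      - slotDeriv i (Sum.inr s) (slotDeriv j (Sum.inl s) x)) := by
  simp only [poisson, LinearMap.sum_apply, LinearMap.sub_apply, Module.End.mul_apply]

lemma slotDeriv_mul_commute {ι : Type} {n : ℕ} (i j k l : ι) (v w v' w' : Var n) :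
    Commute (slotDeriv i v * slotDeriv j w) (slotDeriv k v' * slotDeriv l w') :=
  Commute.mul_left ((slotDeriv_commute _ _ _ _).mul_right (slotDeriv_commute _ _ _ _))
    ((slotDeriv_commute _ _ _ _).mul_right (slotDeriv_commute _ _ _ _))

lemma poisson_commute {ι : Type} {n : ℕ} (i j k l : ι) :
    Commute (poisson (n := n) i j) (poisson k l) :=
  commute_sum_sub_sum_sub _ _ _ _ _ _ (fun _ _ => slotDeriv_mul_commute _ _ _ _ _ _ _ _)
    (fun _ _ => slotDeriv_mul_commute _ _ _ _ _ _ _ _)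
    (fun _ _ => slotDeriv_mul_commute _ _ _ _ _ _ _ _)
    (fun _ _ => slotDeriv_mul_commute _ _ _ _ _ _ _ _)

lemma poisson_locNil {ι : Type} {n : ℕ} (i j : ι) : LocNil (poisson (n := n) i j) :=
  LocNil.sum_sub _ _ _ (fun _ _ => slotDeriv_mul_commute _ _ _ _ _ _ _ _)
    (fun _ _ => slotDeriv_mul_commute _ _ _ _ _ _ _ _)
    (fun _ _ => slotDeriv_mul_commute _ _ _ _ _ _ _ _)
    (fun _ => LocNil.mul (slotDeriv_commute _ _ _ _) (slotDeriv_locNil _ _))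
    (fun _ => LocNil.mul (slotDeriv_commute _ _ _ _) (slotDeriv_locNil _ _))

/-! ## The Weyl algebra -/

/-- The underlying space of the polynomial Weyl algebra of `ℝ²ⁿ`: polynomials in
`p_1, …, p_n, q_1, …, q_n` with coefficients in `ℂ[ħ, ħ⁻¹]`. -/
def Weyl (n : ℕ) : Type := Poly n

instance (n : ℕ) : AddCommGroup (Weyl n) := inferInstanceAs (AddCommGroup (Poly n))

instance (n : ℕ) : Module Coeff (Weyl n) := inferInstanceAs (Module Coeff (Poly n))

/-- An element of the Weyl algebra, viewed as a polynomial. -/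
def Weyl.toPoly {n : ℕ} : Weyl n ≃ₗ[Coeff] Poly n := LinearEquiv.refl Coeff (Poly n)

/-- The Moyal product `f ⋆ g = m (exp (ħ/2 α) (f ⊗ g))` of polynomials. -/
def moyal {n : ℕ} (f g : Poly n) : Poly n :=
  multiply (expEnd ((algebraMap ℂ Coeff (1 / 2) * hbar) • poisson (0 : Fin 2) 1)
    (pureTensor ![f, g]))

lemma smul_poisson_locNil {ι : Type} {n : ℕ} (c : Coeff) (i j : ι) :
    LocNil (c • poisson (n := n) i j) := (poisson_locNil i j).smul c

lemma smul_poisson_commute {ι : Type} {n : ℕ} (c d : Coeff) (i j k l : ι) :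
    Commute (c • poisson (n := n) i j) (d • poisson k l) :=
  ((poisson_commute i j k l).smul_left c).smul_right d

lemma poisson_merge {ι κ : Type} [Fintype ι] [DecidableEq κ] {n : ℕ} (f : ι → κ) (k l : κ)
    (x : Slots ι n) :
    poisson k l (merge f x)
      = ∑ i, ∑ j, if f i = k ∧ f j = l then merge f (poisson i j x) else 0 := by
  have h : ∀ v w : Var n, slotDeriv k v (slotDeriv l w (merge f x))
      = ∑ i, ∑ j, if f i = k ∧ f j = l then merge f (slotDeriv i v (slotDeriv j w x)) else 0 := by
    intro v w
    rw [slotDeriv_merge, map_sum, Finset.sum_comm]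
    refine Finset.sum_congr rfl fun j _ => ?_
    split_ifs with hj
    · rw [slotDeriv_merge]
      refine Finset.sum_congr rfl fun i _ => ?_
      simp [hj]
    · simp [hj]
  rw [poisson_apply]
  simp only [h, ← Finset.sum_sub_distrib]
  rw [Finset.sum_comm]
  refine Finset.sum_congr rfl fun i _ => ?_
  rw [Finset.sum_comm]
  refine Finset.sum_congr rfl fun j _ => ?_
  split_ifs
  · rw [poisson_apply, map_sum]
    exact Finset.sum_congr rfl fun s _ => by rw [map_sub]
  · simp

lemma multiply_merge {ι κ : Type} {n : ℕ} (f : ι → κ) (x : Slots ι n) :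
    multiply (merge f x) = multiply x := by
  simp only [multiply, merge, MvPolynomial.rename_rename]
  rfl

lemma multiply_slot {ι : Type} {n : ℕ} (i : ι) (x : Poly n) :
    multiply (MvPolynomial.rename (Prod.mk i) x) = x := by
  simp only [multiply, MvPolynomial.rename_rename]
  exact MvPolynomial.rename_id_apply x

lemma merge_slot {ι κ : Type} {n : ℕ} (f : ι → κ) (i : ι) (x : Poly n) :
    merge f (MvPolynomial.rename (Prod.mk i) x) = MvPolynomial.rename (Prod.mk (f i)) x := by
  simp only [merge, MvPolynomial.rename_rename]
  rfl

lemma merge_merge_const {ι κ μ : Type} {n : ℕ} (e : ι → κ) (f : κ → μ) (m : μ)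
    (h : ∀ i, f (e i) = m) (x : Slots ι n) :
    merge f (merge e x) = MvPolynomial.rename (Prod.mk m) (multiply x) := by
  simp only [merge, multiply, MvPolynomial.rename_rename]
  congr 2
  funext p
  exact Prod.ext (h p.1) rfl

/-- Insertion of slots along `e`, with the extra factor `g` in slot `k`. -/
def embedMul {ι κ : Type} {n : ℕ} (e : ι → κ) (k : κ) (g : Poly n) :
    Slots ι n →ₗ[Coeff] Slots κ n :=
  (LinearMap.mulRight Coeff (MvPolynomial.rename (Prod.mk k) g : Slots κ n)).comp
    (merge e).toLinearMap

lemma embedMul_apply {ι κ : Type} {n : ℕ} (e : ι → κ) (k : κ) (g : Poly n) (x : Slots ι n) :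
    embedMul e k g x = merge e x * MvPolynomial.rename (Prod.mk k) g := rfl

lemma slotDeriv_embedMul {ι κ : Type} [Fintype ι] [DecidableEq κ] {n : ℕ} {e : ι → κ}
    (he : Function.Injective e) {k : κ} (hk : ∀ i, e i ≠ k) (g : Poly n) (i : ι) (v : Var n)
    (x : Slots ι n) :
    slotDeriv (e i) v (embedMul e k g x) = embedMul e k g (slotDeriv i v x) := by
  have h1 := slotDeriv_slot (e i) k v g
  rw [if_neg (hk i).symm, slotDeriv_apply] at h1
  have h2 := slotDeriv_merge e (e i) v x
  rw [Finset.sum_eq_single i (fun j _ hj => if_neg fun h => hj (he h)) (by simp), if_pos rfl] at h2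
  rw [embedMul_apply, embedMul_apply, slotDeriv_apply, Derivation.leibniz, h1, smul_zero,
    zero_add, smul_eq_mul, mul_comm, ← h2, slotDeriv_apply]

lemma poisson_embedMul {ι κ : Type} [Fintype ι] [DecidableEq κ] {n : ℕ} {e : ι → κ}
    (he : Function.Injective e) {k : κ} (hk : ∀ i, e i ≠ k) (g : Poly n) (i j : ι)
    (x : Slots ι n) :
    poisson (e i) (e j) (embedMul e k g x) = embedMul e k g (poisson i j x) := by
  rw [poisson_apply, poisson_apply, map_sum]
  refine Finset.sum_congr rfl fun s _ => ?_
  rw [map_sub, slotDeriv_embedMul he hk, slotDeriv_embedMul he hk, slotDeriv_embedMul he hk,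
    slotDeriv_embedMul he hk]

lemma moyal_eq {n : ℕ} (f g : Poly n) :
    moyal f g = multiply (expEnd ((algebraMap ℂ Coeff (1 / 2) * hbar) • poisson (0 : Fin 2) 1)
      (MvPolynomial.rename (Prod.mk 0) f * MvPolynomial.rename (Prod.mk 1) g)) := by
  simp [moyal, pureTensor, Fin.prod_univ_two]

lemma moyal_add_left {n : ℕ} (f f' g : Poly n) : moyal (f + f') g = moyal f g + moyal f' g := by
  simp only [moyal_eq, map_add, add_mul]

lemma moyal_add_right {n : ℕ} (f g g' : Poly n) : moyal f (g + g') = moyal f g + moyal f g' := by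
  simp only [moyal_eq, map_add, mul_add]

lemma moyal_smul_left {n : ℕ} (c : Coeff) (f g : Poly n) : moyal (c • f) g = c • moyal f g := by
  simp only [moyal_eq, map_smul, smul_mul_assoc]

lemma moyal_smul_right {n : ℕ} (c : Coeff) (f g : Poly n) : moyal f (c • g) = c • moyal f g := by
  simp only [moyal_eq, map_smul, mul_smul_comm]

lemma expEnd_smul_poisson_of_eq_zero {ι : Type} {n : ℕ} {c : Coeff} {i j : ι} {x : Slots ι n}
    (h : poisson i j x = 0) : expEnd (c • poisson i j) x = x := by
  have h1 : ((c • poisson (n := n) i j) ^ 1) x = 0 := by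
    rw [pow_one, LinearMap.smul_apply, h, smul_zero]
  rw [expEnd_eq_sum (smul_poisson_locNil c i j) h1]
  simp

lemma moyal_one_left {n : ℕ} (g : Poly n) : moyal 1 g = g := by
  rw [moyal_eq, expEnd_smul_poisson_of_eq_zero, map_mul, multiply_slot, multiply_slot, one_mul]
  refine (poisson_apply _ _ _).trans (Finset.sum_eq_zero fun s _ => ?_)
  rw [map_one, one_mul, slotDeriv_slot, slotDeriv_slot, if_pos rfl, if_pos rfl, slotDeriv_slot,
    slotDeriv_slot, if_neg (by decide), if_neg (by decide), sub_zero]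

lemma moyal_one_right {n : ℕ} (f : Poly n) : moyal f 1 = f := by
  rw [moyal_eq, expEnd_smul_poisson_of_eq_zero, map_mul, multiply_slot, multiply_slot, mul_one]
  refine (poisson_apply _ _ _).trans (Finset.sum_eq_zero fun s _ => ?_)
  rw [map_one, mul_one, slotDeriv_slot, slotDeriv_slot, if_neg (by decide), if_neg (by decide),
    map_zero, map_zero, sub_zero]

lemma poisson_merge_left {n : ℕ} (x : Slots (Fin 3) n) :
    poisson (0 : Fin 2) 1 (merge ![0, 0, 1] x)
      = merge ![0, 0, 1] (poisson 0 2 x + poisson 1 2 x) := by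
  rw [poisson_merge, map_add]
  simp [Fin.sum_univ_three]

lemma poisson_merge_right {n : ℕ} (x : Slots (Fin 3) n) :
    poisson (0 : Fin 2) 1 (merge ![0, 1, 1] x)
      = merge ![0, 1, 1] (poisson 0 1 x + poisson 0 2 x) := by
  rw [poisson_merge, map_add]
  simp [Fin.sum_univ_three]

/-- The common value of the two threefold Moyal products. -/
def moyal₃ {n : ℕ} (f g h : Poly n) : Poly n :=
  multiply (expEnd ((algebraMap ℂ Coeff (1 / 2) * hbar) • poisson (0 : Fin 3) 1
      + ((algebraMap ℂ Coeff (1 / 2) * hbar) • poisson (0 : Fin 3) 2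
        + (algebraMap ℂ Coeff (1 / 2) * hbar) • poisson (1 : Fin 3) 2))
    (MvPolynomial.rename (Prod.mk 0) f * MvPolynomial.rename (Prod.mk 1) g
      * MvPolynomial.rename (Prod.mk 2) h))

lemma moyal_moyal_left {n : ℕ} (f g h : Poly n) : moyal (moyal f g) h = moyal₃ f g h := by
  set c : Coeff := algebraMap ℂ Coeff (1 / 2) * hbar with hc
  have hinj : Function.Injective (![0, 1] : Fin 2 → Fin 3) := by decide
  have hne : ∀ i, (![0, 1] : Fin 2 → Fin 3) i ≠ 2 := by decide
  have hB : LocNil (c • poisson (n := n) (0 : Fin 3) 2 + c • poisson 1 2) :=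
    (smul_poisson_locNil c _ _).add (smul_poisson_commute _ _ _ _ _ _) (smul_poisson_locNil c _ _)
  have hcomm : Commute (c • poisson (n := n) (0 : Fin 3) 2 + c • poisson 1 2)
      (c • poisson (0 : Fin 3) 1) :=
    (smul_poisson_commute _ _ _ _ _ _).add_left (smul_poisson_commute _ _ _ _ _ _)
  have step1 : (MvPolynomial.rename (Prod.mk (0 : Fin 2)) (moyal f g)
      * MvPolynomial.rename (Prod.mk 1) h : Slots (Fin 2) n)
      = merge ![0, 0, 1] (expEnd (c • poisson (0 : Fin 3) 1)
        (MvPolynomial.rename (Prod.mk 0) f * MvPolynomial.rename (Prod.mk 1) g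
          * MvPolynomial.rename (Prod.mk 2) h)) := by
    have e1 := expEnd_intertwine (smul_poisson_locNil (n := n) c (0 : Fin 2) 1)
      (smul_poisson_locNil c (0 : Fin 3) 1) (embedMul ![0, 1] 2 h)
      (fun x => by
        rw [LinearMap.smul_apply, LinearMap.smul_apply, map_smul]
        exact congrArg (c • ·) (poisson_embedMul hinj hne h 0 1 x).symm)
      (MvPolynomial.rename (Prod.mk 0) f * MvPolynomial.rename (Prod.mk 1) g)
    rw [embedMul_apply, embedMul_apply, map_mul (merge ![0, 1]), merge_slot, merge_slot] at e1
    have e2 := congrArg (merge (n := n) (![0, 0, 1] : Fin 3 → Fin 2)) e1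
    rw [map_mul, merge_merge_const _ _ 0 (by decide), merge_slot, ← moyal_eq] at e2
    exact e2
  have step2 := fun x => expEnd_intertwine hB (smul_poisson_locNil (n := n) c (0 : Fin 2) 1)
      (merge ![0, 0, 1]).toLinearMap (fun y => by
        rw [LinearMap.smul_apply, AlgHom.toLinearMap_apply, AlgHom.toLinearMap_apply,
          poisson_merge_left, LinearMap.add_apply, LinearMap.smul_apply, LinearMap.smul_apply,
          ← smul_add, map_smul]) x
  rw [moyal_eq, step1, ← hc]
  have step3 := step2 (expEnd (c • poisson (0 : Fin 3) 1)
        (MvPolynomial.rename (Prod.mk 0) f * MvPolynomial.rename (Prod.mk 1) g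
          * MvPolynomial.rename (Prod.mk 2) h))
  rw [AlgHom.toLinearMap_apply, AlgHom.toLinearMap_apply] at step3
  rw [← step3, multiply_merge, ← expEnd_add hcomm hB (smul_poisson_locNil c _ _), moyal₃, ← hc,
    add_comm]

lemma moyal_moyal_right {n : ℕ} (f g h : Poly n) : moyal f (moyal g h) = moyal₃ f g h := by
  set c : Coeff := algebraMap ℂ Coeff (1 / 2) * hbar with hc
  have hinj : Function.Injective (![1, 2] : Fin 2 → Fin 3) := by decide
  have hne : ∀ i, (![1, 2] : Fin 2 → Fin 3) i ≠ 0 := by decide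
  have hB : LocNil (c • poisson (n := n) (0 : Fin 3) 1 + c • poisson 0 2) :=
    (smul_poisson_locNil c _ _).add (smul_poisson_commute _ _ _ _ _ _) (smul_poisson_locNil c _ _)
  have hcomm : Commute (c • poisson (n := n) (0 : Fin 3) 1 + c • poisson 0 2)
      (c • poisson (1 : Fin 3) 2) :=
    (smul_poisson_commute _ _ _ _ _ _).add_left (smul_poisson_commute _ _ _ _ _ _)
  have step1 : (MvPolynomial.rename (Prod.mk (0 : Fin 2)) f
      * MvPolynomial.rename (Prod.mk 1) (moyal g h) : Slots (Fin 2) n)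
      = merge ![0, 1, 1] (expEnd (c • poisson (1 : Fin 3) 2)
        (MvPolynomial.rename (Prod.mk 0) f * MvPolynomial.rename (Prod.mk 1) g
          * MvPolynomial.rename (Prod.mk 2) h)) := by
    have e1 := expEnd_intertwine (smul_poisson_locNil (n := n) c (0 : Fin 2) 1)
      (smul_poisson_locNil c (1 : Fin 3) 2) (embedMul ![1, 2] 0 f)
      (fun x => by
        rw [LinearMap.smul_apply, LinearMap.smul_apply, map_smul]
        exact congrArg (c • ·) (poisson_embedMul hinj hne f 0 1 x).symm)
      (MvPolynomial.rename (Prod.mk 0) g * MvPolynomial.rename (Prod.mk 1) h)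
    rw [embedMul_apply, embedMul_apply, map_mul (merge ![1, 2]), merge_slot, merge_slot] at e1
    have e2 := congrArg (merge (n := n) (![0, 1, 1] : Fin 3 → Fin 2)) e1
    rw [map_mul, merge_merge_const _ _ 1 (by decide), merge_slot, ← moyal_eq] at e2
    rw [mul_assoc, mul_comm _ (_ * _), mul_comm _ (MvPolynomial.rename _ (moyal g h))]
    exact e2
  have step2 := fun x => expEnd_intertwine hB (smul_poisson_locNil (n := n) c (0 : Fin 2) 1)
      (merge ![0, 1, 1]).toLinearMap (fun y => by
        rw [LinearMap.smul_apply, AlgHom.toLinearMap_apply, AlgHom.toLinearMap_apply,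
          poisson_merge_right, LinearMap.add_apply, LinearMap.smul_apply, LinearMap.smul_apply,
          ← smul_add, map_smul]) x
  rw [moyal_eq, step1, ← hc]
  have step3 := step2 (expEnd (c • poisson (1 : Fin 3) 2)
        (MvPolynomial.rename (Prod.mk 0) f * MvPolynomial.rename (Prod.mk 1) g
          * MvPolynomial.rename (Prod.mk 2) h))
  rw [AlgHom.toLinearMap_apply, AlgHom.toLinearMap_apply] at step3
  rw [← step3, multiply_merge, ← expEnd_add hcomm hB (smul_poisson_locNil c _ _), moyal₃, ← hc,
    add_assoc]

lemma moyal_assoc {n : ℕ} (f g h : Poly n) : moyal (moyal f g) h = moyal f (moyal g h) := by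
  rw [moyal_moyal_left, moyal_moyal_right]

instance (n : ℕ) : Mul (Weyl n) := ⟨fun f g => moyal (n := n) f g⟩

instance (n : ℕ) : One (Weyl n) := ⟨(1 : Poly n)⟩

/-- The polynomial Weyl algebra is an associative unital ring under the Moyal product. -/
instance (n : ℕ) : Ring (Weyl n) :=
  { (inferInstance : AddCommGroup (Weyl n)), (inferInstance : Mul (Weyl n)),
    (inferInstance : One (Weyl n)) with
    mul_assoc := moyal_assoc (n := n)
    one_mul := moyal_one_left (n := n)
    mul_one := moyal_one_right (n := n)
    left_distrib := moyal_add_right (n := n)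
    right_distrib := moyal_add_left (n := n)
    zero_mul := fun g => by
      have h := moyal_smul_left (n := n) 0 0 g
      rw [zero_smul, zero_smul] at h
      exact h
    mul_zero := fun f => by
      have h := moyal_smul_right (n := n) 0 f 0
      rw [zero_smul, zero_smul] at h
      exact h }

instance (n : ℕ) : Algebra Coeff (Weyl n) :=
  Algebra.ofModule (moyal_smul_left (n := n)) (moyal_smul_right (n := n))

/-! ## The normalized mixed cochain complex of an algebra -/

section Mixed

variable (R A : Type*) [CommRing R] [Ring A] [Algebra R A]

/-- Functions of `k + 1` arguments in `A` with values in the ground ring. -/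
abbrev CochainFun (k : ℕ) : Type _ := (Fin (k + 1) → A) → R

/-- The normalized Hochschild cochains `Hom_R (A ⊗ (A / R) ^ {⊗ k}, R)`: multilinear functions
`f (a_0, …, a_k)` that vanish if one of the arguments `a_1, …, a_k` is a scalar. -/
def NormalizedCochain (k : ℕ) : Submodule R (CochainFun R A k) where
  carrier := {f | (∃ F : MultilinearMap R (fun _ : Fin (k + 1) => A) R, ∀ a, f a = F a) ∧
    ∀ (a : Fin (k + 1) → A) (j : Fin k) (c : R), a j.succ = algebraMap R A c → f a = 0}
  add_mem' := by
    rintro f g ⟨⟨F, hF⟩, hf⟩ ⟨⟨G, hG⟩, hg⟩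
    refine ⟨⟨F + G, fun a => by simp [hF, hG]⟩, fun a j c h => ?_⟩
    rw [Pi.add_apply, hf a j c h, hg a j c h, add_zero]
  zero_mem' := ⟨⟨0, fun a => by simp⟩, fun a j c h => rfl⟩
  smul_mem' := by
    rintro r f ⟨⟨F, hF⟩, hf⟩
    refine ⟨⟨r • F, fun a => by simp [hF]⟩, fun a j c h => ?_⟩
    rw [Pi.smul_apply, hf a j c h, smul_zero]

variable {R A}

/-- The Hochschild coboundary, dual to
`b (a_0 ⊗ ⋯ ⊗ a_{k+1}) = ∑_{i ≤ k} (-1)^i a_0 ⊗ ⋯ ⊗ a_i a_{i+1} ⊗ ⋯ ⊗ a_{k+1}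
  + (-1)^{k+1} a_{k+1} a_0 ⊗ a_1 ⊗ ⋯ ⊗ a_k`. -/
def hochschildB {k : ℕ} (f : CochainFun R A k) : CochainFun R A (k + 1) := fun a =>
  (∑ i : Fin (k + 1), (-1) ^ (i : ℕ) * f (Fin.contractNth i.castSucc (· * ·) a))
    + (-1) ^ (k + 1) * f (Fin.cons (α := fun _ => A) (a (Fin.last (k + 1)) * a 0)
        (fun j : Fin k => a j.castSucc.succ))

/-- Connes' operator on normalized cochains, dual to
`B (a_0 ⊗ ⋯ ⊗ a_k) = ∑_{i ≤ k} (-1)^{i k} 1 ⊗ a_i ⊗ ⋯ ⊗ a_k ⊗ a_0 ⊗ ⋯ ⊗ a_{i-1}`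
(addition in `Fin (k + 1)` is modulo `k + 1`). -/
def connesB {k : ℕ} (f : CochainFun R A (k + 1)) : CochainFun R A k := fun a =>
  ∑ i : Fin (k + 1), (-1) ^ ((i : ℕ) * k) *
    f (Fin.cons (α := fun _ => A) 1 (fun j : Fin (k + 1) => a (i + j)))

variable (R A)

/-- The degree `m` part `⨁_{i ≤ m/2} C̄^{m - 2i}` of the total complex: families of normalized
cochains that vanish outside the degrees `m, m - 2, m - 4, …, m - 2 ⌊m/2⌋`. -/
def TotCochain (m : ℕ) : Submodule R (∀ k : ℕ, CochainFun R A k) where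
  carrier := {c | (∀ k, c k ∈ NormalizedCochain R A k) ∧
    ∀ k, ¬ (k ≤ m ∧ k % 2 = m % 2) → c k = 0}
  add_mem' := by
    rintro c d ⟨hc, hc'⟩ ⟨hd, hd'⟩
    exact ⟨fun k => Submodule.add_mem _ (hc k) (hd k), fun k h => by
      rw [Pi.add_apply, hc' k h, hd' k h, add_zero]⟩
  zero_mem' := ⟨fun k => Submodule.zero_mem _, fun k _ => rfl⟩
  smul_mem' := by
    rintro r c ⟨hc, hc'⟩
    exact ⟨fun k => Submodule.smul_mem _ r (hc k), fun k h => by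
      rw [Pi.smul_apply, hc' k h, smul_zero]⟩

variable {R A}

/-- The total differential `b + B`. -/
def totD (c : ∀ k : ℕ, CochainFun R A k) : ∀ k : ℕ, CochainFun R A k
  | 0 => connesB (c 1)
  | k + 1 => hochschildB (c k) + connesB (c (k + 2))

end Mixed

/-! ## The cochains `τ_i` -/

/-- Evaluation at the origin `a_0 ⊗ ⋯ ⊗ a_m ↦ a_0(0) ⋯ a_m(0)`. -/
def evalZero {ι : Type} {n : ℕ} : Slots ι n →ₐ[Coeff] Coeff := MvPolynomial.aeval 0

/-- The simplex `0 ≤ u_1 ≤ ⋯ ≤ u_m ≤ 1`. -/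
def simplex (m : ℕ) : Set (Fin m → ℝ) := {u | Monotone u ∧ ∀ i, u i ∈ Set.Icc (0 : ℝ) 1}

/-- The integral over the simplex of a function with values in `ℂ[ħ, ħ⁻¹]`, taken coefficientwise
in the powers of `ħ`. -/
def simplexIntegral {m : ℕ} (F : (Fin m → ℝ) → Coeff) : Coeff :=
  ∑ᶠ d : ℤ, LaurentPolynomial.C (∫ u in simplex m, (F u).coeff d) * LaurentPolynomial.T d

/-- The tuple `(u_0, u_1, …, u_m)` with `u_0 = 0`. -/
def withZero {m : ℕ} (u : Fin m → ℝ) : Fin (m + 1) → ℝ := Fin.cons (α := fun _ => ℝ) 0 u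

/-- The operator `∏_{0 ≤ i < j ≤ m} exp (ħ (u_i - u_j + 1/2) α_{ij})`, where `u_0 = 0`. -/
def expProduct {m n : ℕ} (u : Fin m → ℝ) : Module.End Coeff (Slots (Fin (m + 1)) n) :=
  (((List.finRange (m + 1) ×ˢ List.finRange (m + 1)).filter fun ij => ij.1 < ij.2).map fun ij =>
    expEnd ((algebraMap ℂ Coeff ((withZero u ij.1 - withZero u ij.2 + 1 / 2 : ℝ) : ℂ) * hbar) • poisson ij.1 ij.2)).prod

/-- The `r`-th exterior (divided) power of `ħα` acting on the `2 r` slots `e 0, …, e (2 r - 1)`: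
`(1 / (2^r r!)) ∑_σ sgn σ ∏_t ħ α_{e σ(2t), e σ(2t+1)}`, the Pfaffian of the matrix of commuting
operators `ħ α_{ij}`. It is normalized so that the top power of `α` is the determinant
`∂_{p_1} ∧ ∂_{q_1} ∧ ⋯ ∧ ∂_{p_n} ∧ ∂_{q_n}`. -/
def wedgePower {m n : ℕ} (r : ℕ) (e : Fin (2 * r) → Fin (m + 1)) :
    Module.End Coeff (Slots (Fin (m + 1)) n) :=
  algebraMap ℂ Coeff ((2 ^ r * r ! : ℂ)⁻¹) • ∑ σ : Equiv.Perm (Fin (2 * r)),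
    ((Equiv.Perm.sign σ : ℤ) : Coeff) • (List.ofFn fun t : Fin r =>
      hbar • poisson (e (σ ⟨2 * t, by omega⟩)) (e (σ ⟨2 * t + 1, by omega⟩))).prod

/-- The functional
`μ_m ∫_{Δ^m} ∏_{0 ≤ i < j ≤ m} exp (ħ (u_i - u_j + 1/2) α_{ij}) P (a_0 ⊗ ⋯ ⊗ a_m) du_1 ⋯ du_m`
defined by an operator `P` on the `(m + 1)`-fold tensor power. -/
def tauIntegral {m n : ℕ} (P : Module.End Coeff (Slots (Fin (m + 1)) n)) :
    CochainFun Coeff (Weyl n) m := fun a =>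
  simplexIntegral fun u : Fin m → ℝ =>
    evalZero (expProduct u (P (pureTensor fun i => (a i).toPoly)))

/-- The operator `1 ⊗ (ħα)^{∧ k}` on the slots `0, …, 2 k`, acting on the slots `1, …, 2 k`. -/
def piEven (n k : ℕ) : Module.End Coeff (Slots (Fin (2 * k + 1)) n) :=
  wedgePower k Fin.succ

/-- The operator `(ħα)^{∧ (k + 1)}` acting on all of the slots `0, …, 2 k + 1`. -/
def piOdd (n k : ℕ) : Module.End Coeff (Slots (Fin (2 * k + 1 + 1)) n) :=
  wedgePower (k + 1) id

/-- `τ_{2k} = (-1)^k μ ∫ ∏ exp (⋯) (1 ⊗ (ħα)^{∧ k})`. -/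
def tauEven (n k : ℕ) : CochainFun Coeff (Weyl n) (2 * k) :=
  (-1 : Coeff) ^ k • tauIntegral (piEven n k)

/-- `τ_{2k+1} = (-1)^k μ ∫ ∏ exp (⋯) (ħα)^{∧ (k + 1)}`. -/
def tauOdd (n k : ℕ) : CochainFun Coeff (Weyl n) (2 * k + 1) :=
  (-1 : Coeff) ^ k • tauIntegral (piOdd n k)

/-- The family `(τ_0, τ_2, …, τ_{2n})`, with zero in all other degrees. -/
def tauTotal (n : ℕ) : ∀ m : ℕ, CochainFun Coeff (Weyl n) m := fun m =>
  if h : m ≤ 2 * n ∧ 2 * (m / 2) = m then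
    fun a => tauEven n (m / 2) (a ∘ Fin.cast (congrArg (· + 1) h.2))
  else 0

/-- The symplectic coordinates `y_1, …, y_{2n} = p_1, q_1, …, p_n, q_n`. -/
def coord (n : ℕ) (j : Fin (2 * n)) : Var n :=
  if (j : ℕ) % 2 = 0 then Sum.inl ⟨(j : ℕ) / 2, by omega⟩ else Sum.inr ⟨(j : ℕ) / 2, by omega⟩

/-- The operator `a_0 ⊗ ⋯ ⊗ a_{2n} ↦
ħ^n ∑_σ sgn σ a_0 ⊗ ∂a_1/∂y_{σ(1)} ⊗ ⋯ ⊗ ∂a_{2n}/∂y_{σ(2n)}`. -/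
def ffsPi (n : ℕ) : Module.End Coeff (Slots (Fin (2 * n + 1)) n) :=
  hbar ^ n • ∑ σ : Equiv.Perm (Fin (2 * n)), ((Equiv.Perm.sign σ : ℤ) : Coeff) •
    (List.ofFn fun j : Fin (2 * n) => slotDeriv j.succ (coord n (σ j))).prod

/-- The Hochschild cochain of Feigin, Felder and Shoikhet on the Weyl algebra, in degree `2 n`. -/
def ffs (n : ℕ) : CochainFun Coeff (Weyl n) (2 * n) := tauIntegral (ffsPi n)

end WeylCyclic
end

/-! All operators in the definition of `τ_i` are constant coefficient differential operators on a
polynomial ring. They commute, so they can be handled through their symbols (`diffOp`). Two facts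
about symbols carry the computation. The product of exponentials is the exponential of one quadratic
symbol, whose coefficient matrix consists of the values of the sawtooth function at the differences
of the points `u_i` (`expProduct_eq_expOp`). The exterior power of `ħα` is a Pfaffian, and this
Pfaffian is a multiple of a sum of determinants (`wedgePower_eq_diffOp`), so that row operations
apply to it.

Coboundary. The product `a_j ⋆ a_{j+1}` merges two slots at the cost of a factor `exp (ħ α_{j,j+1} /
2)`. When two points collide, the sawtooth keeps its jump 1/2, which is exactly this factor. Hence
the `j`-th term of `b τ_{2k}` is the integral over the `j`-th face of `Δ^{2k+1}` of the integrand on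
one more slot (`kern_contract`). Since the Pfaffian is linear in each row, its symbol becomes the
minor without slot `j` plus the minor without slot `j + 1`, where slot `0` never counts
(`pull_degen_pfaff`). Each minor therefore meets two neighbouring faces with opposite signs. By the
fundamental theorem of calculus in one coordinate, the two face integrals combine to an integral
over `Δ^{2k+1}` with the extra factor `ħ ∑_l α_{il}` (`simplexIntegral_face`). The alternating sum
of these factors times the minors is the Pfaffian of all slots: replace row `0` by the sum of all
rows and expand along it (`sum_sumSymb_mul_minorPf`). This gives `b τ_{2k} = τ_{2k+1}`.

Connes' operator. A unit in slot `0` removes that slot, and the remaining integrand depends only on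
differences of points on a circle of length one. Rotating the circle identifies the terms of `B
τ_{2k+2}` with one integrand on `Δ^{2k+1}`, each weighted by the length of an arc. The arcs fill the
circle, so the weights add up to one (`sum_rotEnd`, `sum_simplexIntegral_rot`). The sign of the
rotation, which comes from the Pfaffian, cancels the sign in `B` (`tauEven_rotate`).

In the top degree, a Pfaffian with more than `n` pairs of rows vanishes because its determinants
have repeated columns (`pfaff_eq_zero`), which closes the cocycle. The Pfaffian with exactly `n`
pairs is `ħ ^ n` times a single determinant, and this is the operator of Feigin, Felder and Shoikhet
(`ffsPi_eq_piEven`). -/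

noncomputable section

namespace WeylCyclic

/-! ## Symbols of differential operators with constant coefficients -/

section Symbols

variable {ι κ : Type} {n : ℕ}

/-- The commutative ring of symbols of constant coefficient differential operators. -/
abbrev Symb (ι : Type) (n : ℕ) : Type := MvPolynomial (ι × Var n) Coeff

/-- The algebra of constant coefficient differential operators. -/
def diffAlg (ι : Type) (n : ℕ) : Subalgebra Coeff (Module.End Coeff (Slots ι n)) :=
  Algebra.adjoin Coeff (Set.range fun p : ι × Var n => slotDeriv p.1 p.2)

/-- The generators commute, hence so does everything they generate. A commutative target is what
allows `MvPolynomial.aeval` in `diffOp`, since the full endomorphism ring is not commutative. -/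
lemma diffAlg_mul_comm (a b : diffAlg ι n) : a * b = b * a :=
  have := Algebra.isMulCommutative_adjoin Coeff
    (s := Set.range fun p : ι × Var n => slotDeriv (n := n) p.1 p.2) (by
      rintro _ ⟨p, rfl⟩ _ ⟨q, rfl⟩
      exact slotDeriv_commute _ _ _ _)
  this.is_comm.comm a b

instance : CommSemiring (diffAlg ι n) :=
  { (diffAlg ι n).toSemiring with mul_comm := diffAlg_mul_comm }

/-- The differential operator with a given symbol. -/
def diffOp : Symb ι n →ₐ[Coeff] Module.End Coeff (Slots ι n) :=
  (diffAlg ι n).val.comp (MvPolynomial.aeval fun p : ι × Var n =>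
    (⟨slotDeriv p.1 p.2, Algebra.subset_adjoin ⟨p, rfl⟩⟩ : diffAlg ι n))

lemma diffOp_X (p : ι × Var n) : diffOp (MvPolynomial.X p) = slotDeriv p.1 p.2 := by
  simp [diffOp]

lemma diffOp_commute (p q : Symb ι n) : Commute (diffOp p) (diffOp q) := by
  rw [Commute, SemiconjBy, ← map_mul, ← map_mul, mul_comm]

lemma diffOp_mul_apply (p q : Symb ι n) (x : Slots ι n) :
    diffOp (p * q) x = diffOp p (diffOp q x) := by
  rw [map_mul, Module.End.mul_apply]

/-- The symbols whose operators are locally nilpotent. -/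
def nilIdeal (ι : Type) (n : ℕ) : Ideal (Symb ι n) where
  carrier := {q | LocNil (diffOp q)}
  add_mem' := fun {p q} hp hq => by
    change LocNil (diffOp (p + q))
    rw [map_add]
    exact LocNil.add (diffOp_commute _ _) hp hq
  zero_mem' := by
    change LocNil (diffOp 0)
    rw [map_zero]
    exact LocNil.zero
  smul_mem' := fun p q hq => by
    change LocNil (diffOp (p * q))
    rw [map_mul]
    exact LocNil.mul (diffOp_commute _ _) hq

/-- Each monomial of such a symbol is divisible by a variable, whose operator is a locally nilpotent
derivative, and locally nilpotent symbols form an ideal. -/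
lemma diffOp_locNil {q : Symb ι n} (hq : MvPolynomial.constantCoeff q = 0) :
    LocNil (diffOp q) := by
  change q ∈ nilIdeal ι n
  rw [q.as_sum]
  refine Ideal.sum_mem _ fun u hu => ?_
  have hu0 : u ≠ 0 := by
    rintro rfl
    exact (MvPolynomial.mem_support_iff.mp hu) hq
  obtain ⟨p, hp⟩ := Finsupp.ne_iff.mp hu0
  obtain ⟨r, hr⟩ := (MvPolynomial.X_dvd_monomial (r := q.coeff u)).mpr (Or.inr hp)
  rw [hr]
  refine Ideal.mul_mem_right _ _ ?_
  change LocNil (diffOp _)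
  rw [diffOp_X]
  exact slotDeriv_locNil _ _

/-- The exponential of the differential operator with symbol `q`. -/
def expOp (q : Symb ι n) : Module.End Coeff (Slots ι n) := expEnd (diffOp q)

lemma expOp_add {p q : Symb ι n} (hp : MvPolynomial.constantCoeff p = 0)
    (hq : MvPolynomial.constantCoeff q = 0) : expOp (p + q) = expOp p * expOp q := by
  refine LinearMap.ext fun x => ?_
  rw [expOp, map_add, expEnd_add (diffOp_commute _ _) (diffOp_locNil hp) (diffOp_locNil hq)]
  rfl

lemma expOp_zero : expOp (0 : Symb ι n) = 1 := by
  refine LinearMap.ext fun x => ?_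
  rw [expOp, expEnd_eq_sum (diffOp_locNil (map_zero _)) (r := 1) (by simp)]
  simp

lemma expOp_diffOp {q : Symb ι n} (hq : MvPolynomial.constantCoeff q = 0) (p : Symb ι n)
    (x : Slots ι n) : expOp q (diffOp p x) = diffOp p (expOp q x) :=
  (expEnd_intertwine (diffOp_locNil hq) (diffOp_locNil hq) (diffOp p)
    (fun y => by rw [← diffOp_mul_apply, mul_comm, diffOp_mul_apply]) x).symm

lemma expOp_list_sum {α : Type*} (l : List α) (q : α → Symb ι n)
    (hq : ∀ i, MvPolynomial.constantCoeff (q i) = 0) :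
    expOp (l.map q).sum = (l.map fun i => expOp (q i)).prod := by
  induction l with
  | nil => exact expOp_zero
  | cons i l ih =>
    rw [List.map_cons, List.sum_cons, List.map_cons, List.prod_cons, ← ih, expOp_add (hq i)]
    rw [map_list_sum, List.map_map]
    refine List.sum_eq_zero ?_
    simp [hq]

/-! ### Merging of slots and pullback of symbols. -/

/-- The symbol map dual to `merge`. -/
def pull [Fintype ι] [DecidableEq κ] (f : ι → κ) :
    Symb κ n →ₐ[Coeff] Symb ι n :=
  MvPolynomial.aeval fun p => ∑ i, if f i = p.1 then MvPolynomial.X (i, p.2) else 0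

lemma pull_X [Fintype ι] [DecidableEq κ] (f : ι → κ) (k : κ) (v : Var n) :
    pull f (MvPolynomial.X (k, v)) = ∑ i, if f i = k then MvPolynomial.X (i, v) else 0 := by
  simp [pull]

lemma constantCoeff_pull [Fintype ι] [DecidableEq κ] (f : ι → κ) (q : Symb κ n) :
    MvPolynomial.constantCoeff (pull f q) = MvPolynomial.constantCoeff q := by
  induction q using MvPolynomial.induction_on with
  | C a => simp [pull]
  | add p q hp hq => rw [map_add, map_add, hp, hq, map_add]
  | mul_X p i hp =>
    obtain ⟨k, v⟩ := i
    rw [map_mul, map_mul, map_mul, hp, pull_X, map_sum, MvPolynomial.constantCoeff_X]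
    rw [Finset.sum_eq_zero]
    intro j _
    split_ifs <;> simp

/-- The chain rule: a derivative in slot `k` after merging is the sum of the derivatives in the
slots over `k`, which is how `pull` is defined on variables. -/
lemma diffOp_merge [Fintype ι] [DecidableEq κ] (f : ι → κ) (q : Symb κ n) (x : Slots ι n) :
    diffOp q (merge f x) = merge f (diffOp (pull f q) x) := by
  induction q using MvPolynomial.induction_on generalizing x with
  | C a =>
    rw [← MvPolynomial.algebraMap_eq, AlgHom.commutes, AlgHom.commutes, AlgHom.commutes,
      Module.algebraMap_end_apply, Module.algebraMap_end_apply, map_smul]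
  | add p q hp hq =>
    rw [map_add, map_add, map_add, LinearMap.add_apply, LinearMap.add_apply, map_add, hp, hq]
  | mul_X p i hp =>
    obtain ⟨k, v⟩ := i
    rw [diffOp_mul_apply, map_mul, diffOp_mul_apply, ← hp, diffOp_X, slotDeriv_merge, pull_X,
      map_sum diffOp, LinearMap.sum_apply, map_sum (merge f)]
    congr 1
    refine Finset.sum_congr rfl fun i _ => ?_
    split_ifs
    · rw [diffOp_X]
    · simp

lemma expOp_merge [Fintype ι] [DecidableEq κ] (f : ι → κ) {q : Symb κ n}
    (hq : MvPolynomial.constantCoeff q = 0) (x : Slots ι n) :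
    expOp q (merge f x) = merge f (expOp (pull f q) x) :=
  (expEnd_intertwine (diffOp_locNil (by rw [constantCoeff_pull, hq])) (diffOp_locNil hq)
    (merge f).toLinearMap (fun y => (diffOp_merge f q y).symm) x).symm

lemma evalZero_merge (f : ι → κ) (x : Slots ι n) :
    evalZero (merge f x) = evalZero x := by
  simp only [evalZero, merge, MvPolynomial.aeval_rename]
  rfl

/-! ### Poisson symbols and quadratic symbols. -/

/-- The symbol of `poisson i j`. -/
def poissonSymb (i j : ι) : Symb ι n :=
  ∑ s : Fin n, (MvPolynomial.X (i, Sum.inl s) * MvPolynomial.X (j, Sum.inr s)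
    - MvPolynomial.X (i, Sum.inr s) * MvPolynomial.X (j, Sum.inl s))

lemma diffOp_poissonSymb (i j : ι) : diffOp (poissonSymb (n := n) i j) = poisson i j := by
  simp only [poissonSymb, map_sum, map_sub, map_mul, diffOp_X, poisson]

lemma constantCoeff_poissonSymb (i j : ι) :
    MvPolynomial.constantCoeff (poissonSymb (n := n) i j) = 0 := by
  simp [poissonSymb]

lemma poissonSymb_swap (i j : ι) : poissonSymb (n := n) j i = -poissonSymb i j := by
  rw [poissonSymb, poissonSymb, ← Finset.sum_neg_distrib]
  exact Finset.sum_congr rfl fun s _ => by ring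

lemma pull_poissonSymb [Fintype ι] [DecidableEq κ] (f : ι → κ) (k l : κ) :
    pull f (poissonSymb (n := n) k l)
      = ∑ i, ∑ j, if f i = k ∧ f j = l then poissonSymb i j else 0 := by
  have h : ∀ v w : Var n, pull f (MvPolynomial.X (k, v) * MvPolynomial.X (l, w))
      = ∑ i, ∑ j, if f i = k ∧ f j = l then
        (MvPolynomial.X (i, v) * MvPolynomial.X (j, w) : Symb ι n) else 0 := by
    intro v w
    rw [map_mul, pull_X, pull_X, Finset.sum_mul_sum]
    refine Finset.sum_congr rfl fun i _ => Finset.sum_congr rfl fun j _ => ?_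
    by_cases h1 : f i = k <;> by_cases h2 : f j = l <;> simp [h1, h2]
  rw [poissonSymb, map_sum]
  simp only [map_sub, h, ← Finset.sum_sub_distrib]
  rw [Finset.sum_comm]
  refine Finset.sum_congr rfl fun i _ => ?_
  rw [Finset.sum_comm]
  refine Finset.sum_congr rfl fun j _ => ?_
  split_ifs
  · rfl
  · simp

/-- The scalar `c ħ` for a real number `c`. -/
def hscal (c : ℝ) : Coeff := algebraMap ℂ Coeff (c : ℂ) * hbar

lemma hscal_add (c d : ℝ) : hscal (c + d) = hscal c + hscal d := by
  simp [hscal, add_mul]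

lemma hscal_neg (c : ℝ) : hscal (-c) = -hscal c := by
  simp [hscal]

lemma hscal_zero : hscal 0 = 0 := by simp [hscal]

/-- The symbol `½ ħ ∑_{i,j} c_{ij} α_{ij}`. -/
def quadSymb [Fintype ι] (c : ι → ι → ℝ) : Symb ι n :=
  ∑ i, ∑ j, hscal (c i j / 2) • poissonSymb i j

lemma constantCoeff_quadSymb [Fintype ι] (c : ι → ι → ℝ) :
    MvPolynomial.constantCoeff (quadSymb (n := n) c) = 0 := by
  simp [quadSymb, MvPolynomial.smul_eq_C_mul, constantCoeff_poissonSymb]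

lemma quadSymb_add [Fintype ι] (c ψ : ι → ι → ℝ) :
    quadSymb (n := n) (c + ψ) = quadSymb c + quadSymb ψ := by
  simp only [quadSymb, Pi.add_apply, add_div, hscal_add, add_smul, Finset.sum_add_distrib]

/-- Every pair `(i, j)` of slots lies over exactly one pair, namely `(f i, f j)`. Thus merging slots
only pulls back the coefficient matrix. -/
lemma pull_quadSymb [Fintype ι] [Fintype κ] [DecidableEq κ] (f : ι → κ) (c : κ → κ → ℝ) :
    pull f (quadSymb (n := n) c) = quadSymb fun i j => c (f i) (f j) := by
  simp only [quadSymb, map_sum, map_smul, pull_poissonSymb, Finset.smul_sum]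
  rw [Finset.sum_congr rfl fun k _ => Finset.sum_comm, Finset.sum_comm]
  refine Finset.sum_congr rfl fun i _ => ?_
  rw [Finset.sum_congr rfl fun k _ => Finset.sum_comm, Finset.sum_comm]
  refine Finset.sum_congr rfl fun j _ => ?_
  rw [Finset.sum_eq_single (f i), Finset.sum_eq_single (f j)]
  · simp
  · intro l _ hl
    simp [hl.symm]
  · simp
  · intro k _ hk
    simp [hk.symm]
  · simp

end Symbols

/-! ## Continuous families and the simplex integral -/

section Tame

open MeasureTheory

variable {X Y : Type*} [TopologicalSpace X] [TopologicalSpace Y]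
variable {M N : Type*} [AddCommGroup M] [Module Coeff M] [AddCommGroup N] [Module Coeff N]

/-- Finite sums `∑ f_k(u) x_k` with continuous complex functions `f_k`. -/
def Tame (y : X → M) : Prop :=
  y ∈ AddSubmonoid.closure {y : X → M | ∃ (f : X → ℂ) (x : M), Continuous f ∧
    y = fun u => algebraMap ℂ Coeff (f u) • x}

lemma tame_smul_const {f : X → ℂ} (hf : Continuous f) (x : M) :
    Tame fun u => algebraMap ℂ Coeff (f u) • x :=
  AddSubmonoid.subset_closure ⟨f, x, hf, rfl⟩

lemma tame_const (x : M) : Tame fun _ : X => x := by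
  simpa using tame_smul_const (X := X) (continuous_const (y := (1 : ℂ))) x

lemma tame_zero : Tame (0 : X → M) := AddSubmonoid.zero_mem _

lemma Tame.add {y z : X → M} (hy : Tame y) (hz : Tame z) : Tame (y + z) :=
  AddSubmonoid.add_mem _ hy hz

lemma Tame.induction {P : (X → M) → Prop} {y : X → M} (hy : Tame y)
    (hP : ∀ (f : X → ℂ) (x : M), Continuous f → P fun u => algebraMap ℂ Coeff (f u) • x)
    (h0 : P 0) (hadd : ∀ y z, Tame y → Tame z → P y → P z → P (y + z)) : P y := by
  induction hy using AddSubmonoid.closure_induction with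
  | mem y hy =>
    obtain ⟨f, x, hf, rfl⟩ := hy
    exact hP f x hf
  | zero => exact h0
  | add y z hy hz h1 h2 => exact hadd y z hy hz h1 h2

lemma Tame.map (S : M →ₗ[Coeff] N) {y : X → M} (hy : Tame y) :
    Tame fun u => S (y u) := by
  refine Tame.induction (P := fun y => Tame fun u => S (y u)) hy ?_ ?_ ?_
  · intro f x hf
    simp only [map_smul]
    exact tame_smul_const hf _
  · simpa using tame_const (X := X) (0 : N)
  · intro y z _ _ h1 h2
    simp only [Pi.add_apply, map_add]
    exact h1.add h2

lemma Tame.comp {g : Y → X} (hg : Continuous g) {y : X → M} (hy : Tame y) :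
    Tame fun v => y (g v) := by
  refine Tame.induction (P := fun y => Tame fun v => y (g v)) hy ?_ ?_ ?_
  · intro f x hf
    exact tame_smul_const (hf.comp hg) _
  · exact tame_zero
  · intro y z _ _ h1 h2
    exact h1.add h2

lemma Tame.const_smul (c : Coeff) {y : X → M} (hy : Tame y) : Tame (c • y) :=
  hy.map (LinearMap.lsmul Coeff M c)

lemma Tame.sum {α : Type*} (s : Finset α) {y : α → X → M} (hy : ∀ i ∈ s, Tame (y i)) :
    Tame (fun u => ∑ i ∈ s, y i u) := by
  have h : (fun u => ∑ i ∈ s, y i u) = ∑ i ∈ s, y i := by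
    funext u
    simp
  rw [h]
  exact AddSubmonoid.sum_mem _ hy

/-- On a fixed vector the exponential is a finite sum, with coefficients polynomial in `c u`. -/
lemma Tame.expEnd {T : Module.End Coeff M} (hT : LocNil T) {c : X → ℝ} (hc : Continuous c)
    {y : X → M} (hy : Tame y) :
    Tame (fun u => expEnd (hscal (c u) • T) (y u)) := by
  refine Tame.induction (P := fun y => Tame fun u => WeylCyclic.expEnd (hscal (c u) • T) (y u)) hy ?_ ?_ ?_
  · intro f x hf
    obtain ⟨r, hr⟩ := hT x
    have h : ∀ u, WeylCyclic.expEnd (hscal (c u) • T) (algebraMap ℂ Coeff (f u) • x)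
        = ∑ s ∈ Finset.range r, algebraMap ℂ Coeff (f u * ((s ! : ℂ)⁻¹ * (c u : ℂ) ^ s))
          • (hbar ^ s • (T ^ s) x) := by
      intro u
      have h0 : ((hscal (c u) • T) ^ r) x = 0 := by
        rw [smul_pow, LinearMap.smul_apply, hr, smul_zero]
      rw [map_smul, expEnd_eq_sum (hT.smul _) h0, Finset.smul_sum]
      refine Finset.sum_congr rfl fun s _ => ?_
      rw [smul_pow, LinearMap.smul_apply, hscal, mul_pow, ← map_pow, smul_smul, smul_smul,
        smul_smul, map_mul, map_mul]
      ring_nf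
    simp only [h]
    refine Tame.sum _ fun s _ => tame_smul_const (by fun_prop) _
  · simpa using tame_const (X := X) (0 : M)
  · intro y z hy hz h1 h2
    simp only [Pi.add_apply, map_add]
    exact h1.add h2

lemma coeff_algebraMap_smul (z : ℂ) (c : Coeff) (d : ℤ) :
    (algebraMap ℂ Coeff z • c).coeff d = z * c.coeff d := by
  rw [algebraMap_smul, AddMonoidAlgebra.coeff_smul_apply, smul_eq_mul]

lemma Tame.continuous_coeff {F : X → Coeff} (hF : Tame F) (d : ℤ) :
    Continuous fun u => (F u).coeff d := by
  refine Tame.induction (P := fun F => Continuous fun u => (F u).coeff d) hF ?_ ?_ ?_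
  · intro f x hf
    simp only [coeff_algebraMap_smul]
    fun_prop
  · exact continuous_const
  · intro y z hy hz h1 h2
    exact h1.add h2

/-- The finite set of powers of `ħ` is uniform in `u`; this makes the sum over all degrees in
`simplexIntegral` finite. -/
lemma Tame.exists_support {F : X → Coeff} (hF : Tame F) :
    ∃ S : Finset ℤ, ∀ u, ∀ d ∉ S, (F u).coeff d = 0 := by
  refine Tame.induction (P := fun F => ∃ S : Finset ℤ, ∀ u, ∀ d ∉ S, (F u).coeff d = 0) hF ?_ ?_ ?_
  · intro f x hf
    refine ⟨x.coeff.support, fun u d hd => ?_⟩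
    rw [coeff_algebraMap_smul, Finsupp.notMem_support_iff.mp hd, mul_zero]
  · exact ⟨∅, fun u d _ => rfl⟩
  · intro y z hy hz h1 h2
    obtain ⟨S, hS⟩ := h1
    obtain ⟨S', hS'⟩ := h2
    refine ⟨S ∪ S', fun u d hd => ?_⟩
    rw [Finset.mem_union, not_or] at hd
    rw [Pi.add_apply, AddMonoidAlgebra.coeff_add, Finsupp.add_apply, hS u d hd.1, hS' u d hd.2,
      add_zero]

/-! ### Linearity of the simplex integral. -/

lemma isCompact_simplex (m : ℕ) : IsCompact (simplex m) := by
  have h : simplex m = Set.Icc (0 : Fin m → ℝ) 1 ∩ {u | Monotone u} := by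
    ext u
    simp only [simplex, Set.mem_ofPred_eq, Set.mem_inter_iff, Set.mem_Icc, Pi.le_def, ← forall_and]
    exact and_comm
  rw [h]
  refine isCompact_Icc.inter_right ?_
  have : {u : Fin m → ℝ | Monotone u} = ⋂ i, ⋂ j, ⋂ (_ : i ≤ j), {u | u i ≤ u j} := by
    ext u
    simp [Monotone]
  rw [this]
  exact isClosed_iInter fun i => isClosed_iInter fun j => isClosed_iInter fun _ =>
    isClosed_le (continuous_apply i) (continuous_apply j)

variable {m : ℕ}

/-- This reduces identities between simplex integrals to identities between integrals of complex
functions, one power of `ħ` at a time. -/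
lemma simplexIntegral_coeff {F : (Fin m → ℝ) → Coeff} (hF : Tame F) (d : ℤ) :
    (simplexIntegral F).coeff d = ∫ u in simplex m, (F u).coeff d := by
  obtain ⟨S, hS⟩ := hF.exists_support
  rw [simplexIntegral, finsum_eq_sum_of_support_subset (s := S)]
  · rw [AddMonoidAlgebra.coeff_sum, Finsupp.finsetSum_apply]
    have h : ∀ e : ℤ, (LaurentPolynomial.C (∫ u in simplex m, (F u).coeff e)
        * LaurentPolynomial.T e : Coeff).coeff d
        = if e = d then ∫ u in simplex m, (F u).coeff d else 0 := by
      intro e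
      rw [← LaurentPolynomial.single_eq_C_mul_T, AddMonoidAlgebra.coeff_single,
        Finsupp.single_apply]
      split_ifs with h
      · rw [h]
      · rfl
    simp only [h]
    rw [Finset.sum_ite_eq']
    split_ifs with hd
    · rfl
    · simp [hS _ d hd]
  · intro d hd
    by_contra h
    refine hd ?_
    simp [hS _ d h]

lemma Tame.integrableOn_coeff {F : (Fin m → ℝ) → Coeff} (hF : Tame F)
    (d : ℤ) : IntegrableOn (fun u => (F u).coeff d) (simplex m) :=
  (hF.continuous_coeff d).continuousOn.integrableOn_compact (isCompact_simplex m)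

lemma simplexIntegral_add {F G : (Fin m → ℝ) → Coeff} (hF : Tame F)
    (hG : Tame G) :
    simplexIntegral (F + G) = simplexIntegral F + simplexIntegral G := by
  refine LaurentPolynomial.ext fun d => ?_
  rw [AddMonoidAlgebra.coeff_add, Finsupp.add_apply, simplexIntegral_coeff hF,
    simplexIntegral_coeff hG, simplexIntegral_coeff (hF.add hG),
    ← integral_add (hF.integrableOn_coeff d) (hG.integrableOn_coeff d)]
  rfl

lemma simplexIntegral_zero : simplexIntegral (0 : (Fin m → ℝ) → Coeff) = 0 := by
  simp [simplexIntegral]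

lemma simplexIntegral_smul_const {f : (Fin m → ℝ) → ℂ} (hf : Continuous f) (c : Coeff) :
    simplexIntegral (fun u => algebraMap ℂ Coeff (f u) • c)
      = algebraMap ℂ Coeff (∫ u in simplex m, f u) • c := by
  refine LaurentPolynomial.ext fun d => ?_
  rw [simplexIntegral_coeff (tame_smul_const hf c), coeff_algebraMap_smul]
  simp only [coeff_algebraMap_smul]
  exact integral_mul_const _ _

lemma simplexIntegral_smul (c : Coeff) {F : (Fin m → ℝ) → Coeff}
    (hF : Tame F) : simplexIntegral (c • F) = c • simplexIntegral F := by
  refine Tame.induction (P := fun F => simplexIntegral (c • F) = c • simplexIntegral F) hF ?_ ?_ ?_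
  · intro f x hf
    have : (c • fun u => algebraMap ℂ Coeff (f u) • x) = fun u => algebraMap ℂ Coeff (f u) • (c • x) := by
      funext u
      exact smul_comm c (algebraMap ℂ Coeff (f u)) x
    rw [this, simplexIntegral_smul_const hf, simplexIntegral_smul_const hf, smul_comm]
  · rw [smul_zero, simplexIntegral_zero, smul_zero]
  · intro y z hy hz h1 h2
    rw [smul_add, simplexIntegral_add (hy.const_smul c) (hz.const_smul c), h1, h2,
      simplexIntegral_add hy hz, smul_add]

lemma simplexIntegral_sum {α : Type*} (s : Finset α) {F : α → (Fin m → ℝ) → Coeff}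
    (hF : ∀ i ∈ s, Tame (F i)) :
    simplexIntegral (∑ i ∈ s, F i) = ∑ i ∈ s, simplexIntegral (F i) := by
  classical
  induction s using Finset.induction_on with
  | empty => simp [simplexIntegral_zero]
  | insert i s hi ih =>
    rw [Finset.sum_insert hi, Finset.sum_insert hi, simplexIntegral_add
      (hF i (Finset.mem_insert_self _ _))
      (AddSubmonoid.sum_mem _ fun j hj => hF j (Finset.mem_insert_of_mem hj)),
      ih fun j hj => hF j (Finset.mem_insert_of_mem hj)]

end Tame

/-! ## Derivatives of exponentials -/

lemma hasDerivAt_coeff_expEnd {M : Type*} [AddCommGroup M] [Module Coeff M]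
    {T : Module.End Coeff M} (hT : LocNil T) (ℓ : M →ₗ[Coeff] Coeff) (x : M) (d : ℤ) (t : ℝ) :
    HasDerivAt (fun t : ℝ => (ℓ (expEnd (hscal t • T) x)).coeff d)
      ((ℓ (expEnd (hscal t • T) (hbar • T x))).coeff d) t := by
  obtain ⟨r, hr⟩ := hT x
  -- The series is cut after `r + 1` terms and its derivative after `r` terms: differentiation kills
  -- the term `s = 0` and shifts the others down by one, so the two sums then match term by term.
  have h0 : ∀ t, ((hscal t • T) ^ (r + 1)) x = 0 := fun t => by
    rw [smul_pow, LinearMap.smul_apply, pow_apply_zero_of_le hr (Nat.le_succ r), smul_zero]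
  have h1 : ∀ t, ((hscal t • T) ^ r) (hbar • T x) = 0 := fun t => by
    rw [smul_pow, LinearMap.smul_apply, map_smul, ← Module.End.mul_apply, ← pow_succ,
      pow_apply_zero_of_le hr (Nat.le_succ r), smul_zero, smul_zero]
  have e0 : ∀ t : ℝ, (ℓ (expEnd (hscal t • T) x)).coeff d
      = ∑ s ∈ Finset.range (r + 1), ((s ! : ℂ)⁻¹ * (t : ℂ) ^ s)
        * (ℓ (hbar ^ s • (T ^ s) x)).coeff d := by
    intro t
    rw [expEnd_eq_sum (hT.smul _) (h0 t), map_sum, AddMonoidAlgebra.coeff_sum,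
      Finsupp.finsetSum_apply]
    refine Finset.sum_congr rfl fun s _ => ?_
    rw [smul_pow, LinearMap.smul_apply, hscal, mul_pow, ← map_pow, mul_smul, smul_smul,
      ← map_mul, map_smul, coeff_algebraMap_smul]
  have e1 : (ℓ (expEnd (hscal t • T) (hbar • T x))).coeff d
      = ∑ s ∈ Finset.range r, ((s ! : ℂ)⁻¹ * (t : ℂ) ^ s)
        * (ℓ (hbar ^ (s + 1) • (T ^ (s + 1)) x)).coeff d := by
    rw [expEnd_eq_sum (hT.smul _) (h1 t), map_sum, AddMonoidAlgebra.coeff_sum,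
      Finsupp.finsetSum_apply]
    refine Finset.sum_congr rfl fun s _ => ?_
    rw [smul_pow, LinearMap.smul_apply, hscal, mul_pow, ← map_pow, mul_smul, smul_smul,
      ← map_mul, map_smul, coeff_algebraMap_smul, map_smul (T ^ s), smul_smul, ← pow_succ,
      pow_succ T, Module.End.mul_apply]
  rw [e1]
  simp only [e0]
  have hd : ∀ s : ℕ, HasDerivAt (fun t : ℝ => ((s ! : ℂ)⁻¹ * (t : ℂ) ^ s)
        * (ℓ (hbar ^ s • (T ^ s) x)).coeff d)
      ((s ! : ℂ)⁻¹ * ((s : ℂ) * (t : ℂ) ^ (s - 1)) * (ℓ (hbar ^ s • (T ^ s) x)).coeff d) t := by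
    intro s
    have := ((hasDerivAt_pow s (t : ℂ)).comp_ofReal)
    exact (this.const_mul _).mul_const _
  have := HasDerivAt.fun_sum (u := Finset.range (r + 1)) fun s _ => hd s
  refine this.congr_deriv ?_
  rw [Finset.sum_range_succ']
  simp only [Nat.cast_zero, zero_mul, mul_zero, add_zero]
  refine Finset.sum_congr rfl fun s _ => ?_
  congr 1
  rw [Nat.add_sub_cancel, ← mul_assoc, Nat.factorial_succ, Nat.cast_mul, mul_inv]
  congr 1
  have : ((s + 1 : ℕ) : ℂ) ≠ 0 := Nat.cast_ne_zero.mpr (Nat.succ_ne_zero s)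
  field_simp

/-! ## Pfaffians of the symplectic form as sums of determinants -/

section Pfaffian

variable {A : Type*} [CommRing A] {n r : ℕ}

/-- The pairs `(t, b)` with `b < 2`, numbered by `2 t + b`. -/
def pairEquiv (r : ℕ) : Fin r × Fin 2 ≃ Fin (2 * r) :=
  finProdFinEquiv.trans (finCongr (mul_comm r 2))

lemma pairEquiv_val (t : Fin r) (b : Fin 2) :
    (pairEquiv r (t, b) : ℕ) = b + 2 * t := rfl

lemma pairEquiv_zero (t : Fin r) : (⟨2 * t, by omega⟩ : Fin (2 * r)) = pairEquiv r (t, 0) := by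
  ext
  simp [pairEquiv_val]

lemma pairEquiv_one (t : Fin r) : (⟨2 * t + 1, by omega⟩ : Fin (2 * r)) = pairEquiv r (t, 1) := by
  ext
  simp [pairEquiv_val, add_comm]

lemma prod_pairs {M : Type*} [CommMonoid M] (f : Fin (2 * r) → M) :
    ∏ j, f j = ∏ t, (f (pairEquiv r (t, 0)) * f (pairEquiv r (t, 1))) := by
  rw [← (pairEquiv r).prod_comp, Fintype.prod_prod_type]
  simp only [Fin.prod_univ_two]

/-- The sequence of coordinates `p_{s 0}, q_{s 0}, p_{s 1}, q_{s 1}, …`. -/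
def pairCol (s : Fin r → Fin n) (j : Fin (2 * r)) : Var n :=
  if (j : ℕ) % 2 = 0 then Sum.inl (s ⟨(j : ℕ) / 2, by omega⟩)
  else Sum.inr (s ⟨(j : ℕ) / 2, by omega⟩)

lemma pairCol_zero (s : Fin r → Fin n) (t : Fin r) :
    pairCol s (pairEquiv r (t, 0)) = Sum.inl (s t) := by
  have h : ((pairEquiv r (t, 0) : Fin (2 * r)) : ℕ) = 2 * t := by simp [pairEquiv_val]
  unfold pairCol
  rw [if_pos (by omega)]
  congr 3
  omega

lemma pairCol_one (s : Fin r → Fin n) (t : Fin r) :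
    pairCol s (pairEquiv r (t, 1)) = Sum.inr (s t) := by
  have h : ((pairEquiv r (t, 1) : Fin (2 * r)) : ℕ) = 1 + 2 * t := by simp [pairEquiv_val]
  unfold pairCol
  rw [if_neg (by omega)]
  congr 3
  omega

/-- The permutation of `Fin (2 r)` that permutes the pairs `{2 t, 2 t + 1}`. -/
def pairPerm (τ : Equiv.Perm (Fin r)) : Equiv.Perm (Fin (2 * r)) :=
  (pairEquiv r).permCongr (Equiv.prodCongrLeft fun _ => τ)

lemma pairPerm_apply (τ : Equiv.Perm (Fin r)) (t : Fin r) (b : Fin 2) :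
    pairPerm τ (pairEquiv r (t, b)) = pairEquiv r (τ t, b) := by
  simp [pairPerm, Equiv.permCongr_apply]

/-- The permutation acts as `τ` on the even and on the odd positions, so its sign is a square. -/
lemma sign_pairPerm (τ : Equiv.Perm (Fin r)) : Equiv.Perm.sign (pairPerm τ) = 1 := by
  rw [pairPerm, Equiv.Perm.sign_permCongr, Equiv.Perm.sign_prodCongrLeft, Fin.prod_univ_two,
    Int.units_mul_self]

lemma pairCol_pairPerm (s : Fin r → Fin n) (τ : Equiv.Perm (Fin r)) (j : Fin (2 * r)) :
    pairCol s (pairPerm τ j) = pairCol (s ∘ τ) j := by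
  obtain ⟨⟨t, b⟩, rfl⟩ := (pairEquiv r).surjective j
  rw [pairPerm_apply]
  fin_cases b
  · exact (pairCol_zero s (τ t)).trans (pairCol_zero (s ∘ τ) t).symm
  · exact (pairCol_one s (τ t)).trans (pairCol_one (s ∘ τ) t).symm

/-- The permutation of `Fin (2 r)` that swaps `2 t` and `2 t + 1` for `t ∈ T`. -/
def pairFlip (T : Finset (Fin r)) : Equiv.Perm (Fin (2 * r)) :=
  (pairEquiv r).permCongr (Equiv.prodCongrRight fun t => if t ∈ T then Equiv.swap 0 1 else 1)

lemma pairFlip_apply (T : Finset (Fin r)) (t : Fin r) (b : Fin 2) :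
    pairFlip T (pairEquiv r (t, b))
      = pairEquiv r (t, (if t ∈ T then Equiv.swap 0 1 else 1 : Equiv.Perm (Fin 2)) b) := by
  simp [pairFlip, Equiv.permCongr_apply]

lemma sign_pairFlip (T : Finset (Fin r)) :
    Equiv.Perm.sign (pairFlip T) = (-1) ^ T.card := by
  rw [pairFlip, Equiv.Perm.sign_permCongr, Equiv.Perm.sign_prodCongrRight]
  have : ∀ t, Equiv.Perm.sign (if t ∈ T then Equiv.swap 0 1 else 1 : Equiv.Perm (Fin 2))
      = if t ∈ T then -1 else 1 := by
    intro t
    split_ifs <;> simp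
  simp only [this]
  rw [Finset.prod_ite_mem, Finset.univ_inter, Finset.prod_const]

/-- Antisymmetrization of a product of differences. -/
lemma sum_sign_prod_sub (c : Fin (2 * r) → Fin (2 * r) → A) :
    ∑ σ : Equiv.Perm (Fin (2 * r)), ((Equiv.Perm.sign σ : ℤ) : A) *
      ∏ t, (c (σ (pairEquiv r (t, 0))) (σ (pairEquiv r (t, 1)))
        - c (σ (pairEquiv r (t, 1))) (σ (pairEquiv r (t, 0))))
      = 2 ^ r * ∑ σ : Equiv.Perm (Fin (2 * r)), ((Equiv.Perm.sign σ : ℤ) : A) *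
        ∏ t, c (σ (pairEquiv r (t, 0))) (σ (pairEquiv r (t, 1))) := by
  classical
  simp only [Finset.prod_sub, Finset.mul_sum]
  rw [Finset.sum_comm, ← Finset.mul_sum]
  -- In the expanded product, `T` is the set of pairs where the subtracted term is chosen. Composing
  -- `σ` with the flip of these pairs restores the order of the arguments, and the sign of the flip
  -- cancels `(-1) ^ T.card`. All `2 ^ r` sets `T` thus contribute equally.
  have key : ∀ T ∈ (Finset.univ : Finset (Fin r)).powerset,
      ∑ σ : Equiv.Perm (Fin (2 * r)), ((Equiv.Perm.sign σ : ℤ) : A) *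
      ((-1) ^ T.card * (∏ t ∈ Finset.univ \ T,
          c (σ (pairEquiv r (t, 0))) (σ (pairEquiv r (t, 1))))
        * ∏ t ∈ T, c (σ (pairEquiv r (t, 1))) (σ (pairEquiv r (t, 0))))
      = ∑ σ : Equiv.Perm (Fin (2 * r)), ((Equiv.Perm.sign σ : ℤ) : A) *
        ∏ t, c (σ (pairEquiv r (t, 0))) (σ (pairEquiv r (t, 1))) := by
    intro T _
    rw [← Equiv.sum_comp (Equiv.mulRight (pairFlip T))]
    refine Finset.sum_congr rfl fun σ _ => ?_
    rw [Equiv.coe_mulRight, Equiv.Perm.sign_mul, sign_pairFlip]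
    have h1 : ∏ t ∈ Finset.univ \ T,
          c ((σ * pairFlip T) (pairEquiv r (t, 0))) ((σ * pairFlip T) (pairEquiv r (t, 1)))
        = ∏ t ∈ Finset.univ \ T, c (σ (pairEquiv r (t, 0))) (σ (pairEquiv r (t, 1))) := by
      refine Finset.prod_congr rfl fun t ht => ?_
      rw [Finset.mem_sdiff] at ht
      rw [Equiv.Perm.mul_apply, Equiv.Perm.mul_apply, pairFlip_apply, pairFlip_apply,
        if_neg ht.2]
      rfl
    have h2 : ∏ t ∈ T,
          c ((σ * pairFlip T) (pairEquiv r (t, 1))) ((σ * pairFlip T) (pairEquiv r (t, 0)))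
        = ∏ t ∈ T, c (σ (pairEquiv r (t, 0))) (σ (pairEquiv r (t, 1))) := by
      refine Finset.prod_congr rfl fun t ht => ?_
      rw [Equiv.Perm.mul_apply, Equiv.Perm.mul_apply, pairFlip_apply, pairFlip_apply,
        if_pos ht, Equiv.swap_apply_left, Equiv.swap_apply_right]
    rw [h1, h2, mul_assoc ((-1) ^ T.card), Finset.prod_sdiff (Finset.subset_univ T), ← mul_assoc]
    congr 1
    push_cast
    rw [mul_assoc, ← mul_pow]
    simp
  rw [Finset.sum_congr rfl key, Finset.sum_const, Finset.card_powerset, Finset.card_univ,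
    Fintype.card_fin, nsmul_eq_mul]
  push_cast
  rfl

/-- The determinant of the coordinates `p_{s 0}, q_{s 0}, p_{s 1}, …` of the vectors `R i`. -/
def pairDet (R : Fin (2 * r) → Var n → A) (s : Fin r → Fin n) : A :=
  (Matrix.of fun i j => R i (pairCol s j)).det

lemma pairDet_comp_perm (R : Fin (2 * r) → Var n → A) (s : Fin r → Fin n)
    (τ : Equiv.Perm (Fin r)) : pairDet R (s ∘ τ) = pairDet R s := by
  have h := Matrix.det_permute' (pairPerm τ) (Matrix.of fun i j => R i (pairCol s j))
  rw [sign_pairPerm, Units.val_one, Int.cast_one, one_mul] at h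
  rw [pairDet, pairDet, ← h]
  congr 1
  ext i j
  simp [pairCol_pairPerm]

lemma pairDet_eq_zero (R : Fin (2 * r) → Var n → A) {s : Fin r → Fin n}
    (hs : ¬ Function.Injective s) : pairDet R s = 0 := by
  obtain ⟨t, t', h, hne⟩ := Function.not_injective_iff.mp hs
  refine Matrix.det_zero_of_column_eq (i := pairEquiv r (t, 0)) (j := pairEquiv r (t', 0))
    (fun h' => hne ?_) fun k => ?_
  · simpa using (pairEquiv r).injective h'
  · simp only [Matrix.of_apply, pairCol_zero, h]

/-- Multiplying out the product of sums amounts to choosing an index `s t` for each pair `t`; for a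
fixed choice the signed sum over `σ` is the Leibniz formula. -/
lemma sum_sign_prod_eq_sum_pairDet (R : Fin (2 * r) → Var n → A) :
    ∑ σ : Equiv.Perm (Fin (2 * r)), ((Equiv.Perm.sign σ : ℤ) : A) *
      ∏ t, ∑ a, R (σ (pairEquiv r (t, 0))) (Sum.inl a) * R (σ (pairEquiv r (t, 1))) (Sum.inr a)
      = ∑ s, pairDet R s := by
  classical
  simp only [pairDet, Matrix.det_apply', Finset.prod_univ_sum, Fintype.piFinset_univ,
    Finset.mul_sum]
  rw [Finset.sum_comm]
  refine Finset.sum_congr rfl fun s _ => Finset.sum_congr rfl fun σ _ => ?_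
  rw [prod_pairs]
  simp only [Matrix.of_apply, pairCol_zero, pairCol_one]

/-! ### Expansion of the sum of determinants along the first row. -/

/-- The determinant with the row `0` restricted to the columns of the pair `t`. -/
def restrDet {k : ℕ} (R : Fin (2 * (k + 1)) → Var n → A) (s : Fin (k + 1) → Fin n)
    (t : Fin (k + 1)) : A :=
  Matrix.det (n := Fin (2 * k + 1 + 1)) (Matrix.of fun i j =>
    if i = 0 ∧ ((pairEquiv (k + 1)).symm j).1 ≠ t then 0 else R i (pairCol s j))

/-- In the Laplace expansion along row `0`, the column `j` survives on the right only for the pair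
`t` that contains it. -/
lemma pairDet_eq_sum_restrDet {k : ℕ} (R : Fin (2 * (k + 1)) → Var n → A)
    (s : Fin (k + 1) → Fin n) : pairDet R s = ∑ t, restrDet R s t := by
  have h1 : pairDet R s = Matrix.det (n := Fin (2 * k + 1 + 1))
    (Matrix.of fun i j => R i (pairCol s j)) := rfl
  rw [h1]
  simp only [restrDet, Matrix.det_succ_row_zero (n := 2 * k + 1)]
  rw [Finset.sum_comm]
  refine Finset.sum_congr rfl fun j _ => ?_
  rw [Finset.sum_eq_single ((pairEquiv (k + 1)).symm j).1]
  · simp only [Matrix.of_apply, ne_eq, not_true_eq_false, and_false, if_false]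
    congr 2
  · intro t _ ht
    simp [ht.symm]
  · simp

/-- Exchanging the pairs `0` and `t` is an even permutation of the columns. -/
lemma restrDet_eq {k : ℕ} (R : Fin (2 * (k + 1)) → Var n → A) (s : Fin (k + 1) → Fin n)
    (t : Fin (k + 1)) : restrDet R s t = restrDet R (s ∘ Equiv.swap 0 t) 0 := by
  have h := Matrix.det_permute' (n := Fin (2 * k + 1 + 1)) (pairPerm (Equiv.swap 0 t))
    (Matrix.of fun i j =>
      if i = 0 ∧ ((pairEquiv (k + 1)).symm j).1 ≠ t then 0 else R i (pairCol s j))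
  have h1 : Equiv.Perm.sign (α := Fin (2 * k + 1 + 1)) (pairPerm (Equiv.swap 0 t)) = 1 :=
    sign_pairPerm _
  rw [h1, Units.val_one, Int.cast_one, one_mul] at h
  rw [restrDet, restrDet, ← h]
  congr 1
  ext i j
  obtain ⟨⟨t', b⟩, rfl⟩ := (pairEquiv (k + 1)).surjective j
  rw [Matrix.submatrix_apply, Matrix.of_apply, Matrix.of_apply, pairCol_pairPerm, pairPerm_apply,
    Equiv.symm_apply_apply, Equiv.symm_apply_apply]
  have h2 : Equiv.swap 0 t t' ≠ t ↔ t' ≠ 0 := by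
    rw [Ne, Ne, Equiv.swap_apply_eq_iff, Equiv.swap_apply_right]
  simp only [id, h2]

lemma fin_zero_eq_pairEquiv (k : ℕ) :
    (0 : Fin (2 * k + 1 + 1)) = pairEquiv (k + 1) (0, 0) := by
  ext
  simp [pairEquiv_val]

lemma fin_one_eq_pairEquiv (k : ℕ) :
    (Fin.succ 0 : Fin (2 * k + 1 + 1)) = pairEquiv (k + 1) (0, 1) := by
  ext
  simp [pairEquiv_val]

lemma pairCol_cons_zero {k : ℕ} (a : Fin n) (s : Fin k → Fin n) :
    pairCol (Fin.cons a s : Fin (k + 1) → Fin n) (0 : Fin (2 * k + 1 + 1)) = Sum.inl a := by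
  rw [fin_zero_eq_pairEquiv, pairCol_zero, Fin.cons_zero]

lemma pairCol_cons_one {k : ℕ} (a : Fin n) (s : Fin k → Fin n) :
    pairCol (Fin.cons a s : Fin (k + 1) → Fin n) (Fin.succ 0 : Fin (2 * k + 1 + 1))
      = Sum.inr a := by
  rw [fin_one_eq_pairEquiv, pairCol_one, Fin.cons_zero]

lemma pairCol_cons_succ {k : ℕ} (a : Fin n) (s : Fin k → Fin n) (j : Fin (2 * k)) :
    pairCol (Fin.cons a s : Fin (k + 1) → Fin n) (j.succ.succ : Fin (2 * k + 1 + 1))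
      = pairCol s j := by
  have h1 : ((j.succ.succ : Fin (2 * k + 1 + 1)) : ℕ) = j + 2 := rfl
  unfold pairCol
  have h3 : (⟨((j.succ.succ : Fin (2 * k + 1 + 1)) : ℕ) / 2, by omega⟩ : Fin (k + 1))
      = Fin.succ ⟨(j : ℕ) / 2, by omega⟩ := by
    ext
    simp only [Fin.val_succ]
    omega
  rw [h3, Fin.cons_succ]
  by_cases h : (j : ℕ) % 2 = 0
  · rw [if_pos h, if_pos (by omega)]
  · rw [if_neg h, if_neg (by omega)]

/-- Row `0` has entries only in the columns `0` and `1`. Deleting one of these leaves the other as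
first column; expanding along it produces the same minor in both cases. The two coefficients
combine, with opposite signs, to the symplectic pairing of row `0` with row `i + 1`. -/
lemma restrDet_cons_zero {k : ℕ} (R : Fin (2 * (k + 1)) → Var n → A) (a : Fin n)
    (s : Fin k → Fin n) :
    restrDet R (Fin.cons a s : Fin (k + 1) → Fin n) 0
      = ∑ i : Fin (2 * k + 1), (-1) ^ (i : ℕ) *
        (R (0 : Fin (2 * k + 1 + 1)) (Sum.inl a) * R i.succ (Sum.inr a)
          - R (0 : Fin (2 * k + 1 + 1)) (Sum.inr a) * R i.succ (Sum.inl a))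
        * pairDet (fun j => R (i.succAbove j).succ) s := by
  have hz : ∀ j : Fin (2 * k), ((pairEquiv (k + 1)).symm j.succ.succ).1 ≠ 0 := by
    intro j h
    have h2 := congrArg Fin.val ((pairEquiv (k + 1)).apply_symm_apply j.succ.succ)
    rw [← Prod.mk.eta (p := (pairEquiv (k + 1)).symm j.succ.succ), pairEquiv_val, h] at h2
    have h3 : ((j.succ.succ : Fin (2 * k + 1 + 1)) : ℕ) = j + 2 := rfl
    have h4 := ((pairEquiv (k + 1)).symm j.succ.succ).2.isLt
    simp only [Fin.val_zero] at h2
    omega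
  have h0 : ((pairEquiv (k + 1)).symm (0 : Fin (2 * k + 1 + 1))).1 = 0 := by
    rw [fin_zero_eq_pairEquiv, Equiv.symm_apply_apply]
  have h1 : ((pairEquiv (k + 1)).symm (Fin.succ 0 : Fin (2 * k + 1 + 1))).1 = 0 := by
    rw [fin_one_eq_pairEquiv, Equiv.symm_apply_apply]
  rw [restrDet, Matrix.det_succ_row_zero (n := 2 * k + 1), Fin.sum_univ_succ, Fin.sum_univ_succ,
    Finset.sum_eq_zero (s := (Finset.univ : Finset (Fin (2 * k))))]
  · simp only [Matrix.of_apply, h0, h1, ne_eq, not_true_eq_false, and_false, if_false,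
      pairCol_cons_zero, pairCol_cons_one, add_zero, Fin.val_zero, pow_zero, one_mul,
      Fin.val_succ, zero_add, pow_one]
    rw [Matrix.det_succ_column_zero, Matrix.det_succ_column_zero, Finset.mul_sum, Finset.mul_sum,
      ← Finset.sum_add_distrib]
    refine Finset.sum_congr rfl fun i _ => ?_
    have e1 : ((((Matrix.of fun (i j : Fin (2 * k + 1 + 1)) =>
        if i = 0 ∧ ¬ ((pairEquiv (k + 1)).symm j).1 = 0 then (0 : A)
        else R i (pairCol (Fin.cons a s : Fin (k + 1) → Fin n) j)).submatrix Fin.succ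
          (Fin.succAbove 0)).submatrix i.succAbove Fin.succ).det)
        = pairDet (fun j => R (i.succAbove j).succ) s := by
      rw [pairDet]
      congr 1
      ext x y
      simp [Fin.succ_ne_zero, pairCol_cons_succ]
    have e2 : ((((Matrix.of fun (i j : Fin (2 * k + 1 + 1)) =>
        if i = 0 ∧ ¬ ((pairEquiv (k + 1)).symm j).1 = 0 then (0 : A)
        else R i (pairCol (Fin.cons a s : Fin (k + 1) → Fin n) j)).submatrix Fin.succ
          (Fin.succAbove (Fin.succ 0))).submatrix i.succAbove Fin.succ).det)
        = pairDet (fun j => R (i.succAbove j).succ) s := by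
      rw [pairDet]
      congr 1
      ext x y
      simp [Fin.succ_ne_zero, pairCol_cons_succ]
    rw [e1, e2]
    simp only [Matrix.submatrix_apply, Matrix.of_apply, Fin.succ_ne_zero, false_and, if_false,
      Fin.succAbove_zero, Fin.succ_succAbove_zero, pairCol_cons_zero, pairCol_cons_one]
    ring
  · intro j _
    simp only [Matrix.of_apply, ne_eq, hz j, not_false_eq_true, and_self, if_true, mul_zero,
      zero_mul]

/-- Row `0` may use any of the `k + 1` pairs of columns. After summation over `s` all of them
contribute the same, which explains the factor. -/
lemma sum_pairDet_succ {k : ℕ} (R : Fin (2 * (k + 1)) → Var n → A) :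
    ∑ s, pairDet R s = (k + 1 : A) * ∑ i : Fin (2 * k + 1), (-1) ^ (i : ℕ) *
      (∑ a, (R (0 : Fin (2 * k + 1 + 1)) (Sum.inl a) * R i.succ (Sum.inr a)
          - R (0 : Fin (2 * k + 1 + 1)) (Sum.inr a) * R i.succ (Sum.inl a)))
        * ∑ s, pairDet (fun j => R (i.succAbove j).succ) s := by
  simp only [pairDet_eq_sum_restrDet]
  rw [Finset.sum_comm]
  have h : ∀ t, ∑ s, restrDet R s t = ∑ s, restrDet R s 0 := by
    intro t
    rw [← (Equiv.arrowCongr (Equiv.swap 0 t) (Equiv.refl (Fin n))).sum_comp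
      fun s => restrDet R s 0]
    refine Finset.sum_congr rfl fun s _ => ?_
    rw [restrDet_eq]
    rfl
  rw [Finset.sum_congr rfl fun t _ => h t, Finset.sum_const, Finset.card_univ, Fintype.card_fin,
    nsmul_eq_mul, ← (Fin.consEquiv fun _ => Fin n).sum_comp, Fintype.sum_prod_type]
  push_cast
  congr 1
  have : ∀ (a : Fin n) (s : Fin k → Fin n),
      restrDet R ((Fin.consEquiv fun _ => Fin n) (a, s)) 0
      = restrDet R (Fin.cons a s : Fin (k + 1) → Fin n) 0 := fun _ _ => rfl
  simp only [this, restrDet_cons_zero, Finset.mul_sum, Finset.sum_mul]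
  rw [Finset.sum_congr rfl fun a _ => Finset.sum_comm, Finset.sum_comm]
  refine Finset.sum_congr rfl fun i _ => ?_
  rw [Finset.sum_comm]

/-! ### Normalized Pfaffians and their row operations. -/

variable [Algebra Coeff A]

/-- The coefficient `ħ ^ r / r !`. -/
def pfCoeff (r : ℕ) : Coeff := algebraMap ℂ Coeff ((r ! : ℂ)⁻¹) * hbar ^ r

/-- The Pfaffian of the matrix of the values of the form `ħ ∑ d p_a ∧ d q_a` on the vectors
`R i`. -/
def pfaff (R : Fin (2 * r) → Var n → A) : A := pfCoeff r • ∑ s, pairDet R s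

/-- The form `ħ ∑ d p_a ∧ d q_a`. -/
def sympl (x y : Var n → A) : A :=
  hbar • ∑ a, (x (Sum.inl a) * y (Sum.inr a) - x (Sum.inr a) * y (Sum.inl a))

lemma pfCoeff_succ (k : ℕ) : pfCoeff (k + 1) * (k + 1 : ℕ) = pfCoeff k * hbar := by
  rw [pfCoeff, pfCoeff, ← map_natCast (algebraMap ℂ Coeff), pow_succ, Nat.factorial_succ]
  have h : ((k + 1 : ℕ) : ℂ) ≠ 0 := Nat.cast_ne_zero.mpr (Nat.succ_ne_zero k)
  have h2 : (((k + 1) * k ! : ℕ) : ℂ)⁻¹ * ((k + 1 : ℕ) : ℂ) = (k ! : ℂ)⁻¹ := by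
    push_cast at h ⊢
    field_simp
  rw [← h2, map_mul]
  ring

/-- The usual expansion of a Pfaffian along its first row; the factor `k + 1` of `sum_pairDet_succ`
is absorbed by the factorial in `pfCoeff`. -/
lemma pfaff_succ {k : ℕ} (R : Fin (2 * (k + 1)) → Var n → A) :
    pfaff R = ∑ i : Fin (2 * k + 1), (-1) ^ (i : ℕ) *
      sympl (R (0 : Fin (2 * k + 1 + 1))) (R i.succ)
        * pfaff fun j : Fin (2 * k) => R (i.succAbove j).succ := by
  have h : (pfCoeff (k + 1) • (k + 1 : A) : A) = algebraMap Coeff A (pfCoeff k * hbar) := by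
    rw [← pfCoeff_succ, Algebra.smul_def, map_mul]
    simp
  rw [pfaff, sum_pairDet_succ, ← smul_mul_assoc, h, Finset.mul_sum]
  refine Finset.sum_congr rfl fun i _ => ?_
  rw [sympl, pfaff, Algebra.smul_def, Algebra.smul_def, map_mul]
  ring

/-- There is no injective `s : Fin r → Fin n`, so every determinant in the sum has a repeated
column. -/
lemma pfaff_eq_zero (h : n < r) (R : Fin (2 * r) → Var n → A) : pfaff R = 0 := by
  rw [pfaff, Finset.sum_eq_zero, smul_zero]
  intro s _
  refine pairDet_eq_zero R fun hs => ?_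
  have := Fintype.card_le_of_injective s hs
  simp at this
  omega

/-- Only the bijective `s` contribute. Each of these `n !` permutations moves whole pairs of columns
and gives the same determinant, which cancels the factorial in `pfCoeff`. -/
lemma pfaff_top (R : Fin (2 * n) → Var n → A) : pfaff R = hbar ^ n • pairDet R id := by
  classical
  have h : ∑ s, pairDet R s = (n ! : A) * pairDet R id := by
    rw [← Finset.sum_subset (Finset.subset_univ
      (Finset.univ.image fun σ : Equiv.Perm (Fin n) => (σ : Fin n → Fin n)))]
    · rw [Finset.sum_image fun σ _ τ _ h => Equiv.coe_fn_injective h]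
      have hp : ∀ σ : Equiv.Perm (Fin n), pairDet R σ = pairDet R id := pairDet_comp_perm R id
      rw [Finset.sum_congr rfl fun σ _ => hp σ, Finset.sum_const,
        Finset.card_univ, Fintype.card_perm, Fintype.card_fin, nsmul_eq_mul]
    · intro s _ hs
      refine pairDet_eq_zero R fun hi => hs ?_
      exact Finset.mem_image.mpr
        ⟨Equiv.ofBijective s (Finite.injective_iff_bijective.mp hi), Finset.mem_univ _, rfl⟩
  have h2 : algebraMap ℂ Coeff ((n ! : ℂ)⁻¹) * (n ! : Coeff) = 1 := by
    rw [← map_natCast (algebraMap ℂ Coeff), ← map_mul,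
      inv_mul_cancel₀ (Nat.cast_ne_zero.mpr (Nat.factorial_ne_zero n)), map_one]
  have h3 : (n ! : A) * pairDet R id = (n ! : Coeff) • pairDet R id := by
    rw [Algebra.smul_def, map_natCast]
  rw [pfaff, h, h3, smul_smul, pfCoeff, mul_right_comm, h2, one_mul]

lemma pfaff_comp_perm (R : Fin (2 * r) → Var n → A) (σ : Equiv.Perm (Fin (2 * r))) :
    pfaff (fun i => R (σ i)) = ((Equiv.Perm.sign σ : ℤ) : A) * pfaff R := by
  have h : ∀ s, pairDet (fun i => R (σ i)) s = ((Equiv.Perm.sign σ : ℤ) : A) * pairDet R s :=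
    fun s => Matrix.det_permute σ (Matrix.of fun i j => R i (pairCol s j))
  simp only [pfaff, h, ← Finset.mul_sum, mul_smul_comm]

lemma pfaff_map {B : Type*} [CommRing B] [Algebra Coeff B] (f : A →ₐ[Coeff] B)
    (R : Fin (2 * r) → Var n → A) : f (pfaff R) = pfaff fun i v => f (R i v) := by
  rw [pfaff, pfaff, map_smul, map_sum]
  congr 1
  refine Finset.sum_congr rfl fun s _ => ?_
  rw [pairDet, AlgHom.map_det]
  rfl

lemma pfaff_add (R R₁ R₂ : Fin (2 * r) → Var n → A) (i : Fin (2 * r)) (h : R i = R₁ i + R₂ i)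
    (h₁ : ∀ j, j ≠ i → R₁ j = R j) (h₂ : ∀ j, j ≠ i → R₂ j = R j) :
    pfaff R = pfaff R₁ + pfaff R₂ := by
  rw [pfaff, pfaff, pfaff, ← smul_add, ← Finset.sum_add_distrib]
  congr 1
  refine Finset.sum_congr rfl fun s _ => ?_
  have e := Matrix.det_updateRow_add (Matrix.of fun i j => R i (pairCol s j)) i
    (fun j => R₁ i (pairCol s j)) (fun j => R₂ i (pairCol s j))
  rw [pairDet, pairDet, pairDet]
  convert e using 2
  · ext a b
    by_cases ha : a = i
    · subst ha
      simp [h]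
    · rw [Matrix.updateRow_ne ha]
  · congr 1
    ext a b
    by_cases ha : a = i
    · subst ha
      simp
    · rw [Matrix.updateRow_ne ha, Matrix.of_apply, Matrix.of_apply, h₁ a ha]
  · congr 1
    ext a b
    by_cases ha : a = i
    · subst ha
      simp
    · rw [Matrix.updateRow_ne ha, Matrix.of_apply, Matrix.of_apply, h₂ a ha]

/-- A row operation on each determinant. For the Pfaffian of slot derivatives it replaces one slot
by the total derivative, which is the form produced by the integration over the faces. -/
lemma pfaff_update_sum (R : Fin (2 * r) → Var n → A) (i : Fin (2 * r)) :
    pfaff (Function.update R i (∑ j, R j)) = pfaff R := by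
  rw [pfaff, pfaff]
  congr 1
  refine Finset.sum_congr rfl fun s _ => ?_
  have e := Matrix.det_updateRow_sum (Matrix.of fun i j => R i (pairCol s j)) i (fun _ => 1)
  rw [one_smul] at e
  rw [pairDet, pairDet, ← e]
  congr 1
  ext a b
  by_cases ha : a = i
  · subst ha
    simp only [Matrix.of_apply, Function.update_self, Matrix.updateRow_self, one_smul]
    rw [Finset.sum_apply]
    exact (Finset.sum_apply b Finset.univ fun x y => R x (pairCol s y)).symm
  · rw [Matrix.updateRow_ne ha, Matrix.of_apply, Matrix.of_apply, Function.update_of_ne ha]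

/-- Modulo `I` each determinant has a zero row. Applied to annihilator ideals, this gives the
vanishing on scalar arguments. -/
lemma pfaff_mem (I : Ideal A) (R : Fin (2 * r) → Var n → A) (i : Fin (2 * r))
    (h : ∀ v, R i v ∈ I) : pfaff R ∈ I := by
  rw [pfaff, Algebra.smul_def]
  refine Ideal.mul_mem_left _ _ (Ideal.sum_mem _ fun s _ => ?_)
  rw [← Ideal.Quotient.eq_zero_iff_mem, pairDet, RingHom.map_det]
  refine Matrix.det_eq_zero_of_row_eq_zero i fun j => ?_
  exact Ideal.Quotient.eq_zero_iff_mem.mpr (h _)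

end Pfaffian

/-! ## The operators `(ħα)^{∧ k}` as Pfaffians -/

lemma diffOp_list_prod {ι : Type} {n r : ℕ} (g : Fin r → Symb ι n) :
    (List.ofFn fun t => diffOp (g t)).prod = diffOp (∏ t, g t) := by
  rw [← List.prod_ofFn, map_list_prod, List.map_ofFn]
  rfl

lemma hbar_smul_poisson {ι : Type} {n : ℕ} (i j : ι) :
    hbar • poisson (n := n) i j = diffOp (hbar •
      ((∑ a, (MvPolynomial.X (i, Sum.inl a) * MvPolynomial.X (j, Sum.inr a) : Symb ι n))
        - ∑ a, MvPolynomial.X (j, Sum.inl a) * MvPolynomial.X (i, Sum.inr a))) := by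
  have h : poissonSymb (n := n) i j =
      (∑ a, (MvPolynomial.X (i, Sum.inl a) * MvPolynomial.X (j, Sum.inr a) : Symb ι n))
        - ∑ a, MvPolynomial.X (j, Sum.inl a) * MvPolynomial.X (i, Sum.inr a) := by
    rw [poissonSymb, ← Finset.sum_sub_distrib]
    exact Finset.sum_congr rfl fun a _ => by rw [mul_comm (MvPolynomial.X (j, Sum.inl a))]
  rw [← h, map_smul, diffOp_poissonSymb]

lemma intCast_smul_diffOp {ι : Type} {n : ℕ} (z : ℤ) (x : Symb ι n) :
    (z : Coeff) • diffOp x = diffOp ((z : Symb ι n) * x) := by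
  rw [← map_smul, Algebra.smul_def, map_intCast]

/-- Antisymmetrizing the product of the forms yields `2 ^ r` times the sum of determinants, and this
power of two cancels the one in the normalization. -/
lemma pfaff_eq_sum_sign {A : Type*} [CommRing A] [Algebra Coeff A] {n r : ℕ}
    (R : Fin (2 * r) → Var n → A) :
    pfaff R = algebraMap ℂ Coeff ((2 ^ r * r ! : ℂ)⁻¹) • ∑ σ : Equiv.Perm (Fin (2 * r)),
      ((Equiv.Perm.sign σ : ℤ) : A) * ∏ t, hbar •
        ((∑ a, R (σ (pairEquiv r (t, 0))) (Sum.inl a) * R (σ (pairEquiv r (t, 1))) (Sum.inr a))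
        - ∑ a, R (σ (pairEquiv r (t, 1))) (Sum.inl a)
          * R (σ (pairEquiv r (t, 0))) (Sum.inr a)) := by
  have h1 := sum_sign_prod_sub fun i j => ∑ a, R i (Sum.inl a) * R j (Sum.inr a)
  rw [sum_sign_prod_eq_sum_pairDet] at h1
  simp only [Finset.prod_smul, Finset.prod_const, Finset.card_univ, Fintype.card_fin,
    mul_smul_comm, ← Finset.smul_sum]
  rw [h1, pfaff, smul_smul, pfCoeff, mul_inv, map_mul]
  have h5 : (2 ^ r * ∑ s, pairDet R s : A)
      = algebraMap ℂ Coeff (2 ^ r) • ∑ s, pairDet R s := by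
    rw [Algebra.smul_def, map_pow, map_pow, map_ofNat, map_ofNat]
  rw [h5, smul_smul]
  congr 1
  have h6 : algebraMap ℂ Coeff ((2 ^ r)⁻¹) * algebraMap ℂ Coeff (2 ^ r) = 1 := by
    rw [← map_mul, inv_mul_cancel₀ (pow_ne_zero _ two_ne_zero), map_one]
  linear_combination -(algebraMap ℂ Coeff ((r ! : ℂ)⁻¹) * hbar ^ r) * h6

lemma wedgePower_eq_diffOp {m n : ℕ} (r : ℕ) (e : Fin (2 * r) → Fin (m + 1)) :
    wedgePower (n := n) r e
      = diffOp (pfaff fun i v => (MvPolynomial.X (e i, v) : Symb (Fin (m + 1)) n)) := by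
  rw [pfaff_eq_sum_sign, map_smul, map_sum, wedgePower]
  congr 1
  refine Finset.sum_congr rfl fun σ _ => ?_
  rw [← intCast_smul_diffOp, ← diffOp_list_prod]
  congr 2
  refine congrArg List.ofFn (funext fun t => ?_)
  rw [pairEquiv_zero, pairEquiv_one, hbar_smul_poisson]

/-- The determinant is transposed first so that `σ` permutes the coordinates and not the slots, as
in `ffsPi`. -/
lemma pairDet_id_eq_sum {A : Type*} [CommRing A] {n : ℕ} (R : Fin (2 * n) → Var n → A) :
    pairDet R id = ∑ σ : Equiv.Perm (Fin (2 * n)), ((Equiv.Perm.sign σ : ℤ) : A) *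
      ∏ j, R j (coord n (σ j)) := by
  rw [pairDet, ← Matrix.det_transpose, Matrix.det_apply']
  rfl

lemma ffsPi_eq_piEven (n : ℕ) : ffsPi n = piEven n n := by
  rw [piEven, wedgePower_eq_diffOp, pfaff_top, ffsPi, map_smul, pairDet_id_eq_sum, map_sum]
  refine congrArg (hbar ^ n • ·) (Finset.sum_congr rfl fun σ _ => ?_)
  rw [← intCast_smul_diffOp, ← diffOp_list_prod]
  simp only [diffOp_X]

/-! ## Integration over simplices -/

section SimplexIntegrals

open MeasureTheory

variable {m : ℕ}

/-- Fubini in a volume preserving chart in which the simplex is a family of intervals over a smaller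
simplex. It serves both for the insertion of a coordinate and for the rotation of the circle.
Indicator functions are used so that the integrand, which is merely continuous, becomes integrable
on the whole space. -/
lemma setIntegral_simplex_succ {T : ℝ × (Fin m → ℝ) → Fin (m + 1) → ℝ}
    (hT : MeasurePreserving T) (hc : Continuous T) (hi : Function.Injective T)
    {a b : (Fin m → ℝ) → ℝ} (hab : ∀ w ∈ simplex m, a w ≤ b w)
    (hset : ∀ t w, T (t, w) ∈ simplex (m + 1) ↔ w ∈ simplex m ∧ a w ≤ t ∧ t ≤ b w)
    {g : (Fin (m + 1) → ℝ) → ℂ} (hg : Continuous g) :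
    ∫ u in simplex (m + 1), g u = ∫ w in simplex m, ∫ t in (a w)..(b w), g (T (t, w)) := by
  have he : MeasurableEmbedding T := hc.measurableEmbedding hi
  have hS := (isCompact_simplex (m + 1)).measurableSet
  have hint : Integrable ((simplex (m + 1)).indicator g) :=
    (hg.continuousOn.integrableOn_compact (isCompact_simplex (m + 1))).integrable_indicator hS
  have hint2 : Integrable (fun p => (simplex (m + 1)).indicator g (T p)) :=
    (hT.integrable_comp_emb he).mpr hint
  rw [← integral_indicator hS, ← hT.integral_comp he]
  rw [Measure.volume_eq_prod] at hint2 ⊢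
  rw [integral_prod_symm _ hint2, ← integral_indicator (isCompact_simplex m).measurableSet]
  refine integral_congr_ae (Filter.Eventually.of_forall fun w => ?_)
  by_cases hw : w ∈ simplex m
  · rw [Set.indicator_of_mem hw, intervalIntegral.integral_of_le (hab w hw),
      ← integral_Icc_eq_integral_Ioc, ← integral_indicator measurableSet_Icc]
    refine integral_congr_ae (Filter.Eventually.of_forall fun t => ?_)
    have h : T (t, w) ∈ simplex (m + 1) ↔ t ∈ Set.Icc (a w) (b w) :=
      (hset t w).trans ⟨fun h => h.2, fun h => ⟨hw, h⟩⟩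
    by_cases ht : t ∈ Set.Icc (a w) (b w)
    · simp only [Set.indicator_of_mem ht, Set.indicator_of_mem (h.mpr ht)]
    · simp only [Set.indicator_of_notMem ht, Set.indicator_of_notMem (fun h' => ht (h.mp h'))]
  · have h : ∀ t, T (t, w) ∉ simplex (m + 1) := fun t h => hw ((hset t w).mp h).1
    simp only [Set.indicator_of_notMem hw, Set.indicator_of_notMem (h _), integral_zero]

/-! ### Faces of the simplex. -/

/-- The tuple `(0, w_1, …, w_m, 1)`. -/
def withEnds (w : Fin m → ℝ) : Fin (m + 2) → ℝ :=
  Fin.cons (α := fun _ => ℝ) 0 (Fin.snoc (α := fun _ => ℝ) w 1)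

lemma withEnds_zero (w : Fin m → ℝ) : withEnds w 0 = 0 := rfl

lemma withEnds_last (w : Fin m → ℝ) : withEnds w (Fin.last (m + 1)) = 1 := by
  rw [withEnds, ← Fin.succ_last, Fin.cons_succ, Fin.snoc_last]

lemma withEnds_castSucc_succ (w : Fin m → ℝ) (i : Fin m) : withEnds w i.castSucc.succ = w i := by
  rw [withEnds, Fin.cons_succ, Fin.snoc_castSucc]

lemma withEnds_castSucc (w : Fin m → ℝ) (i : Fin (m + 1)) :
    withEnds w i.castSucc = withZero w i := by
  induction i using Fin.cases with
  | zero => rfl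
  | succ i => rw [← Fin.succ_castSucc, withEnds_castSucc_succ, withZero, Fin.cons_succ]

/-- With the end points `0` and `1` included, all constraints have the same form, so the first and
last faces need no separate treatment. -/
lemma mem_simplex_iff (w : Fin m → ℝ) : w ∈ simplex m ↔ Monotone (withEnds w) := by
  constructor
  · rintro ⟨h, h'⟩ i j hij
    induction i using Fin.cases with
    | zero =>
      induction j using Fin.cases with
      | zero => exact le_rfl
      | succ j =>
        induction j using Fin.lastCases with
        | last =>
          rw [Fin.succ_last, withEnds_last, withEnds_zero]
          exact zero_le_one
        | cast j =>
          rw [withEnds_zero, withEnds_castSucc_succ]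
          exact (h' j).1
    | succ i =>
      induction j using Fin.cases with
      | zero => exact absurd hij (not_le.mpr (Fin.succ_pos i))
      | succ j =>
        rw [Fin.succ_le_succ_iff] at hij
        induction j using Fin.lastCases with
        | last =>
          rw [Fin.succ_last, withEnds_last]
          induction i using Fin.lastCases with
          | last => rw [Fin.succ_last, withEnds_last]
          | cast i =>
            rw [withEnds_castSucc_succ]
            exact (h' i).2
        | cast j =>
          induction i using Fin.lastCases with
          | last => exact absurd hij (not_le.mpr (Fin.castSucc_lt_last j))
          | cast i =>
            rw [withEnds_castSucc_succ, withEnds_castSucc_succ]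
            exact h (Fin.castSucc_le_castSucc_iff.mp hij)
  · intro h
    refine ⟨fun i j hij => ?_, fun i => ⟨?_, ?_⟩⟩
    · rw [← withEnds_castSucc_succ w i, ← withEnds_castSucc_succ w j]
      exact h (Fin.succ_le_succ_iff.mpr (Fin.castSucc_le_castSucc_iff.mpr hij))
    · rw [← withEnds_castSucc_succ w i, ← withEnds_zero w]
      exact h (Fin.zero_le _)
    · rw [← withEnds_castSucc_succ w i, ← withEnds_last w]
      exact h (Fin.le_last _)

lemma withEnds_insertNth (i : Fin (m + 1)) (t : ℝ) (w : Fin m → ℝ) :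
    withEnds (i.insertNth (α := fun _ => ℝ) t w)
      = i.succ.castSucc.insertNth (α := fun _ => ℝ) t (withEnds w) := by
  rw [Fin.eq_insertNth_iff]
  constructor
  · rw [← Fin.succ_castSucc, withEnds_castSucc_succ, Fin.insertNth_apply_same]
  · funext j
    rw [Fin.removeNth]
    induction j using Fin.cases with
    | zero =>
      rw [← Fin.succ_castSucc, Fin.succ_succAbove_zero]
      rfl
    | succ j =>
      rw [← Fin.succ_castSucc, Fin.succ_succAbove_succ]
      induction j using Fin.lastCases with
      | last =>
        rw [Fin.succAbove_of_le_castSucc _ _ (Fin.castSucc_le_castSucc_iff.mpr (Fin.le_last i)),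
          Fin.succ_last, Fin.succ_last, withEnds_last, withEnds_last]
      | cast j =>
        rw [Fin.castSucc_succAbove_castSucc, withEnds_castSucc_succ, withEnds_castSucc_succ,
          Fin.insertNth_apply_succAbove]

lemma monotone_insertNth_iff (i : Fin (m + 1)) (t : ℝ) (v : Fin (m + 2) → ℝ) :
    Monotone (i.succ.castSucc.insertNth (α := fun _ => ℝ) t v)
      ↔ Monotone v ∧ v i.castSucc ≤ t ∧ t ≤ v i.succ := by
  set p := i.succ.castSucc with hp
  have hv : ∀ j, v j = (p.insertNth (α := fun _ => ℝ) t v : Fin (m + 3) → ℝ) (p.succAbove j) :=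
    fun j => (Fin.insertNth_apply_succAbove (α := fun _ => ℝ) p t v j).symm
  have ht : t = (p.insertNth (α := fun _ => ℝ) t v : Fin (m + 3) → ℝ) p :=
    (Fin.insertNth_apply_same (α := fun _ => ℝ) p t v).symm
  constructor
  · intro h
    refine ⟨fun a b hab => ?_, ?_, ?_⟩
    · rw [hv a, hv b]
      exact h ((Fin.strictMono_succAbove p).monotone hab)
    · rw [hv]
      conv_rhs => rw [ht]
      refine h (le_of_lt ?_)
      rw [Fin.succAbove_lt_iff_castSucc_lt, hp]
      exact Fin.castSucc_lt_castSucc_iff.mpr Fin.castSucc_lt_succ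
    · rw [hv]
      conv_lhs => rw [ht]
      refine h (le_of_lt ?_)
      rw [Fin.lt_succAbove_iff_le_castSucc]
  · rintro ⟨h, h1, h2⟩ a b hab
    rcases Fin.eq_self_or_eq_succAbove p a with ha | ⟨a, rfl⟩ <;>
    rcases Fin.eq_self_or_eq_succAbove p b with hb | ⟨b, rfl⟩
    · rw [ha, hb]
    · rw [ha, ← ht, ← hv]
      rw [ha] at hab
      have hlt := lt_of_le_of_ne hab (Fin.succAbove_ne p b).symm
      rw [Fin.lt_succAbove_iff_le_castSucc, hp, Fin.castSucc_le_castSucc_iff] at hlt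
      exact h2.trans (h hlt)
    · rw [hb, ← ht, ← hv]
      rw [hb] at hab
      have hlt := lt_of_le_of_ne hab (Fin.succAbove_ne p a)
      rw [Fin.succAbove_lt_iff_castSucc_lt, hp, Fin.castSucc_lt_castSucc_iff,
        ← Fin.le_castSucc_iff] at hlt
      exact (h hlt).trans h1
    · rw [← hv, ← hv]
      exact h ((Fin.strictMono_succAbove p).le_iff_le.mp hab)

/-- The face maps of the simplex. -/
def face (j : Fin (m + 2)) (w : Fin m → ℝ) : Fin (m + 1) → ℝ := fun i =>
  if i.castSucc < j then withEnds w i.succ else withEnds w i.castSucc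

/-- When the inserted coordinate reaches its upper neighbour, two points coincide and the tuple lies
on the next face. The lower neighbour is treated in `insertNth_withEnds_castSucc`. -/
lemma insertNth_withEnds_succ (i : Fin (m + 1)) (w : Fin m → ℝ) :
    i.insertNth (α := fun _ => ℝ) (withEnds w i.succ) w = face i.succ w := by
  funext l
  rcases Fin.eq_self_or_eq_succAbove i l with rfl | ⟨a, rfl⟩
  · rw [Fin.insertNth_apply_same, face, if_pos Fin.castSucc_lt_succ]
  · rw [Fin.insertNth_apply_succAbove, face]
    by_cases h : a.castSucc < i
    · rw [Fin.succAbove_of_castSucc_lt _ _ h, if_pos, withEnds_castSucc_succ]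
      exact (Fin.castSucc_lt_castSucc_iff.mpr h).trans Fin.castSucc_lt_succ
    · rw [not_lt] at h
      rw [Fin.succAbove_of_le_castSucc _ _ h, if_neg, ← Fin.succ_castSucc, withEnds_castSucc_succ]
      rw [← Fin.succ_castSucc, Fin.succ_lt_succ_iff, not_lt]
      exact h

lemma insertNth_withEnds_castSucc (i : Fin (m + 1)) (w : Fin m → ℝ) :
    i.insertNth (α := fun _ => ℝ) (withEnds w i.castSucc) w = face i.castSucc w := by
  funext l
  rcases Fin.eq_self_or_eq_succAbove i l with rfl | ⟨a, rfl⟩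
  · rw [Fin.insertNth_apply_same, face, if_neg (lt_irrefl _)]
  · rw [Fin.insertNth_apply_succAbove, face]
    by_cases h : a.castSucc < i
    · rw [Fin.succAbove_of_castSucc_lt _ _ h, if_pos (Fin.castSucc_lt_castSucc_iff.mpr h),
        withEnds_castSucc_succ]
    · rw [not_lt] at h
      rw [Fin.succAbove_of_le_castSucc _ _ h, if_neg, ← Fin.succ_castSucc, withEnds_castSucc_succ]
      rw [Fin.castSucc_lt_castSucc_iff, not_lt]
      exact h.trans Fin.castSucc_lt_succ.le

lemma continuous_withEnds (i : Fin (m + 2)) : Continuous fun w : Fin m → ℝ => withEnds w i := by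
  induction i using Fin.cases with
  | zero => exact continuous_const
  | succ i =>
    induction i using Fin.lastCases with
    | last =>
      simp only [Fin.succ_last, withEnds_last]
      exact continuous_const
    | cast i =>
      simp only [withEnds_castSucc_succ]
      exact continuous_apply i

lemma continuous_withZero (i : Fin (m + 1)) : Continuous fun w : Fin m → ℝ => withZero w i := by
  simp only [← withEnds_castSucc]
  exact continuous_withEnds _

lemma continuous_face (j : Fin (m + 2)) : Continuous (face (m := m) j) := by
  refine continuous_pi fun i => ?_
  unfold face
  split_ifs
  · exact continuous_withEnds _
  · exact continuous_withEnds _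

/-- The fundamental theorem of calculus in one of the coordinates of a simplex. -/
lemma setIntegral_simplex_deriv (i : Fin (m + 1)) {G g : (Fin (m + 1) → ℝ) → ℂ}
    (hG : Continuous G) (hg : Continuous g)
    (hd : ∀ t w, HasDerivAt (fun t => G (i.insertNth (α := fun _ => ℝ) t w))
      (g (i.insertNth (α := fun _ => ℝ) t w)) t) :
    ∫ u in simplex (m + 1), g u
      = (∫ w in simplex m, G (face i.succ w)) - ∫ w in simplex m, G (face i.castSucc w) := by
  have hc : Continuous fun p : ℝ × (Fin m → ℝ) => i.insertNth (α := fun _ => ℝ) p.1 p.2 := by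
    fun_prop
  have hT : MeasurePreserving fun p : ℝ × (Fin m → ℝ) => i.insertNth (α := fun _ => ℝ) p.1 p.2 :=
    (volume_preserving_piFinSuccAbove (fun _ : Fin (m + 1) => ℝ) i).symm
  have hi : Function.Injective
      fun p : ℝ × (Fin m → ℝ) => i.insertNth (α := fun _ => ℝ) p.1 p.2 :=
    (MeasurableEquiv.piFinSuccAbove (fun _ : Fin (m + 1) => ℝ) i).symm.injective
  rw [setIntegral_simplex_succ hT hc hi (a := fun w => withEnds w i.castSucc)
    (b := fun w => withEnds w i.succ)
    (fun w hw => (mem_simplex_iff w).mp hw Fin.castSucc_lt_succ.le)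
    (fun t w => by
      rw [mem_simplex_iff, mem_simplex_iff, withEnds_insertNth, monotone_insertNth_iff]) hg,
    ← integral_sub]
  · refine setIntegral_congr_fun (isCompact_simplex m).measurableSet fun w _ => ?_
    dsimp only
    rw [intervalIntegral.integral_eq_sub_of_hasDerivAt (fun t _ => hd t w),
      insertNth_withEnds_succ, insertNth_withEnds_castSucc]
    refine Continuous.intervalIntegrable ?_ _ _
    exact hg.comp (hc.comp (by fun_prop : Continuous fun t : ℝ => (t, w)))
  · exact (hG.comp (continuous_face _)).continuousOn.integrableOn_compact (isCompact_simplex m)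
  · exact (hG.comp (continuous_face _)).continuousOn.integrableOn_compact (isCompact_simplex m)

end SimplexIntegrals

/-! ## Cyclic rotations of simplices -/

section Rotation

open MeasureTheory

variable {m : ℕ}

/-- The points `t + w_j` on the circle of length one, cut open between the slots `i - 1` and `i`
and listed in their cyclic order. -/
def rotPoint (i : Fin (m + 1)) (p : ℝ × (Fin m → ℝ)) : Fin (m + 1) → ℝ := fun j =>
  p.1 + withZero p.2 (i + j) - if i ≤ i + j then 1 else 0

lemma withZero_zero (w : Fin m → ℝ) : withZero w 0 = 0 := rfl

lemma withZero_succ (w : Fin m → ℝ) (i : Fin m) : withZero w i.succ = w i := rfl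

/-- The same point indexed by its original slot `l`, which `rotPoint` lists at the position `l - i`.
-/
lemma rotPoint_sub (i l : Fin (m + 1)) (p : ℝ × (Fin m → ℝ)) :
    rotPoint i p (l - i) = p.1 + withZero p.2 l - if i ≤ l then 1 else 0 := by
  rw [rotPoint, add_sub_cancel]

lemma rotPoint_injective (i : Fin (m + 1)) : Function.Injective (rotPoint (m := m) i) := by
  rintro ⟨t, w⟩ ⟨t', w'⟩ h
  have h1 : ∀ l, t + withZero w l = t' + withZero w' l := by
    intro l
    have := congrFun h (l - i)
    rw [rotPoint_sub, rotPoint_sub] at this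
    simpa using this
  have ht : t = t' := by simpa [withZero_zero] using h1 0
  subst ht
  refine Prod.ext rfl (funext fun l => ?_)
  simpa [withZero_succ] using h1 l.succ

lemma continuous_rotPoint (i : Fin (m + 1)) : Continuous (rotPoint (m := m) i) := by
  refine continuous_pi fun j => ?_
  unfold rotPoint
  exact (continuous_fst.add ((continuous_withZero (i + j)).comp continuous_snd)).sub
    continuous_const

/-- The map is a shear adding `t` to all `w_l`, followed by the insertion of `t` as coordinate `0`,
a translation and a permutation of the coordinates. -/
lemma measurePreserving_rotPoint (i : Fin (m + 1)) : MeasurePreserving (rotPoint (m := m) i) := by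
  have h1 : MeasurePreserving (fun p : ℝ × (Fin m → ℝ) => (p.1, p.2 + fun _ => p.1))
      (volume.prod volume) (volume.prod volume) := by
    refine (MeasurePreserving.id (volume : Measure ℝ)).skew_product
      (g := fun t w => w + fun _ => t) ?_ ?_
    · fun_prop
    · exact Filter.Eventually.of_forall fun t => (measurePreserving_add_right volume _).map_eq
  have h2 := (volume_preserving_piFinSuccAbove (fun _ : Fin (m + 1) => ℝ) 0).symm
  have h3 := measurePreserving_add_right (volume : Measure (Fin (m + 1) → ℝ))
    (fun l => - if i ≤ l then (1 : ℝ) else 0)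
  have h4 := volume_measurePreserving_piCongrLeft (fun _ : Fin (m + 1) => ℝ)
    (Equiv.addLeft i).symm
  have h := h4.comp (h3.comp (h2.comp h1))
  suffices e : rotPoint (m := m) i = _ by
    rw [e]
    exact h
  funext p j
  obtain ⟨l, rfl⟩ := (Equiv.addLeft i).symm.surjective j
  have e1 : (Equiv.addLeft i).symm l = l - i := by
    rw [Equiv.addLeft_symm, Equiv.coe_addLeft]
    exact neg_add_eq_sub i l
  simp only [Function.comp_apply]
  erw [MeasurableEquiv.coe_piCongrLeft, Equiv.piCongrLeft_apply_apply]
  rw [e1, rotPoint_sub, Pi.add_apply, sub_eq_add_neg]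
  congr 1
  induction l using Fin.cases with
  | zero =>
    rw [withZero_zero, add_zero]
    rfl
  | succ l =>
    rw [withZero_succ, add_comm]
    rfl

/-- The upper end of the range of `t` for which `rotPoint i (t, w)` lies in the simplex. -/
def rotEnd (i : Fin (m + 1)) (w : Fin m → ℝ) : ℝ :=
  1 - withZero w (i - 1) + if i = 0 then 1 else 0

/-- The lengths are the arcs between cyclically neighbouring points on the circle. Their sum
telescopes, leaving the 1 from the arc that passes through the origin. -/
lemma sum_rotEnd (w : Fin m → ℝ) : ∑ i, (rotEnd i w - (1 - withZero w i)) = 1 := by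
  have h : ∑ i, withZero w (i - 1) = ∑ i, withZero w i :=
    (Equiv.subRight (1 : Fin (m + 1))).sum_comp (withZero w)
  have h2 : ∀ i, rotEnd i w - (1 - withZero w i)
      = withZero w i - withZero w (i - 1) + if i = 0 then 1 else 0 := fun i => by
    rw [rotEnd]
    ring
  simp only [h2]
  rw [Finset.sum_add_distrib, Finset.sum_sub_distrib, h, sub_self, zero_add,
    Finset.sum_ite_eq' Finset.univ (0 : Fin (m + 1)) fun _ => (1 : ℝ)]
  simp

lemma mem_simplex_iff_withZero (w : Fin m → ℝ) :
    w ∈ simplex m ↔ Monotone (withZero w) ∧ ∀ l, withZero w l ≤ 1 := by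
  rw [mem_simplex_iff]
  constructor
  · intro h
    refine ⟨fun a b hab => ?_, fun l => ?_⟩
    · rw [← withEnds_castSucc, ← withEnds_castSucc]
      exact h (Fin.castSucc_le_castSucc_iff.mpr hab)
    · rw [← withEnds_castSucc, ← withEnds_last w]
      exact h (Fin.le_last _)
  · rintro ⟨h, h1⟩ a b hab
    induction b using Fin.lastCases with
    | last =>
      rw [withEnds_last]
      induction a using Fin.lastCases with
      | last => rw [withEnds_last]
      | cast a =>
        rw [withEnds_castSucc]
        exact h1 a
    | cast b =>
      induction a using Fin.lastCases with
      | last => exact absurd hab (not_le.mpr (Fin.castSucc_lt_last b))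
      | cast a =>
        rw [withEnds_castSucc, withEnds_castSucc]
        exact h (Fin.castSucc_le_castSucc_iff.mp hab)

/-- For `w` in the simplex the rotated points are automatically in order, so only the first one
(slot `i`) and the last one (slot `i - 1`) constrain `t`. -/
lemma rotPoint_mem_simplex (i : Fin (m + 1)) (t : ℝ) (w : Fin m → ℝ) :
    rotPoint i (t, w) ∈ simplex (m + 1)
      ↔ w ∈ simplex m ∧ 1 - withZero w i ≤ t ∧ t ≤ rotEnd i w := by
  have key1 : ∀ l : Fin (m + 1), i ≤ l → ((l - i : Fin (m + 1)) : ℕ) = l - i := fun l h =>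
    Fin.coe_sub_iff_le.mpr h
  have key2 : ∀ l : Fin (m + 1), l < i → ((l - i : Fin (m + 1)) : ℕ) = m + 1 + l - i := fun l h =>
    Fin.coe_sub_iff_lt.mpr h
  have val1 : ∀ l, i ≤ l → rotPoint i (t, w) (l - i) = t + withZero w l - 1 := fun l h => by
    rw [rotPoint_sub, if_pos h]
  have val2 : ∀ l, l < i → rotPoint i (t, w) (l - i) = t + withZero w l := fun l h => by
    rw [rotPoint_sub, if_neg (not_le.mpr h), sub_zero]
  -- A nonzero `i` forces `m > 0`; otherwise `1 : Fin (m + 1)` would be zero.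
  have pred : i ≠ 0 → ((i - 1 : Fin (m + 1)) : ℕ) = i - 1 := fun h => by
    have hm : 1 < m + 1 := by
      have := i.isLt
      have := Fin.pos_iff_ne_zero.mpr h
      rw [Fin.lt_def, Fin.val_zero] at this
      omega
    have h1 : ((1 : Fin (m + 1)) : ℕ) = 1 := by
      rw [Fin.val_one', Nat.mod_eq_of_lt hm]
    rw [Fin.coe_sub_iff_le.mpr, h1]
    rw [Fin.le_def, h1]
    have := Fin.pos_iff_ne_zero.mpr h
    rw [Fin.lt_def, Fin.val_zero] at this
    omega
  rw [mem_simplex_iff_withZero w]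
  constructor
  · rintro ⟨hmono, hb⟩
    -- For `i = 0` all points are shifted alike and the bounds `0` and `1` of the simplex are used.
    -- For `i > 0` slot `l` precedes slot `0` in the list, so `t + w_l - 1 ≤ t`.
    have hle : ∀ l, i ≤ l → withZero w l ≤ 1 := by
      intro l hl
      rcases Fin.eq_zero_or_eq_succ i with h0 | ⟨i', hi'⟩
      · have a1 := (hb (0 - i)).1
        have a2 := (hb (l - i)).2
        rw [val1 0 (by rw [h0]), withZero_zero] at a1
        rw [val1 l hl] at a2
        linarith
      · have hpos : (0 : Fin (m + 1)) < i := by rw [hi']; exact Fin.succ_pos _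
        have h1 : l - i ≤ 0 - i := by
          rw [Fin.le_def, key1 l hl, key2 0 hpos]
          have := l.isLt
          omega
        have a1 := hmono h1
        rw [val1 l hl, val2 0 hpos, withZero_zero] at a1
        linarith
    refine ⟨⟨fun a b hab => ?_, fun l => ?_⟩, ?_, ?_⟩
    · rcases le_or_gt i a with ha | ha
      · have h1 : a - i ≤ b - i := by
          rw [Fin.le_def, key1 a ha, key1 b (ha.trans hab)]
          exact Nat.sub_le_sub_right hab _
        have a1 := hmono h1
        rw [val1 a ha, val1 b (ha.trans hab)] at a1
        linarith
      · rcases le_or_gt i b with hb' | hb'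
        · have a1 := (hb (a - i)).2
          have a2 := (hb (b - i)).1
          rw [val2 a ha] at a1
          rw [val1 b hb'] at a2
          linarith
        · have h1 : a - i ≤ b - i := by
            rw [Fin.le_def, key2 a ha, key2 b hb']
            rw [Fin.le_def] at hab
            omega
          have a1 := hmono h1
          rw [val2 a ha, val2 b hb'] at a1
          linarith
    · rcases le_or_gt i l with hl | hl
      · exact hle l hl
      · have a1 := (hb (l - i)).2
        have hpos : (0 : Fin (m + 1)) < i := lt_of_le_of_lt (Fin.zero_le _) hl
        have a2 := (hb (0 - i)).1
        rw [val2 l hl] at a1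
        rw [val2 0 hpos, withZero_zero] at a2
        linarith
    · have a1 := (hb (i - i)).1
      rw [val1 i le_rfl] at a1
      linarith
    · have a1 := (hb (i - 1 - i)).2
      rw [rotEnd]
      by_cases h0 : i = 0
      · rw [if_pos h0]
        rw [val1 _ (by rw [h0]; exact Fin.zero_le _)] at a1
        linarith
      · rw [if_neg h0]
        have hlt : i - 1 < i := by
          rw [Fin.lt_def, pred h0]
          have := Fin.pos_iff_ne_zero.mpr h0
          rw [Fin.lt_def, Fin.val_zero] at this
          omega
        rw [val2 _ hlt] at a1
        linarith
  · rintro ⟨⟨hmono, hb⟩, h1, h2⟩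
    have hnn : ∀ l, 0 ≤ withZero w l := fun l => by
      rw [← withZero_zero w]
      exact hmono (Fin.zero_le _)
    have sub : ∀ a : Fin (m + 1), ∃ l, a = l - i := fun a => ⟨a + i, (add_sub_cancel_right a i).symm⟩
    refine ⟨fun a b hab => ?_, fun a => ?_⟩
    · obtain ⟨a, rfl⟩ := sub a
      obtain ⟨b, rfl⟩ := sub b
      rw [Fin.le_def] at hab
      rcases le_or_gt i a with ha | ha <;> rcases le_or_gt i b with hb' | hb'
      · rw [key1 a ha, key1 b hb'] at hab
        rw [val1 a ha, val1 b hb']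
        have : a ≤ b := by
          rw [Fin.le_def] at *
          omega
        linarith [hmono this]
      · rw [val1 a ha, val2 b hb']
        linarith [hb a, hnn b]
      · rw [key2 a ha, key1 b hb'] at hab
        have := b.isLt
        have := i.isLt
        omega
      · rw [key2 a ha, key2 b hb'] at hab
        rw [val2 a ha, val2 b hb']
        have : a ≤ b := by
          rw [Fin.le_def]
          omega
        linarith [hmono this]
    · obtain ⟨l, rfl⟩ := sub a
      rw [rotEnd] at h2
      by_cases h0 : i = 0
      · rw [if_pos h0] at h2
        have hl : i ≤ l := by rw [h0]; exact Fin.zero_le _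
        have hlast : l ≤ i - 1 := by
          rw [h0, zero_sub]
          rw [← eq_neg_of_add_eq_zero_left (Fin.last_add_one m)]
          exact Fin.le_last _
        rw [val1 l hl]
        have := hmono hlast
        have h3 := hmono hl
        constructor <;> linarith
      · rw [if_neg h0] at h2
        rcases le_or_gt i l with hl | hl
        · rw [val1 l hl]
          have h3 := hmono hl
          have h4 := hb l
          have h5 := hnn (i - 1)
          constructor <;> linarith
        · rw [val2 l hl]
          have h3 : l ≤ i - 1 := by
            rw [Fin.le_def, pred h0]
            rw [Fin.lt_def] at hl
            omega
          have h4 := hmono h3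
          have h5 := hnn l
          have h6 := hb i
          constructor <;> linarith

/-- The sum over the cyclic rotations of the integrals of a rotation invariant function. -/
lemma sum_setIntegral_rotPoint {G : Fin (m + 1) → (Fin (m + 1) → ℝ) → ℂ}
    {H : (Fin m → ℝ) → ℂ} (hG : ∀ i, Continuous (G i)) (hH : Continuous H)
    (h : ∀ i t w, G i (rotPoint i (t, w)) = H w) :
    ∑ i, ∫ u in simplex (m + 1), G i u = ∫ w in simplex m, H w := by
  -- The integrand does not depend on `t`, so the inner integral is just the length of the range of
  -- `t`.
  have h1 : ∀ i, ∫ u in simplex (m + 1), G i u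
      = ∫ w in simplex m, ((rotEnd i w - (1 - withZero w i) : ℝ) : ℂ) * H w := by
    intro i
    rw [setIntegral_simplex_succ (measurePreserving_rotPoint i) (continuous_rotPoint i)
      (rotPoint_injective i) (a := fun w => 1 - withZero w i) (b := rotEnd i) ?_
      (rotPoint_mem_simplex i) (hG i)]
    · simp only [h, intervalIntegral.integral_const, Complex.real_smul]
    · intro w hw
      rw [mem_simplex_iff_withZero] at hw
      rw [rotEnd]
      split_ifs with h0
      · linarith [hw.2 (i - 1), hw.2 i, withZero_zero w ▸ hw.1 (Fin.zero_le i)]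
      · have h2 : i - 1 ≤ i := by
          obtain ⟨j, rfl⟩ := Fin.exists_succ_eq.mpr h0
          rw [← Fin.coeSucc_eq_succ, add_sub_cancel_right, Fin.coeSucc_eq_succ]
          exact Fin.castSucc_lt_succ.le
        linarith [hw.1 h2]
  have hcont : ∀ i, Continuous fun w : Fin m → ℝ =>
      ((rotEnd i w - (1 - withZero w i) : ℝ) : ℂ) * H w := by
    intro i
    have h2 := continuous_withZero (m := m) i
    have h3 := continuous_withZero (m := m) (i - 1)
    unfold rotEnd
    fun_prop
  rw [Finset.sum_congr rfl fun i _ => h1 i, ← integral_finsetSum _ fun i _ =>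
    (hcont i).continuousOn.integrableOn_compact (isCompact_simplex m)]
  refine integral_congr_ae (Filter.Eventually.of_forall fun w => ?_)
  dsimp only
  rw [← Finset.sum_mul, ← Complex.ofReal_sum, sum_rotEnd, Complex.ofReal_one, one_mul]

end Rotation

/-! ## The integrands of the cochains -/

section Kernel

variable {m n : ℕ}

/-- Both `c` and `α` are antisymmetric, so `(i, j)` and `(j, i)` contribute equally, each with
weight 1/2, and the diagonal vanishes. -/
lemma quadSymb_antisymm (c : Fin m → Fin m → ℝ) (hc : ∀ i j, c j i = -c i j) :
    quadSymb (n := n) c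
      = ∑ p ∈ Finset.univ.filter (fun p : Fin m × Fin m => p.1 < p.2),
        hscal (c p.1 p.2) • poissonSymb p.1 p.2 := by
  set g : Fin m × Fin m → Symb (Fin m) n := fun p => hscal (c p.1 p.2 / 2) • poissonSymb p.1 p.2
    with hg
  have hswap : ∀ p, g p.swap = g p := by
    rintro ⟨i, j⟩
    simp only [hg, Prod.swap, hc i j, neg_div, hscal_neg, poissonSymb_swap i j, smul_neg, neg_smul,
      neg_neg]
  have h0 : quadSymb (n := n) c = ∑ p, g p := by
    rw [quadSymb, Fintype.sum_prod_type]
  have hdiag : ∀ p : Fin m × Fin m, ¬ p.1 < p.2 → ¬ p.2 < p.1 → g p = 0 := by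
    rintro ⟨i, j⟩ h1 h2
    obtain rfl : i = j := le_antisymm (not_lt.mp h2) (not_lt.mp h1)
    have : c i i = 0 := by linarith [hc i i]
    simp only [hg, this, zero_div, hscal_zero, zero_smul]
  rw [h0, ← Finset.sum_filter_add_sum_filter_not Finset.univ
    (fun p : Fin m × Fin m => p.1 < p.2)]
  have h1 : ∑ p ∈ Finset.univ.filter (fun p : Fin m × Fin m => ¬ p.1 < p.2), g p
      = ∑ p ∈ Finset.univ.filter (fun p : Fin m × Fin m => p.1 < p.2), g p := by
    rw [← Finset.sum_filter_add_sum_filter_not (Finset.univ.filter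
      (fun p : Fin m × Fin m => ¬ p.1 < p.2)) (fun p => p.2 < p.1), Finset.filter_filter,
      Finset.filter_filter]
    have h2 : ∑ p ∈ Finset.univ.filter (fun p : Fin m × Fin m => ¬ p.1 < p.2 ∧ ¬ p.2 < p.1), g p
        = 0 := Finset.sum_eq_zero fun p hp =>
      hdiag p (Finset.mem_filter.mp hp).2.1 (Finset.mem_filter.mp hp).2.2
    rw [h2, add_zero]
    refine Finset.sum_bij' (fun p _ => p.swap) (fun p _ => p.swap) ?_ ?_ ?_ ?_ ?_
    · intro p hp
      simpa using (Finset.mem_filter.mp hp).2.2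
    · intro p hp
      have := (Finset.mem_filter.mp hp).2
      simpa using ⟨this.le, this⟩
    · intro p _
      exact Prod.swap_swap p
    · intro p _
      exact Prod.swap_swap p
    · intro p _
      exact (hswap p).symm
  rw [h1, ← Finset.sum_add_distrib]
  refine Finset.sum_congr rfl fun p _ => ?_
  simp only [hg]
  rw [← add_smul, ← hscal_add, add_halves]

/-- The values of the sawtooth function at the differences of the points `v i`. -/
def saw (v : Fin m → ℝ) (i j : Fin m) : ℝ :=
  v i - v j + if i < j then 1 / 2 else if j < i then -(1 / 2) else 0

lemma saw_swap (v : Fin m → ℝ) (i j : Fin m) : saw v j i = -saw v i j := by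
  unfold saw
  rcases lt_trichotomy i j with h | h | h
  · rw [if_neg (not_lt.mpr h.le), if_pos h, if_pos h]
    ring
  · subst h
    simp
  · rw [if_pos h, if_neg (not_lt.mpr h.le), if_pos h]
    ring

lemma expProduct_eq_expOp (u : Fin m → ℝ) :
    expProduct (n := n) u = expOp (quadSymb (saw (withZero u))) := by
  rw [quadSymb_antisymm _ (saw_swap _)]
  have hnd : ((List.finRange (m + 1) ×ˢ List.finRange (m + 1)).filter fun ij => ij.1 < ij.2).Nodup :=
    ((List.nodup_finRange _).product (List.nodup_finRange _)).filter _
  have hset : Finset.univ.filter (fun p : Fin (m + 1) × Fin (m + 1) => p.1 < p.2)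
      = ((List.finRange (m + 1) ×ˢ List.finRange (m + 1)).filter
        fun ij => ij.1 < ij.2).toFinset := by
    ext p
    have h : p ∈ List.finRange (m + 1) ×ˢ List.finRange (m + 1) :=
      List.pair_mem_product.mpr ⟨List.mem_finRange _, List.mem_finRange _⟩
    simp [h]
  rw [hset, List.sum_toFinset _ hnd, expOp_list_sum, expProduct]
  · congr 1
    refine List.map_congr_left fun p hp => ?_
    rw [List.mem_filter, decide_eq_true_iff] at hp
    rw [expOp, map_smul, diffOp_poissonSymb, hscal, saw, if_pos hp.2]
  · intro p
    rw [MvPolynomial.smul_eq_C_mul, map_mul, constantCoeff_poissonSymb, mul_zero]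

/-- The integrand `μ ∏ exp (ħ (u_i - u_j + 1/2) α_{ij}) P x` for an operator with symbol `P`. -/
def kern (P : Symb (Fin (m + 1)) n) (x : Slots (Fin (m + 1)) n) (u : Fin m → ℝ) : Coeff :=
  evalZero (expOp (quadSymb (saw (withZero u))) (diffOp P x))

lemma tauIntegral_diffOp (P : Symb (Fin (m + 1)) n) (a : Fin (m + 1) → Weyl n) :
    tauIntegral (diffOp P) a
      = simplexIntegral (kern P (pureTensor fun i => (a i).toPoly)) := by
  simp only [tauIntegral, expProduct_eq_expOp]
  rfl

lemma tame_expOp_quadSymb {X ι : Type} [TopologicalSpace X] [Fintype ι] {c : X → ι → ι → ℝ}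
    (hc : ∀ i j, Continuous fun u => c u i j) (x : Slots ι n) :
    Tame fun u => expOp (quadSymb (c u)) x := by
  classical
  have h : ∀ s : Finset (ι × ι), Tame fun u => expOp (∑ p ∈ s,
      hscal (c u p.1 p.2 / 2) • poissonSymb p.1 p.2) x := by
    intro s
    induction s using Finset.induction_on with
    | empty =>
      simp only [Finset.sum_empty, expOp_zero]
      exact tame_const _
    | insert p s hp ih =>
      have h2 : ∀ u, expOp (∑ p ∈ insert p s,
          hscal (c u p.1 p.2 / 2) • poissonSymb (n := n) p.1 p.2) x
          = expEnd (hscal (c u p.1 p.2 / 2) • poisson p.1 p.2)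
            (expOp (∑ p ∈ s, hscal (c u p.1 p.2 / 2) • poissonSymb p.1 p.2) x) := by
        intro u
        rw [Finset.sum_insert hp, expOp_add, Module.End.mul_apply]
        · congr 1
          rw [expOp, map_smul, diffOp_poissonSymb]
        · simp [MvPolynomial.smul_eq_C_mul, constantCoeff_poissonSymb]
        · simp [MvPolynomial.smul_eq_C_mul, constantCoeff_poissonSymb]
      simp only [h2]
      exact Tame.expEnd (poisson_locNil _ _) ((hc p.1 p.2).div_const 2) ih
  have h3 := h Finset.univ
  simp only [Fintype.sum_prod_type] at h3
  exact h3

lemma tame_kern (P : Symb (Fin (m + 1)) n) (x : Slots (Fin (m + 1)) n) : Tame (kern P x) := by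
  refine Tame.map evalZero.toLinearMap (tame_expOp_quadSymb (fun i j => ?_) (diffOp P x))
  unfold saw
  exact ((continuous_withZero i).sub (continuous_withZero j)).add continuous_const

lemma kern_add_symb (P Q : Symb (Fin (m + 1)) n) (x : Slots (Fin (m + 1)) n) :
    kern (P + Q) x = kern P x + kern Q x := by
  funext u
  simp only [kern, map_add, LinearMap.add_apply, Pi.add_apply]

lemma kern_zero_symb (x : Slots (Fin (m + 1)) n) : kern 0 x = 0 := by
  funext u
  simp only [kern, map_zero, LinearMap.zero_apply, Pi.zero_apply]

lemma kern_smul_symb (c : Coeff) (P : Symb (Fin (m + 1)) n) (x : Slots (Fin (m + 1)) n) :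
    kern (c • P) x = c • kern P x := by
  funext u
  simp only [kern, map_smul, LinearMap.smul_apply, Pi.smul_apply]

lemma kern_sum_symb {α : Type*} (s : Finset α) (P : α → Symb (Fin (m + 1)) n)
    (x : Slots (Fin (m + 1)) n) : kern (∑ i ∈ s, P i) x = ∑ i ∈ s, kern (P i) x := by
  funext u
  simp only [kern, map_sum, LinearMap.sum_apply, Finset.sum_apply]

/-- The functional `x ↦ μ ∫ ∏ exp (ħ (u_i - u_j + 1/2) α_{ij}) P x`. -/
def kernIntegral (P : Symb (Fin (m + 1)) n) : Slots (Fin (m + 1)) n →ₗ[Coeff] Coeff where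
  toFun x := simplexIntegral (kern P x)
  map_add' x y := by
    rw [← simplexIntegral_add (tame_kern P x) (tame_kern P y)]
    congr 1
    funext u
    simp only [kern, map_add, Pi.add_apply]
  map_smul' c x := by
    rw [RingHom.id_apply, ← simplexIntegral_smul c (tame_kern P x)]
    congr 1
    funext u
    simp only [kern, map_smul, Pi.smul_apply]

/-! ### Multilinearity and normalization of the cochains. -/

/-- The tensor product of elements of the Weyl algebra, as a multilinear map. -/
def tensorMap (m n : ℕ) :
    MultilinearMap Coeff (fun _ : Fin (m + 1) => Weyl n) (Slots (Fin (m + 1)) n) :=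
  (MultilinearMap.mkPiAlgebra Coeff (Fin (m + 1)) (Slots (Fin (m + 1)) n)).compLinearMap fun i =>
    (MvPolynomial.rename (Prod.mk i)).toLinearMap ∘ₗ Weyl.toPoly.toLinearMap

lemma tensorMap_apply (a : Fin (m + 1) → Weyl n) :
    tensorMap m n a = pureTensor fun i => (a i).toPoly := by
  simp only [tensorMap, MultilinearMap.compLinearMap_apply, MultilinearMap.mkPiAlgebra_apply]
  rfl

/-- The ideal of symbols of operators that annihilate a tensor. -/
def annIdeal {ι : Type} (x : Slots ι n) : Ideal (Symb ι n) where
  carrier := {P | diffOp P x = 0}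
  add_mem' := fun {P Q} hP hQ => by
    change diffOp (P + Q) x = 0
    rw [map_add, LinearMap.add_apply, hP, hQ, add_zero]
  zero_mem' := by
    change diffOp 0 x = 0
    rw [map_zero, LinearMap.zero_apply]
  smul_mem' := fun P Q hQ => by
    change diffOp (P * Q) x = 0
    rw [diffOp_mul_apply, hQ, map_zero]

lemma X_mem_annIdeal {ι : Type} [Fintype ι] [DecidableEq ι] {a : ι → Poly n} {i : ι} {c : Coeff}
    (h : a i = MvPolynomial.C c) (v : Var n) :
    MvPolynomial.X (i, v) ∈ annIdeal (pureTensor a) := by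
  change diffOp (MvPolynomial.X (i, v)) (pureTensor a) = 0
  rw [diffOp_X, slotDeriv_pureTensor, h, MvPolynomial.pderiv_C, pureTensor]
  refine Finset.prod_eq_zero (Finset.mem_univ i) ?_
  rw [Function.update_self, map_zero]

lemma toPoly_algebraMap (c : Coeff) :
    (algebraMap Coeff (Weyl n) c).toPoly = MvPolynomial.C c := by
  rw [Algebra.algebraMap_eq_smul_one, map_smul]
  change c • (1 : Poly n) = _
  rw [MvPolynomial.smul_eq_C_mul, mul_one]

/-- By `he` every slot except possibly `0` provides a row of the Pfaffian. If the factor in that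
slot is a scalar, the derivatives in this row annihilate the tensor, and with them the whole
Pfaffian. -/
lemma tauIntegral_pfaff_mem {r : ℕ} (e : Fin (2 * r) → Fin (m + 1))
    (he : ∀ j : Fin m, ∃ i, e i = j.succ) :
    tauIntegral (diffOp (pfaff fun i v => (MvPolynomial.X (e i, v) : Symb (Fin (m + 1)) n)))
      ∈ NormalizedCochain Coeff (Weyl n) m := by
  refine ⟨⟨(kernIntegral (pfaff fun i v =>
    (MvPolynomial.X (e i, v) : Symb (Fin (m + 1)) n))).compMultilinearMap (tensorMap m n), fun a => ?_⟩, fun a j c h => ?_⟩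
  · rw [tauIntegral_diffOp, LinearMap.compMultilinearMap_apply, tensorMap_apply]
    rfl
  · obtain ⟨i, hi⟩ := he j
    have h1 : pfaff (fun i v => (MvPolynomial.X (e i, v) : Symb (Fin (m + 1)) n))
        ∈ annIdeal (pureTensor fun i => (a i).toPoly) := by
      refine pfaff_mem _ _ i fun v => ?_
      rw [hi]
      exact X_mem_annIdeal (c := c) (by rw [h, toPoly_algebraMap]) v
    have h2 : diffOp _ (pureTensor fun i => (a i).toPoly) = 0 := h1
    rw [tauIntegral_diffOp]
    have h3 : kern (pfaff fun i v => (MvPolynomial.X (e i, v) : Symb (Fin (m + 1)) n))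
        (pureTensor fun i => (a i).toPoly) = 0 := by
      funext u
      rw [kern, h2, map_zero, map_zero, Pi.zero_apply]
    rw [h3, simplexIntegral_zero]

/-! ## Derivatives of the integrands -/

/-- The symbol of `ħ ∑_l α_{kl}`. -/
def sumSymb (k : Fin (m + 1)) : Symb (Fin (m + 1)) n := hbar • ∑ l, poissonSymb k l

/-- The matrix is supported in row `k` and column `k`; by antisymmetry of `α` each of the two gives
half of the right hand side. -/
lemma quadSymb_sub_single (k : Fin (m + 1)) (t : ℝ) :
    quadSymb (n := n) (fun i j : Fin (m + 1) => (if i = k then t else 0) - if j = k then t else 0)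
      = hscal t • ∑ l, poissonSymb k l := by
  have h : (fun i j : Fin (m + 1) => (if i = k then t else 0) - if j = k then t else 0)
      = (fun i _ => if i = k then t else 0) + fun _ j => -if j = k then t else 0 := by
    funext i j
    simp [sub_eq_add_neg]
  have h1 : quadSymb (n := n) (fun (i _ : Fin (m + 1)) => if i = k then t else 0)
      = hscal (t / 2) • ∑ l, poissonSymb k l := by
    rw [quadSymb, Finset.sum_eq_single k, Finset.smul_sum]
    · simp
    · intro i _ hi
      simp [hi, hscal_zero]
    · simp
  have h2 : quadSymb (n := n) (fun (_ j : Fin (m + 1)) => -if j = k then t else 0)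
      = hscal (t / 2) • ∑ l, poissonSymb k l := by
    rw [quadSymb, Finset.sum_comm, Finset.sum_eq_single k, Finset.smul_sum]
    · refine Finset.sum_congr rfl fun l _ => ?_
      rw [if_pos rfl, poissonSymb_swap k l, neg_div, hscal_neg, smul_neg, neg_smul, neg_neg]
    · intro i _ hi
      simp [hi, hscal_zero]
    · simp
  rw [h, quadSymb_add, h1, h2, ← add_smul, ← hscal_add, add_halves]

lemma saw_add_single (v : Fin (m + 1) → ℝ) (k : Fin (m + 1)) (t : ℝ) :
    saw (fun i => v i + if i = k then t else 0)
      = (fun i j => (if i = k then t else 0) - if j = k then t else 0) + saw v := by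
  funext i j
  simp only [saw, Pi.add_apply]
  ring

lemma withZero_insertNth (i : Fin (m + 1)) (t : ℝ) (w : Fin m → ℝ) :
    withZero (i.insertNth (α := fun _ => ℝ) t w)
      = fun l => withZero (i.insertNth (α := fun _ => ℝ) 0 w) l + if l = i.succ then t else 0 := by
  funext l
  induction l using Fin.cases with
  | zero => simp [withZero_zero, (Fin.succ_ne_zero i).symm]
  | succ l =>
    rw [withZero_succ, withZero_succ]
    rcases Fin.eq_self_or_eq_succAbove i l with rfl | ⟨a, rfl⟩
    · simp
    · rw [Fin.insertNth_apply_succAbove, Fin.insertNth_apply_succAbove, if_neg, add_zero]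
      rw [Fin.succ_inj]
      exact Fin.succAbove_ne i a

/-- The jumps in `saw` depend on the order of the indices and not on the points, so the exponent is
affine in each coordinate. Moving `u_{i+1}` by `t` multiplies the exponential by that of `t ħ ∑_l
α_{i+1,l}`. -/
lemma hasDerivAt_kern (P : Symb (Fin (m + 1 + 1)) n) (x : Slots (Fin (m + 1 + 1)) n)
    (i : Fin (m + 1)) (d : ℤ) (t : ℝ) (w : Fin m → ℝ) :
    HasDerivAt (fun t => (kern P x (i.insertNth (α := fun _ => ℝ) t w)).coeff d)
      ((kern (sumSymb i.succ * P) x (i.insertNth (α := fun _ => ℝ) t w)).coeff d) t := by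
  set S : Symb (Fin (m + 1 + 1)) n := ∑ l, poissonSymb i.succ l with hS
  have hS0 : MvPolynomial.constantCoeff S = 0 := by simp [hS, constantCoeff_poissonSymb]
  set q₀ : Symb (Fin (m + 1 + 1)) n :=
    quadSymb (saw (withZero (i.insertNth (α := fun _ => ℝ) 0 w))) with hq
  have h : ∀ (t : ℝ) (y : Slots (Fin (m + 1 + 1)) n),
      expOp (quadSymb (saw (withZero (i.insertNth (α := fun _ => ℝ) t w)))) y
        = expEnd (hscal t • diffOp S) (expOp q₀ y) := by
    intro t y
    rw [withZero_insertNth, saw_add_single, quadSymb_add, quadSymb_sub_single, expOp_add,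
      Module.End.mul_apply, expOp, map_smul]
    · rw [MvPolynomial.smul_eq_C_mul, map_mul, ← hS, hS0, mul_zero]
    · exact constantCoeff_quadSymb _
  have h1 := hasDerivAt_coeff_expEnd (diffOp_locNil hS0) (evalZero (ι := Fin (m + 1 + 1))).toLinearMap
    (expOp q₀ (diffOp P x)) d t
  have h2 : kern (sumSymb i.succ * P) x (i.insertNth (α := fun _ => ℝ) t w)
      = evalZero (expEnd (hscal t • diffOp S) (hbar • diffOp S (expOp q₀ (diffOp P x)))) := by
    rw [kern, h, sumSymb, ← hS, smul_mul_assoc, map_smul, LinearMap.smul_apply, map_smul,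
      diffOp_mul_apply, expOp_diffOp (constantCoeff_quadSymb _)]
  rw [h2]
  simp only [kern, h]
  exact h1

lemma simplexIntegral_face (P : Symb (Fin (m + 1 + 1)) n) (x : Slots (Fin (m + 1 + 1)) n)
    (i : Fin (m + 1)) :
    simplexIntegral (kern (sumSymb i.succ * P) x)
      = simplexIntegral (fun w => kern P x (face i.succ w))
        - simplexIntegral (fun w => kern P x (face i.castSucc w)) := by
  have h1 := tame_kern P x
  refine LaurentPolynomial.ext fun d => ?_
  rw [AddMonoidAlgebra.coeff_sub, Finsupp.sub_apply, simplexIntegral_coeff (tame_kern _ x),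
    simplexIntegral_coeff (h1.comp (continuous_face _)),
    simplexIntegral_coeff (h1.comp (continuous_face _))]
  exact setIntegral_simplex_deriv i (h1.continuous_coeff d) ((tame_kern _ x).continuous_coeff d)
    fun t w => hasDerivAt_kern P x i d t w

end Kernel

/-! ## The operator `B` on the cochains -/

section ConnesOperator

variable {m n : ℕ}

lemma piEven_eq_diffOp (n k : ℕ) :
    piEven n k = diffOp (pfaff fun i v => MvPolynomial.X (i.succ, v)) :=
  wedgePower_eq_diffOp _ _

lemma piOdd_eq_diffOp (n k : ℕ) :
    piOdd n k = diffOp (pfaff (r := k + 1) fun i v => MvPolynomial.X (i, v)) :=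
  wedgePower_eq_diffOp (m := 2 * k + 1) (k + 1) id

/-- Pure tensors with some factors equal to one. -/
lemma pureTensor_eq_merge {ι κ : Type} [Fintype ι] [Fintype κ] {f : ι → κ}
    (hf : Function.Injective f) (a : ι → Poly n) (b : κ → Poly n) (hb : ∀ i, b (f i) = a i)
    (h1 : ∀ k, (∀ i, f i ≠ k) → b k = 1) : pureTensor b = merge f (pureTensor a) := by
  classical
  rw [pureTensor, pureTensor, map_prod]
  simp only [merge_slot, ← hb]
  rw [← Finset.prod_image (f := fun k => MvPolynomial.rename (Prod.mk k) (b k))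
    (g := f) (s := Finset.univ) fun i _ j _ h => hf h]
  refine (Finset.prod_subset (Finset.subset_univ _) fun k _ hk => ?_).symm
  rw [h1 k fun i hi => hk (Finset.mem_image.mpr ⟨i, Finset.mem_univ _, hi⟩), map_one]

lemma kern_merge {ι : Type} [Fintype ι] (f : ι → Fin (m + 1)) (P : Symb (Fin (m + 1)) n)
    (x : Slots ι n) (u : Fin m → ℝ) :
    kern P (merge f x) u = evalZero (expOp (quadSymb fun i j => saw (withZero u) (f i) (f j))
      (diffOp (pull f P) x)) := by
  rw [kern, diffOp_merge, expOp_merge f (constantCoeff_quadSymb _), evalZero_merge, pull_quadSymb]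

open Fin.NatCast in
lemma addLeft_eq_finRotate_pow (i : Fin (m + 1)) :
    Equiv.addLeft i = finRotate (m + 1) ^ (i : ℕ) := by
  have h : ∀ (k : ℕ) (l : Fin (m + 1)), (finRotate (m + 1) ^ k) l = (k : Fin (m + 1)) + l := by
    intro k
    induction k with
    | zero => simp
    | succ k ih =>
      intro l
      rw [pow_succ', Equiv.Perm.mul_apply, ih, finRotate_apply, Nat.cast_succ]
      abel
  refine Equiv.ext fun l => ?_
  rw [h, Equiv.coe_addLeft, Fin.cast_val_eq_self]

lemma sign_addLeft (i : Fin (m + 1)) :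
    Equiv.Perm.sign (Equiv.addLeft i) = (-1) ^ ((i : ℕ) * m) := by
  rw [addLeft_eq_finRotate_pow, map_pow, sign_finRotate, Nat.add_sub_cancel, ← pow_mul, mul_comm]

/-- Periodicity of the sawtooth: if the rotation reverses the order of two slots, the jump changes
by one, and so does the difference of the points, in the opposite direction. -/
lemma saw_rotPoint (i : Fin (m + 1)) (t : ℝ) (w : Fin m → ℝ) (l l' : Fin (m + 1)) :
    saw (withZero (rotPoint i (t, w))) (l - i).succ (l' - i).succ = saw (withZero w) l l' := by
  have key1 : ∀ l : Fin (m + 1), i ≤ l → ((l - i : Fin (m + 1)) : ℕ) = l - i := fun l h =>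
    Fin.coe_sub_iff_le.mpr h
  have key2 : ∀ l : Fin (m + 1), l < i → ((l - i : Fin (m + 1)) : ℕ) = m + 1 + l - i := fun l h =>
    Fin.coe_sub_iff_lt.mpr h
  have hl := l.isLt
  have hl' := l'.isLt
  have hi := i.isLt
  rw [saw, saw, withZero_succ, withZero_succ, rotPoint_sub, rotPoint_sub]
  simp only [Fin.succ_lt_succ_iff]
  rcases le_or_gt i l with h | h <;> rcases le_or_gt i l' with h' | h'
  · rw [if_pos h, if_pos h']
    have e1 : l - i < l' - i ↔ l < l' := by
      rw [Fin.lt_def, key1 l h, key1 l' h']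
      rw [Fin.le_def] at h h'
      rw [Fin.lt_def]
      omega
    have e2 : l' - i < l - i ↔ l' < l := by
      rw [Fin.lt_def, key1 l h, key1 l' h']
      rw [Fin.le_def] at h h'
      rw [Fin.lt_def]
      omega
    simp only [e1, e2]
    ring
  · have e1 : l - i < l' - i := by
      rw [Fin.lt_def, key1 l h, key2 l' h']
      omega
    have e2 : l' < l := lt_of_lt_of_le h' h
    rw [if_pos h, if_neg (not_le.mpr h'), if_pos e1, if_neg (not_lt.mpr e2.le), if_pos e2]
    ring
  · have e1 : l' - i < l - i := by
      rw [Fin.lt_def, key2 l h, key1 l' h']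
      omega
    have e2 : l < l' := lt_of_lt_of_le h h'
    rw [if_neg (not_le.mpr h), if_pos h', if_neg (not_lt.mpr e1.le), if_pos e1, if_pos e2]
    ring
  · rw [if_neg (not_le.mpr h), if_neg (not_le.mpr h')]
    have e1 : l - i < l' - i ↔ l < l' := by
      rw [Fin.lt_def, key2 l h, key2 l' h', Fin.lt_def]
      omega
    have e2 : l' - i < l - i ↔ l' < l := by
      rw [Fin.lt_def, key2 l h, key2 l' h', Fin.lt_def]
      omega
    simp only [e1, e2]
    ring

lemma tame_rot (i : Fin (m + 1)) (P : Symb (Fin (m + 1)) n) (x : Slots (Fin (m + 1)) n) :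
    Tame fun u : Fin (m + 1) → ℝ =>
      evalZero (expOp (quadSymb fun l l' => saw (withZero u) (l - i).succ (l' - i).succ)
        (diffOp P x)) := by
  refine Tame.map evalZero.toLinearMap (tame_expOp_quadSymb (fun j k => ?_) (diffOp P x))
  unfold saw
  exact ((continuous_withZero _).sub (continuous_withZero _)).add continuous_const

lemma sum_simplexIntegral_rot (P : Symb (Fin (m + 1)) n) (x : Slots (Fin (m + 1)) n) :
    ∑ i : Fin (m + 1), simplexIntegral (fun u : Fin (m + 1) → ℝ =>
      evalZero (expOp (quadSymb fun l l' => saw (withZero u) (l - i).succ (l' - i).succ)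
        (diffOp P x))) = simplexIntegral (kern P x) := by
  refine LaurentPolynomial.ext fun d => ?_
  rw [AddMonoidAlgebra.coeff_sum, Finsupp.finsetSum_apply, simplexIntegral_coeff (tame_kern P x)]
  rw [Finset.sum_congr rfl fun i _ => simplexIntegral_coeff (tame_rot i P x) d]
  refine sum_setIntegral_rotPoint (fun i => (tame_rot i P x).continuous_coeff d)
    ((tame_kern P x).continuous_coeff d) fun i t w => ?_
  simp only [saw_rotPoint]
  rfl

lemma pull_X_of_injective {ι κ : Type} [Fintype ι] [DecidableEq κ] {f : ι → κ}
    (hf : Function.Injective f) (i : ι) (v : Var n) :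
    pull f (MvPolynomial.X (f i, v)) = MvPolynomial.X (i, v) := by
  classical
  rw [pull_X, Finset.sum_eq_single i, if_pos rfl]
  · intro j _ hj
    exact if_neg fun h => hj (hf h)
  · simp

/-- The tensor with unit in slot `0` is the image of the unrotated one under `l ↦ (l - i).succ`.
Pulling back along this map returns all operators to the original slots; it permutes the rows of the
Pfaffian cyclically and so produces the sign. -/
lemma tauEven_rotate (n k : ℕ) (a : Fin (2 * k + 1 + 1) → Weyl n) (i : Fin (2 * k + 1 + 1)) :
    tauEven n (k + 1) (Fin.cons (α := fun _ => Weyl n) 1 fun j : Fin (2 * k + 1 + 1) => a (i + j))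
      = (-1) ^ (k + 1) * ((-1) ^ ((i : ℕ) * (2 * k + 1)) *
        simplexIntegral (fun u : Fin (2 * k + 1 + 1) → ℝ =>
          evalZero (expOp (quadSymb fun l l' => saw (withZero u) (l - i).succ (l' - i).succ)
            (diffOp (pfaff (r := k + 1) fun i v => MvPolynomial.X (i, v))
              (pureTensor fun i => (a i).toPoly))))) := by
  set f : Fin (2 * k + 1 + 1) → Fin (2 * k + 1 + 1 + 1) := fun l => (l - i).succ with hf
  have hinj : Function.Injective f := fun l l' h => sub_left_injective (Fin.succ_injective _ h)
  have hpure : (pureTensor fun j : Fin (2 * k + 1 + 1 + 1) =>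
      (Fin.cons (α := fun _ => Weyl n) 1 (fun j : Fin (2 * k + 1 + 1) => a (i + j)) j).toPoly)
      = merge f (pureTensor fun i => (a i).toPoly) := by
    refine pureTensor_eq_merge hinj _ _ (fun l => ?_) fun j hj => ?_
    · rw [hf, Fin.cons_succ, add_sub_cancel]
    · induction j using Fin.cases with
      | zero => rfl
      | succ j => exact absurd (by rw [hf]; simp) (hj (j + i))
  have hpull : pull f (pfaff (r := k + 1) fun i v =>
        (MvPolynomial.X (i.succ, v) : Symb (Fin (2 * k + 1 + 1 + 1)) n))
      = ((-1) ^ ((i : ℕ) * (2 * k + 1)) : Coeff) •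
        pfaff (r := k + 1) fun i v => (MvPolynomial.X (i, v) : Symb (Fin (2 * k + 1 + 1)) n) := by
    rw [pfaff_map]
    have h := pfaff_comp_perm (r := k + 1)
      (fun i v => (MvPolynomial.X (i, v) : Symb (Fin (2 * k + 1 + 1)) n))
      (Equiv.addLeft i : Equiv.Perm (Fin (2 * k + 1 + 1)))
    rw [show Equiv.Perm.sign (α := Fin (2 * (k + 1)))
        (Equiv.addLeft i : Equiv.Perm (Fin (2 * k + 1 + 1)))
        = (-1) ^ ((i : ℕ) * (2 * k + 1)) from sign_addLeft i] at h
    rw [Algebra.smul_def, map_pow, map_neg, map_one]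
    push_cast at h
    rw [← h]
    congr 1
    funext j v
    rw [← pull_X_of_injective hinj]
    congr 2
    rw [hf]
    simp
  have hint : ∀ a, tauEven n (k + 1) a = (-1 : Coeff) ^ (k + 1) * tauIntegral (m := 2 * k + 1 + 1)
      (diffOp (pfaff (r := k + 1) fun i v => MvPolynomial.X (i.succ, v))) a :=
    fun a => congrArg (fun P => (-1 : Coeff) ^ (k + 1) * tauIntegral P a) (piEven_eq_diffOp n (k + 1))
  rw [hint]
  congr 1
  rw [tauIntegral_diffOp, hpure]
  refine Eq.trans ?_ (simplexIntegral_smul _ (tame_rot i _ _))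
  congr 1
  funext u
  rw [kern_merge, hpull, map_smul, LinearMap.smul_apply, map_smul, map_smul]
  rfl

/-- `B τ_{2k+2} = -τ_{2k+1}`. -/
lemma neg_connesB_tauEven (n k : ℕ) :
    -connesB (k := 2 * k + 1) (tauEven n (k + 1)) = tauOdd n k := by
  funext a
  rw [Pi.neg_apply, connesB, tauOdd, piOdd_eq_diffOp, Pi.smul_apply, tauIntegral_diffOp,
    ← sum_simplexIntegral_rot, smul_eq_mul, Finset.mul_sum, ← Finset.sum_neg_distrib]
  refine Finset.sum_congr rfl fun i _ => ?_
  rw [tauEven_rotate]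
  -- The sign in Connes' operator and the sign of the rotation cancel, and the remaining `-(-1) ^ (k
  -- + 1)` is `(-1) ^ k`.
  have h : ∀ y : Coeff, -((-1) ^ ((i : ℕ) * (2 * k + 1)) * ((-1) ^ (k + 1) *
      ((-1) ^ ((i : ℕ) * (2 * k + 1)) * y))) = (-1) ^ k * y := by
    intro y
    have e : ((-1) ^ ((i : ℕ) * (2 * k + 1)) : Coeff) * (-1) ^ ((i : ℕ) * (2 * k + 1)) = 1 := by
      rw [← mul_pow, neg_mul_neg, one_mul, one_pow]
    linear_combination ((-1) ^ k * y) * e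
  exact h _

end ConnesOperator

/-! ## Contractions of two neighbouring slots -/

section Contraction

variable {m n : ℕ}

lemma slotDeriv_prod_rename {ι : Type} [DecidableEq ι] (i : ι) (v : Var n)
    (s : Finset ι) (hi : i ∉ s) (a : ι → Poly n) :
    slotDeriv i v (∏ j ∈ s, MvPolynomial.rename (Prod.mk j) (a j)) = 0 := by
  rw [slotDeriv_apply]
  refine Finset.prod_induction _ (fun y => MvPolynomial.pderiv (i, v) y = 0) ?_ ?_ ?_
  · intro x y hx hy
    rw [Derivation.leibniz, hx, hy, smul_zero, smul_zero, add_zero]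
  · simp
  · intro j hj
    have hne : j ≠ i := by
      rintro rfl
      exact hi hj
    have := slotDeriv_slot i j v (a j)
    rw [if_neg hne] at this
    exact this

/-- A pure tensor in which one factor is a Moyal product. -/
lemma pureTensor_moyal {ι κ : Type} [Fintype ι] [Fintype κ] [DecidableEq ι] [DecidableEq κ]
    {f : ι → κ} {i j : ι} (hij : i ≠ j) (hfij : f i = f j)
    (hinj : ∀ l l', l ≠ i → l ≠ j → f l = f l' → l = l') (hsurj : Function.Surjective f)
    (a : ι → Poly n) (b : κ → Poly n) (hb : b (f i) = moyal (a i) (a j))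
    (hb' : ∀ l, l ≠ i → l ≠ j → b (f l) = a l) :
    pureTensor b = merge f (expOp (hscal (1 / 2) • poissonSymb i j) (pureTensor a)) := by
  set s : Finset ι := (Finset.univ.erase i).erase j with hs
  set rest : Slots ι n := ∏ l ∈ s, MvPolynomial.rename (Prod.mk l) (a l) with hrest
  set e : Fin 2 → ι := ![i, j] with he
  have hei : Function.Injective e := by
    intro x y hxy
    fin_cases x <;> fin_cases y <;> simp_all
  -- `S` places a tensor with two slots in the slots `i` and `j` and multiplies by the other
  -- factors. The derivatives in these two slots do not see `rest`, so `S` carries the exponential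
  -- in the Moyal product to the exponential on all slots.
  set S : Slots (Fin 2) n →ₗ[Coeff] Slots ι n :=
    (LinearMap.mulRight Coeff rest).comp (merge e).toLinearMap with hS
  have hS' : ∀ y, S y = merge e y * rest := fun y => rfl
  have hr : ∀ (x : Fin 2) (v : Var n), slotDeriv (e x) v rest = 0 := by
    intro x v
    refine slotDeriv_prod_rename _ _ _ ?_ _
    fin_cases x <;> simp [he, hs]
  have hd : ∀ (x : Fin 2) (v : Var n) (y : Slots (Fin 2) n),
      slotDeriv (e x) v (S y) = S (slotDeriv x v y) := by
    intro x v y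
    have h1 := hr x v
    have h2 := slotDeriv_merge e (e x) v y
    rw [Finset.sum_eq_single x (fun z _ hz => if_neg fun h => hz (hei h)) (by simp),
      if_pos rfl] at h2
    rw [slotDeriv_apply] at h1
    rw [hS', hS', slotDeriv_apply, Derivation.leibniz, h1, smul_zero, zero_add, smul_eq_mul,
      mul_comm, ← h2, slotDeriv_apply]
  have hp : ∀ y, S (((algebraMap ℂ Coeff (1 / 2) * hbar) • poisson (0 : Fin 2) 1) y)
      = diffOp (hscal (1 / 2) • poissonSymb i j) (S y) := by
    intro y
    have e0 : e 0 = i := rfl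
    have e1 : e 1 = j := rfl
    have hc : hscal (1 / 2) = algebraMap ℂ Coeff (1 / 2) * hbar := by
      rw [hscal]
      norm_num
    rw [map_smul, diffOp_poissonSymb, LinearMap.smul_apply, LinearMap.smul_apply, map_smul, hc,
      poisson_apply, poisson_apply, map_sum]
    congr 1
    refine Finset.sum_congr rfl fun t _ => ?_
    rw [map_sub, ← hd, ← hd, ← hd, ← hd, e0, e1]
  have hnil : LocNil (diffOp (hscal (1 / 2) • poissonSymb (n := n) i j)) := by
    refine diffOp_locNil ?_
    rw [MvPolynomial.smul_eq_C_mul, map_mul, constantCoeff_poissonSymb, mul_zero]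
  have hji : j ∈ Finset.univ.erase i := Finset.mem_erase.mpr ⟨hij.symm, Finset.mem_univ _⟩
  have hpure : pureTensor a = S (pureTensor ![a i, a j]) := by
    rw [hS', pureTensor, pureTensor, Fin.prod_univ_two, map_mul, merge_slot, merge_slot,
      ← Finset.mul_prod_erase _ _ (Finset.mem_univ i), ← Finset.mul_prod_erase _ _ hji, ← mul_assoc]
    rfl
  have hconst : ∀ x, f (e x) = f i := by
    intro x
    fin_cases x
    · rfl
    · exact hfij.symm
  have himage : (Finset.univ : Finset κ).erase (f i) = s.image f := by
    ext k
    simp only [hs, Finset.mem_erase, Finset.mem_univ, and_true, Finset.mem_image]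
    constructor
    · intro hk
      obtain ⟨l, rfl⟩ := hsurj k
      exact ⟨l, ⟨fun h => hk (by rw [h, hfij]), fun h => hk (by rw [h])⟩, rfl⟩
    · rintro ⟨l, ⟨h1, h2⟩, rfl⟩ h
      exact h2 (hinj l i h2 h1 h)
  rw [expOp, hpure, ← expEnd_intertwine (smul_poisson_locNil _ _ _) hnil S hp, hS', map_mul,
    merge_merge_const _ _ _ hconst]
  have hm : multiply (expEnd ((algebraMap ℂ Coeff (1 / 2) * hbar) • poisson (0 : Fin 2) 1)
    (pureTensor ![a i, a j])) = b (f i) := hb.symm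
  rw [hm, hrest, map_prod, pureTensor, ← Finset.mul_prod_erase _ _ (Finset.mem_univ (f i)), himage,
    Finset.prod_image]
  · congr 1
    refine Finset.prod_congr rfl fun l hl => ?_
    simp only [hs, Finset.mem_erase, Finset.mem_univ, and_true] at hl
    rw [merge_slot, hb' l hl.2 hl.1]
  · intro l hl l' _ h
    simp only [hs, Finset.coe_erase, Set.mem_sdiff, Set.mem_singleton_iff] at hl
    exact hinj l l' hl.1.2 hl.2 h

/-- The map of slots that identifies the slots `j` and `j + 1` (in the cyclic order). -/
def degen (j l : Fin (m + 2)) : Fin (m + 1) :=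
  ⟨if (l : ℕ) = m + 1 ∧ (j : ℕ) = m + 1 then 0 else if (l : ℕ) ≤ j then l else l - 1, by
    have := l.isLt
    have := j.isLt
    split_ifs <;> omega⟩

lemma degen_val (j l : Fin (m + 2)) : (degen j l : ℕ)
    = if (l : ℕ) = m + 1 ∧ (j : ℕ) = m + 1 then 0 else if (l : ℕ) ≤ j then (l : ℕ) else l - 1 := rfl

/-- The slot after `j` in the cyclic order. -/
def nextSlot (j : Fin (m + 2)) : Fin (m + 2) :=
  ⟨if (j : ℕ) = m + 1 then 0 else j + 1, by
    have := j.isLt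
    split_ifs <;> omega⟩

lemma nextSlot_val (j : Fin (m + 2)) :
    (nextSlot j : ℕ) = if (j : ℕ) = m + 1 then 0 else (j : ℕ) + 1 := rfl

lemma nextSlot_ne (j : Fin (m + 2)) : j ≠ nextSlot j := by
  rw [Ne, Fin.ext_iff, nextSlot_val]
  split_ifs <;> omega

lemma degen_nextSlot (j : Fin (m + 2)) : degen j j = degen j (nextSlot j) := by
  rw [Fin.ext_iff, degen_val, degen_val, nextSlot_val]
  split_ifs <;> omega

lemma degen_inj (j l l' : Fin (m + 2)) (h1 : l ≠ j) (h2 : l ≠ nextSlot j)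
    (h : degen j l = degen j l') : l = l' := by
  rw [Ne, Fin.ext_iff] at h1
  rw [Ne, Fin.ext_iff, nextSlot_val] at h2
  rw [Fin.ext_iff, degen_val, degen_val] at h
  rw [Fin.ext_iff]
  have := l.isLt
  have := l'.isLt
  have := j.isLt
  split_ifs at h h2 <;> omega

lemma degen_surjective (j : Fin (m + 2)) : Function.Surjective (degen j) := by
  intro k
  have := k.isLt
  by_cases h : (k : ℕ) ≤ j
  · refine ⟨⟨k, by omega⟩, ?_⟩
    rw [Fin.ext_iff, degen_val]
    dsimp only
    split_ifs <;> omega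
  · refine ⟨⟨k + 1, by omega⟩, ?_⟩
    rw [Fin.ext_iff, degen_val]
    dsimp only
    split_ifs <;> omega

lemma withEnds_of_lt (w : Fin m → ℝ) (i : Fin (m + 2)) (h : (i : ℕ) < m + 1) :
    withEnds w i = withZero w ⟨i, h⟩ :=
  withEnds_castSucc w ⟨i, h⟩

/-- The exception is the last face: there slot `m + 1` sits at the point `1` and is merged with slot
`0` at the point `0`, the same point of the circle. -/
lemma withZero_face (j : Fin (m + 2)) (w : Fin m → ℝ) (l : Fin (m + 2)) :
    withZero (face j w) l
      = if (l : ℕ) = m + 1 ∧ (j : ℕ) = m + 1 then 1 else withZero w (degen j l) := by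
  have hj := j.isLt
  induction l using Fin.cases with
  | zero =>
    have h0 : degen j 0 = 0 := by
      rw [Fin.ext_iff, degen_val]
      simp
    rw [withZero_zero, if_neg (by simp), h0, withZero_zero]
  | succ i =>
    have hi := i.isLt
    rw [withZero_succ, face]
    have hv : ((i.succ : Fin (m + 2)) : ℕ) = i + 1 := rfl
    by_cases h : i.castSucc < j
    · rw [if_pos h]
      rw [Fin.lt_def, Fin.val_castSucc] at h
      by_cases h2 : (i : ℕ) = m
      · rw [if_pos (by omega)]
        have : i.succ = Fin.last (m + 1) := by
          rw [Fin.ext_iff, hv, Fin.val_last, h2]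
        rw [this, withEnds_last]
      · rw [if_neg (by omega), withEnds_of_lt _ _ (by omega)]
        congr 1
        rw [Fin.ext_iff, degen_val]
        dsimp only
        split_ifs <;> omega
    · rw [if_neg h]
      rw [Fin.lt_def, Fin.val_castSucc] at h
      rw [if_neg (by omega), withEnds_castSucc]
      congr 1
      rw [Fin.ext_iff, degen_val]
      split_ifs <;> omega

lemma quadSymb_pair {ι : Type} [Fintype ι] [DecidableEq ι] (a b : ι) :
    quadSymb (n := n) (fun i l => (if i = a ∧ l = b then (1 / 2 : ℝ) else 0)
      - if i = b ∧ l = a then 1 / 2 else 0) = hscal (1 / 2) • poissonSymb a b := by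
  have h : (fun i l => (if i = a ∧ l = b then (1 / 2 : ℝ) else 0)
      - if i = b ∧ l = a then 1 / 2 else 0)
      = (fun i l => if i = a ∧ l = b then (1 / 2 : ℝ) else 0)
        + fun i l => if i = b ∧ l = a then -(1 / 2) else 0 := by
    funext i l
    simp only [Pi.add_apply, sub_eq_add_neg]
    congr 1
    split_ifs <;> simp
  have h1 : ∀ (a b : ι) (c : ℝ), quadSymb (n := n) (fun i l => if i = a ∧ l = b then c else 0)
      = hscal (c / 2) • poissonSymb a b := by
    intro a b c
    rw [quadSymb, Finset.sum_eq_single a, Finset.sum_eq_single b]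
    · simp
    · intro l _ hl
      simp [hl, hscal_zero]
    · simp
    · intro i _ hi
      simp [hi, hscal_zero]
    · simp
  rw [h, quadSymb_add, h1, h1, poissonSymb_swap a b, neg_div, hscal_neg, smul_neg, neg_smul,
    neg_neg, ← add_smul, ← hscal_add, add_halves]

/-- On a face two points coincide, and between their slots the sawtooth retains its one-sided value
1/2, the constant of the Moyal product. For all other pairs the values agree, across the end points
by periodicity. -/
lemma saw_face (j : Fin (m + 2)) (w : Fin m → ℝ) :
    saw (withZero (face j w)) = (fun i l => saw (withZero w) (degen j i) (degen j l))
      + fun i l => (if i = j ∧ l = nextSlot j then (1 / 2 : ℝ) else 0)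
        - if i = nextSlot j ∧ l = j then 1 / 2 else 0 := by
  have hj := j.isLt
  funext i l
  have hi := i.isLt
  have hl := l.isLt
  have h0 : ∀ k : Fin (m + 2), (k : ℕ) = m + 1 ∧ (j : ℕ) = m + 1 → withZero w (degen j k) = 0 := by
    intro k hk
    have : degen j k = 0 := by
      rw [Fin.ext_iff, degen_val, if_pos hk]
      rfl
    rw [this, withZero_zero]
  have hv : ∀ k : Fin (m + 2), withZero (face j w) k = withZero w (degen j k)
      + if (k : ℕ) = m + 1 ∧ (j : ℕ) = m + 1 then 1 else 0 := by
    intro k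
    rw [withZero_face]
    split_ifs with h
    · rw [h0 k h, zero_add]
    · rw [add_zero]
  simp only [Pi.add_apply, saw, hv]
  have key : ((if (i : ℕ) = m + 1 ∧ (j : ℕ) = m + 1 then (1 : ℝ) else 0)
      - if (l : ℕ) = m + 1 ∧ (j : ℕ) = m + 1 then (1 : ℝ) else 0)
      + (if i < l then 1 / 2 else if l < i then -(1 / 2) else 0)
      = (if degen j i < degen j l then 1 / 2 else if degen j l < degen j i then -(1 / 2) else 0)
      + ((if i = j ∧ l = nextSlot j then (1 / 2 : ℝ) else 0)
        - if i = nextSlot j ∧ l = j then 1 / 2 else 0) := by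
    simp only [Fin.lt_def, Fin.ext_iff, degen_val, nextSlot_val]
    -- The positions have cancelled and only the jumps remain. The case `j = m + 1` is the cyclic
    -- one, where the order of the slots changes; otherwise `degen` preserves the order.
    by_cases hjm : (j : ℕ) = m + 1
    · simp only [hjm, and_true, if_true]
      by_cases him : (i : ℕ) = m + 1 <;> by_cases hlm : (l : ℕ) = m + 1
      · simp [him, hlm]
      · have h1 : (l : ℕ) ≤ m + 1 := by omega
        have h2 : (l : ℕ) < m + 1 := by omega
        have h3 : ¬ m + 1 < (l : ℕ) := by omega
        by_cases h4 : (l : ℕ) = 0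
        · simp [him, h4]
          norm_num
        · have h5 : 0 < (l : ℕ) := by omega
          simp [him, hlm, h1, h2, h3, h4, h5]
          norm_num
      · have h1 : (i : ℕ) ≤ m + 1 := by omega
        have h2 : (i : ℕ) < m + 1 := by omega
        by_cases h4 : (i : ℕ) = 0
        · simp [hlm, h4]
          norm_num
        · have h5 : 0 < (i : ℕ) := by omega
          simp [him, hlm, h1, h2, h4, h5]
          norm_num
      · have h1 : (l : ℕ) ≤ m + 1 := by omega
        have h2 : (i : ℕ) ≤ m + 1 := by omega
        simp [him, hlm, h1, h2]
    · simp only [hjm, and_false, if_false, sub_zero, zero_add]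
      split_ifs <;> first | omega | norm_num
  linarith

/-- The integrand at a tensor in which the factors `j` and `j + 1` are multiplied. -/
lemma kern_contract (j : Fin (m + 2)) (P : Symb (Fin (m + 1)) n)
    (a : Fin (m + 2) → Weyl n) (b : Fin (m + 1) → Weyl n) (hb : b (degen j j) = a j * a (nextSlot j))
    (hb' : ∀ l, l ≠ j → l ≠ nextSlot j → b (degen j l) = a l) (w : Fin m → ℝ) :
    kern P (pureTensor fun i => (b i).toPoly) w
      = kern (pull (degen j) P) (pureTensor fun i => (a i).toPoly) (face j w) := by
  rw [pureTensor_moyal (nextSlot_ne j) (degen_nextSlot j) (degen_inj j) (degen_surjective j)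
    (fun i => (a i).toPoly) (fun i => (b i).toPoly) (by
      rw [hb]
      rfl) fun l h1 h2 => by
      rw [hb' l h1 h2]]
  have hc : MvPolynomial.constantCoeff (hscal (1 / 2) • poissonSymb (n := n) j (nextSlot j)) = 0 := by
    rw [MvPolynomial.smul_eq_C_mul, map_mul, constantCoeff_poissonSymb, mul_zero]
  rw [kern_merge, kern, saw_face, quadSymb_add, quadSymb_pair,
    expOp_add (constantCoeff_quadSymb _) hc, Module.End.mul_apply, expOp_diffOp hc]

end Contraction

/-! ## The Hochschild coboundary of the cochains -/

section Coboundary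

variable {m n : ℕ}

/-- The arguments of the `j`-th term of the Hochschild coboundary. -/
def contract {A : Type*} [Mul A] (j : Fin (m + 2)) (a : Fin (m + 2) → A) : Fin (m + 1) → A :=
  Fin.lastCases (motive := fun _ => Fin (m + 1) → A)
    (Fin.cons (α := fun _ => A) (a (Fin.last (m + 1)) * a 0) fun l : Fin m => a l.castSucc.succ)
    (fun i => Fin.contractNth i.castSucc (· * ·) a) j

/-- The cyclic last term is put on the same footing as the others: it multiplies the last factor by
its cyclic successor. -/
lemma hochschildB_eq_sum {A : Type*} [Ring A] [Algebra Coeff A] (f : CochainFun Coeff A m)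
    (a : Fin (m + 2) → A) :
    hochschildB f a = ∑ j : Fin (m + 2), (-1) ^ (j : ℕ) * f (contract j a) := by
  rw [Fin.sum_univ_castSucc, hochschildB]
  simp only [contract, Fin.lastCases_castSucc, Fin.lastCases_last, Fin.val_castSucc, Fin.val_last]

lemma contract_degen_self {A : Type*} [Mul A] (j : Fin (m + 2)) (a : Fin (m + 2) → A) :
    contract j a (degen j j) = a j * a (nextSlot j) := by
  induction j using Fin.lastCases with
  | last =>
    have h1 : degen (Fin.last (m + 1)) (Fin.last (m + 1)) = 0 := by
      rw [Fin.ext_iff, degen_val]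
      simp
    have h2 : nextSlot (Fin.last (m + 1)) = 0 := by
      rw [Fin.ext_iff, nextSlot_val]
      simp
    rw [contract, Fin.lastCases_last, h1, h2, Fin.cons_zero]
  | cast i =>
    have hi := i.isLt
    have h1 : degen i.castSucc i.castSucc = i := by
      rw [Fin.ext_iff, degen_val, Fin.val_castSucc]
      split_ifs <;> omega
    have h2 : nextSlot i.castSucc = i.succ := by
      rw [Fin.ext_iff, nextSlot_val, Fin.val_castSucc, Fin.val_succ]
      split_ifs <;> omega
    rw [contract, Fin.lastCases_castSucc, h1, h2, Fin.contractNth_apply_of_eq _ _ _ _ rfl]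

lemma contract_degen_of_ne {A : Type*} [Mul A] (j : Fin (m + 2)) (a : Fin (m + 2) → A)
    (l : Fin (m + 2)) (h1 : l ≠ j) (h2 : l ≠ nextSlot j) : contract j a (degen j l) = a l := by
  have hl := l.isLt
  rw [Ne, Fin.ext_iff] at h1
  rw [Ne, Fin.ext_iff, nextSlot_val] at h2
  induction j using Fin.lastCases with
  | last =>
    rw [Fin.val_last] at h1 h2
    rw [if_pos rfl] at h2
    rw [contract, Fin.lastCases_last]
    have h3 : degen (Fin.last (m + 1)) l = Fin.succ ⟨l - 1, by omega⟩ := by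
      rw [Fin.ext_iff, degen_val, Fin.val_last, Fin.val_succ]
      dsimp only
      split_ifs <;> omega
    rw [h3, Fin.cons_succ]
    congr 1
    rw [Fin.ext_iff, Fin.val_succ, Fin.val_castSucc]
    dsimp only
    omega
  | cast i =>
    have hi := i.isLt
    rw [Fin.val_castSucc] at h1 h2
    rw [if_neg (by omega)] at h2
    rw [contract, Fin.lastCases_castSucc]
    have h3 := degen_val i.castSucc l
    rw [Fin.val_castSucc] at h3
    by_cases hlt : (l : ℕ) < i
    · rw [if_neg (by omega), if_pos (by omega)] at h3
      rw [Fin.contractNth_apply_of_lt _ _ _ _ (by rw [h3, Fin.val_castSucc]; exact hlt)]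
      congr 1
      rw [Fin.ext_iff, Fin.val_castSucc, h3]
    · rw [if_neg (by omega), if_neg (by omega)] at h3
      rw [Fin.contractNth_apply_of_gt _ _ _ _ (by rw [h3, Fin.val_castSucc]; omega)]
      congr 1
      rw [Fin.ext_iff, Fin.val_succ, h3]
      omega

lemma hochschildB_tauIntegral (P : Symb (Fin (m + 1)) n) (a : Fin (m + 2) → Weyl n) :
    hochschildB (tauIntegral (diffOp P)) a = ∑ j : Fin (m + 2), (-1) ^ (j : ℕ) *
      simplexIntegral fun w => kern (pull (degen j) P) (pureTensor fun i => (a i).toPoly)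
        (face j w) := by
  rw [hochschildB_eq_sum]
  refine Finset.sum_congr rfl fun j _ => ?_
  rw [tauIntegral_diffOp]
  congr 2
  funext w
  exact kern_contract j P a _ (contract_degen_self j a) (contract_degen_of_ne j a) w

/-- The Pfaffian of the slots `1, …, 2 k + 1` without the slot `i + 1`. -/
def minorPf (n k : ℕ) (i : Fin (2 * k + 1)) : Symb (Fin (2 * k + 1 + 1)) n :=
  pfaff (r := k) fun b v => MvPolynomial.X ((i.succAbove b).succ, v)

/-- Only the slots `b + 1` and `b + 2` can map to `b + 1`, and both do exactly when `j = b + 1`. The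
slot `0`, where the cyclic case would matter, is not hit. -/
lemma pull_degen_X {k : ℕ} (j : Fin (2 * k + 2)) (b : Fin (2 * k)) (v : Var n) :
    pull (degen j) (MvPolynomial.X (b.succ, v))
      = ((if (b : ℕ) + 1 ≤ j then MvPolynomial.X (b.castSucc.succ, v) else 0)
        + if (j : ℕ) ≤ b + 1 then MvPolynomial.X (b.succ.succ, v) else 0 :
          Symb (Fin (2 * k + 2)) n) := by
  have hb := b.isLt
  have hj := j.isLt
  have h : ∀ l : Fin (2 * k + 2),
      (if degen j l = b.succ then (MvPolynomial.X (l, v) : Symb (Fin (2 * k + 2)) n) else 0)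
      = (if l = b.castSucc.succ then
          (if (b : ℕ) + 1 ≤ j then MvPolynomial.X (b.castSucc.succ, v) else 0) else 0)
        + if l = b.succ.succ then
          (if (j : ℕ) ≤ b + 1 then MvPolynomial.X (b.succ.succ, v) else 0) else 0 := by
    intro l
    have hl := l.isLt
    by_cases h1 : l = b.castSucc.succ
    · subst h1
      have hne : b.castSucc.succ ≠ b.succ.succ := by
        rw [Ne, Fin.ext_iff]
        simp
      rw [if_pos rfl, if_neg hne, add_zero]
      congr 1
      have hv : ((b.castSucc.succ : Fin (2 * k + 2)) : ℕ) = b + 1 := rfl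
      have hd := degen_val j b.castSucc.succ
      rw [hv] at hd
      rw [Fin.ext_iff, hd, Fin.val_succ, eq_iff_iff]
      split_ifs <;> omega
    · by_cases h2 : l = b.succ.succ
      · subst h2
        rw [if_neg h1, if_pos rfl, zero_add]
        congr 1
        have hv : ((b.succ.succ : Fin (2 * k + 2)) : ℕ) = b + 2 := rfl
        have hd := degen_val j b.succ.succ
        rw [hv] at hd
        rw [Fin.ext_iff, hd, Fin.val_succ, eq_iff_iff]
        split_ifs <;> try rw [false_iff]
        all_goals omega
      · rw [if_neg h1, if_neg h2, add_zero, if_neg]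
        rw [Fin.ext_iff, Fin.val_succ, Fin.val_castSucc] at h1
        rw [Fin.ext_iff, Fin.val_succ, Fin.val_succ] at h2
        rw [Fin.ext_iff, degen_val, Fin.val_succ]
        split_ifs
        · exact not_false
        all_goals omega
  rw [pull_X]
  simp only [h]
  rw [Finset.sum_add_distrib, Finset.sum_ite_eq', Finset.sum_ite_eq', if_pos (Finset.mem_univ _),
    if_pos (Finset.mem_univ _)]

lemma succAbove_succ_val {k : ℕ} (i : Fin (2 * k + 1)) (b : Fin (2 * k)) :
    (i.succAbove b).succ = if (b : ℕ) < i then b.castSucc.succ else b.succ.succ := by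
  unfold Fin.succAbove
  simp only [Fin.lt_def, Fin.val_castSucc]
  split_ifs <;> rfl

/-- For `0 < j < 2 k + 1` one row is the sum of the derivatives in the slots `j` and `j + 1`, and
additivity in that row gives the minors omitting `j + 1` and `j`. For the first and last `j` one of
the two slots is slot `0`, which has no row, so only one minor occurs. -/
lemma pull_degen_pfaff (k : ℕ) (j : Fin (2 * k + 1 + 1)) :
    pull (degen j) (pfaff (r := k) fun i v =>
        (MvPolynomial.X (i.succ, v) : Symb (Fin (2 * k + 1)) n))
      = Fin.cases (motive := fun _ => Symb (Fin (2 * k + 1 + 1)) n) 0 (minorPf n k) j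
        + Fin.lastCases (motive := fun _ => Symb (Fin (2 * k + 1 + 1)) n) 0 (minorPf n k) j := by
  rw [pfaff_map]
  simp only [pull_degen_X]
  induction j using Fin.cases with
  | zero =>
    have h0 : (0 : Fin (2 * k + 1 + 1)) = Fin.castSucc 0 := rfl
    rw [Fin.cases_zero, zero_add]
    conv_rhs => rw [h0, Fin.lastCases_castSucc]
    rw [minorPf]
    congr 1
    funext b v
    rw [succAbove_succ_val]
    simp
  | succ i =>
    rw [Fin.cases_succ]
    induction i using Fin.lastCases with
    | last =>
      rw [Fin.succ_last, Fin.lastCases_last, add_zero, minorPf]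
      congr 1
      funext b v
      have hb := b.isLt
      rw [succAbove_succ_val, Fin.val_last, Fin.val_last, if_pos (by omega), if_neg (by omega),
        if_pos (by omega), add_zero]
    | cast i =>
      have hi := i.isLt
      rw [Fin.succ_castSucc, Fin.lastCases_castSucc, add_comm (minorPf n k _)]
      refine pfaff_add _ _ _ i ?_ ?_ ?_
      · funext v
        rw [Pi.add_apply, succAbove_succ_val, succAbove_succ_val, Fin.val_castSucc, Fin.val_succ,
          if_pos le_rfl, if_pos le_rfl, if_pos (Nat.lt_succ_self _), Fin.val_castSucc,
          if_neg (lt_irrefl _)]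
      · intro b hb
        rw [Ne, Fin.ext_iff] at hb
        funext v
        rw [succAbove_succ_val, Fin.val_castSucc, Fin.val_succ]
        by_cases h : (b : ℕ) < i
        · rw [if_pos (by omega), if_pos (by omega), if_neg (by omega), add_zero]
        · rw [if_neg (by omega), if_neg (by omega), if_pos (by omega), zero_add]
      · intro b hb
        rw [Ne, Fin.ext_iff] at hb
        funext v
        rw [succAbove_succ_val, Fin.val_castSucc, Fin.val_castSucc, Fin.val_succ]
        by_cases h : (b : ℕ) < i
        · rw [if_pos (by omega), if_pos (by omega), if_neg (by omega), add_zero]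
        · rw [if_neg (by omega), if_neg (by omega), if_pos (by omega), zero_add]

/-- Row `0` of the full Pfaffian may be replaced by the sum of all rows. In the expansion along it,
the pairing with row `i + 1` is `-ħ ∑_l α_{i+1,l}`, which accounts for the exponent `i + 1`. -/
lemma sum_sumSymb_mul_minorPf (n k : ℕ) :
    ∑ i : Fin (2 * k + 1), ((-1) ^ ((i : ℕ) + 1) : Coeff) • (sumSymb i.succ * minorPf n k i)
      = pfaff (r := k + 1) fun i v => (MvPolynomial.X (i, v) : Symb (Fin (2 * k + 1 + 1)) n) := by
  set R : Fin (2 * k + 1 + 1) → Var n → Symb (Fin (2 * k + 1 + 1)) n :=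
    fun i v => MvPolynomial.X (i, v) with hR
  have h := pfaff_update_sum (r := k + 1) R (0 : Fin (2 * k + 1 + 1))
  refine Eq.trans ?_ h
  rw [pfaff_succ]
  refine Finset.sum_congr rfl fun i _ => ?_
  have h1 : Function.update R (0 : Fin (2 * k + 1 + 1)) (∑ j, R j) 0 = ∑ j, R j :=
    Function.update_self _ _ _
  have h2 : ∀ i : Fin (2 * k + 1),
      Function.update R (0 : Fin (2 * k + 1 + 1)) (∑ j, R j) i.succ = R i.succ := fun i =>
    Function.update_of_ne (Fin.succ_ne_zero i) _ _
  have h3 : sympl (∑ j, R j) (R i.succ) = -sumSymb (n := n) i.succ := by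
    rw [sympl, sumSymb, ← smul_neg]
    congr 1
    simp only [poissonSymb]
    rw [Finset.sum_comm, ← Finset.sum_neg_distrib]
    refine Finset.sum_congr rfl fun a _ => ?_
    rw [Finset.sum_apply, Finset.sum_apply, Finset.sum_mul, Finset.sum_mul,
      ← Finset.sum_sub_distrib, ← Finset.sum_neg_distrib]
    refine Finset.sum_congr rfl fun l _ => ?_
    rw [hR]
    ring
  have h4 : (fun j : Fin (2 * k) =>
      Function.update R (0 : Fin (2 * k + 1 + 1)) (∑ j, R j) (i.succAbove j).succ)
      = fun j => R (i.succAbove j).succ := funext fun j => h2 _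
  have h5 : ((-1) ^ ((i : ℕ) + 1) : Coeff) • (sumSymb i.succ * minorPf n k i)
      = (-1) ^ (i : ℕ) * (-sumSymb i.succ) * minorPf n k i := by
    rw [Algebra.smul_def, map_pow, map_neg, map_one]
    ring
  rw [h5, ← h3]
  refine congrArg₂ (· * ·) (congrArg₂ (· * ·) rfl ?_) ?_
  · exact congrArg₂ sympl h1.symm (h2 i).symm
  · exact congrArg pfaff h4.symm

/-- The Hochschild coboundary of the even cochains. -/
lemma hochschildB_tauIntegral_piEven (n k : ℕ) :
    hochschildB (tauIntegral (piEven n k)) = tauIntegral (piOdd n k) := by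
  funext a
  set x := pureTensor fun i => (a i).toPoly with hx
  rw [piEven_eq_diffOp, hochschildB_tauIntegral, piOdd_eq_diffOp, tauIntegral_diffOp, ← hx,
    ← sum_sumSymb_mul_minorPf]
  -- The integral of the minor `i` over the face `j`. Only `j = i` and `j = i + 1` occur in the
  -- coboundary, with opposite signs, and these are the two boundary terms of the coordinate
  -- `u_{i+1}`.
  set I : Fin (2 * k + 1) → Fin (2 * k + 1 + 1) → Coeff := fun i j =>
    simplexIntegral fun w => kern (minorPf n k i) x (face j w) with hI
  have h1 : ∀ j : Fin (2 * k + 1 + 1), (simplexIntegral fun w =>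
      kern (pull (degen j) (pfaff (r := k) fun i v => MvPolynomial.X (i.succ, v))) x (face j w))
      = Fin.cases (motive := fun _ => Coeff) 0 (fun i => I i j) j
        + Fin.lastCases (motive := fun _ => Coeff) 0 (fun i => I i j) j := by
    intro j
    simp only [pull_degen_pfaff, kern_add_symb, Pi.add_apply]
    have h2 : ∀ P : Symb (Fin (2 * k + 1 + 1)) n, Tame fun w => kern P x (face j w) := fun P =>
      (tame_kern P x).comp (continuous_face j)
    refine (simplexIntegral_add (h2 _) (h2 _)).trans ?_
    congr 1
    · induction j using Fin.cases with
      | zero =>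
        simp only [Fin.cases_zero, kern_zero_symb]
        exact simplexIntegral_zero
      | succ j => rfl
    · induction j using Fin.lastCases with
      | last =>
        simp only [Fin.lastCases_last, kern_zero_symb]
        exact simplexIntegral_zero
      | cast j => simp only [Fin.lastCases_castSucc, hI]
  rw [Finset.sum_congr rfl fun j _ => congrArg (_ * ·) (h1 j)]
  simp only [mul_add, Finset.sum_add_distrib]
  rw [Fin.sum_univ_succ (fun j : Fin (2 * k + 1 + 1) => (-1 : Coeff) ^ (j : ℕ) *
      Fin.cases (motive := fun _ => Coeff) 0 (fun i => I i j) j),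
    Fin.sum_univ_castSucc (fun j : Fin (2 * k + 1 + 1) => (-1 : Coeff) ^ (j : ℕ) *
      Fin.lastCases (motive := fun _ => Coeff) 0 (fun i => I i j) j)]
  simp only [Fin.cases_zero, Fin.cases_succ, Fin.lastCases_castSucc, Fin.lastCases_last, mul_zero,
    zero_add, add_zero, Fin.val_succ, Fin.val_castSucc]
  rw [← Finset.sum_add_distrib, kern_sum_symb, simplexIntegral_sum _ fun i _ => tame_kern _ x]
  refine Finset.sum_congr rfl fun i _ => ?_
  rw [kern_smul_symb, simplexIntegral_smul _ (tame_kern _ x), simplexIntegral_face, smul_eq_mul,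
    pow_succ]
  ring

end Coboundary

/-! ## The cocycle -/

section Cocycle

lemma hochschildB_smul {A : Type*} [Ring A] [Algebra Coeff A] {m : ℕ} (c : Coeff)
    (f : CochainFun Coeff A m) : hochschildB (c • f) = c • hochschildB f := by
  funext a
  rw [Pi.smul_apply, hochschildB_eq_sum, hochschildB_eq_sum, Finset.smul_sum]
  refine Finset.sum_congr rfl fun j _ => ?_
  rw [Pi.smul_apply, smul_eq_mul, smul_eq_mul]
  ring

lemma hochschildB_zero {A : Type*} [Ring A] [Algebra Coeff A] {m : ℕ} :
    hochschildB (0 : CochainFun Coeff A m) = 0 := by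
  simpa using hochschildB_smul 0 (0 : CochainFun Coeff A m)

lemma connesB_zero {A : Type*} [Ring A] [Algebra Coeff A] {m : ℕ} :
    connesB (0 : CochainFun Coeff A (m + 1)) = 0 := by
  funext a
  simp [connesB]

lemma hochschildB_tauEven (n k : ℕ) : hochschildB (tauEven n k) = tauOdd n k := by
  rw [tauEven, hochschildB_smul, hochschildB_tauIntegral_piEven, tauOdd]

lemma tauEven_mem (n k : ℕ) : tauEven n k ∈ NormalizedCochain Coeff (Weyl n) (2 * k) := by
  refine Submodule.smul_mem _ _ ?_
  rw [piEven_eq_diffOp]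
  exact tauIntegral_pfaff_mem Fin.succ fun j => ⟨j, rfl⟩

lemma tauOdd_mem (n k : ℕ) : tauOdd n k ∈ NormalizedCochain Coeff (Weyl n) (2 * k + 1) := by
  refine Submodule.smul_mem _ _ ?_
  rw [piOdd_eq_diffOp]
  exact tauIntegral_pfaff_mem (r := k + 1) (m := 2 * k + 1) id fun j => ⟨j.succ, rfl⟩

/-- The operator is the `(n + 1)`-st exterior power of a form in `2 n` variables. -/
lemma tauIntegral_piOdd_self (n : ℕ) : tauIntegral (piOdd n n) = 0 := by
  funext a
  rw [piOdd_eq_diffOp, tauIntegral_diffOp, pfaff_eq_zero (Nat.lt_succ_self n), kern_zero_symb]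
  exact simplexIntegral_zero

lemma tauOdd_self (n : ℕ) : tauOdd n n = 0 := by
  rw [tauOdd, tauIntegral_piOdd_self, smul_zero]

lemma ffs_eq (n : ℕ) : ffs n = tauIntegral (piEven n n) := by
  rw [ffs, ffsPi_eq_piEven]

lemma tauTotal_two_mul {n k : ℕ} (hk : k ≤ n) : tauTotal n (2 * k) = tauEven n k := by
  -- With a variable `j` in place of `2 * k / 2`, the equation `j = k` can be substituted and the
  -- `Fin.cast` disappears.
  have h : ∀ j (hj : 2 * j = 2 * k),
      (fun a => tauEven n j (a ∘ Fin.cast (congrArg (· + 1) hj))) = tauEven n k := by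
    intro j hj
    obtain rfl : j = k := by omega
    rfl
  rw [tauTotal, dif_pos (by omega)]
  exact h _ (by omega)

lemma tauTotal_eq_zero {n m : ℕ} (h : ¬(m ≤ 2 * n ∧ m % 2 = (2 * n) % 2)) :
    tauTotal n m = 0 := by
  rw [tauTotal, dif_neg (by omega)]

lemma tauTotal_mem (n : ℕ) : tauTotal n ∈ TotCochain Coeff (Weyl n) (2 * n) := by
  refine ⟨fun m => ?_, fun m h => tauTotal_eq_zero h⟩
  by_cases h : m ≤ 2 * n ∧ m % 2 = (2 * n) % 2
  · obtain ⟨k, rfl⟩ : ∃ k, m = 2 * k := ⟨m / 2, by omega⟩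
    rw [tauTotal_two_mul (by omega)]
    exact tauEven_mem n k
  · rw [tauTotal_eq_zero h]
    exact Submodule.zero_mem _

/-- In degree `2 k + 1` the coboundary of `τ_{2k}` and the Connes operator of `τ_{2k+2}` cancel. For
`k = n` the second is absent and the first is `τ_{2n+1} = 0`; the remaining degrees vanish by parity
or size. -/
lemma totD_tauTotal (n : ℕ) : totD (tauTotal n) = 0 := by
  funext m
  cases m with
  | zero =>
    rw [totD, tauTotal_eq_zero (by omega), connesB_zero, Pi.zero_apply]
  | succ m =>
    rw [totD, Pi.zero_apply]
    by_cases h : m ≤ 2 * n ∧ m % 2 = (2 * n) % 2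
    · obtain ⟨k, rfl⟩ : ∃ k, m = 2 * k := ⟨m / 2, by omega⟩
      rw [tauTotal_two_mul (by omega), hochschildB_tauEven]
      rcases (show k ≤ n by omega).lt_or_eq with hk | rfl
      · have h1 : tauTotal n (2 * k + 2) = tauEven n (k + 1) := tauTotal_two_mul hk
        rw [h1, ← neg_connesB_tauEven]
        exact neg_add_cancel _
      · rw [tauOdd_self, tauTotal_eq_zero (by omega), connesB_zero, add_zero]
    · rw [tauTotal_eq_zero h, tauTotal_eq_zero (by omega), hochschildB_zero, connesB_zero, add_zero]

end Cocycle

end WeylCyclic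
end

theorem mainTheorem4 (n : ℕ) :
    (∀ k ≤ n, WeylCyclic.tauEven n k ∈
      WeylCyclic.NormalizedCochain WeylCyclic.Coeff (WeylCyclic.Weyl n) (2 * k)) ∧
    (∀ k < n, WeylCyclic.tauOdd n k ∈
      WeylCyclic.NormalizedCochain WeylCyclic.Coeff (WeylCyclic.Weyl n) (2 * k + 1)) ∧
    (∀ k < n,
      -WeylCyclic.connesB (k := 2 * k + 1) (WeylCyclic.tauEven n (k + 1))
          = WeylCyclic.tauOdd n k ∧
        WeylCyclic.tauOdd n k = WeylCyclic.hochschildB (WeylCyclic.tauEven n k)) ∧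
    (WeylCyclic.tauTotal n ∈
        WeylCyclic.TotCochain WeylCyclic.Coeff (WeylCyclic.Weyl n) (2 * n) ∧
      WeylCyclic.totD (WeylCyclic.tauTotal n) = 0) ∧
    (WeylCyclic.tauEven n n = (-1 : WeylCyclic.Coeff) ^ n • WeylCyclic.ffs n ∧
      WeylCyclic.hochschildB (WeylCyclic.ffs n) = 0) :=
  ⟨fun k _ => WeylCyclic.tauEven_mem n k, fun k _ => WeylCyclic.tauOdd_mem n k,
    fun k _ => ⟨WeylCyclic.neg_connesB_tauEven n k, (WeylCyclic.hochschildB_tauEven n k).symm⟩,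
    ⟨WeylCyclic.tauTotal_mem n, WeylCyclic.totD_tauTotal n⟩,
    by rw [WeylCyclic.ffs_eq]; rfl,
    by rw [WeylCyclic.ffs_eq, WeylCyclic.hochschildB_tauIntegral_piEven,
      WeylCyclic.tauIntegral_piOdd_self]⟩
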